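/- **Particle systems.** Fix a finite set of types, a speed $s_a>0$ for each type $a$ with $\sum_a s_a=1$, and for each pair of types $a,b$ (possibly equal) a probability distribution $\pi_{ab}=\pi_{ba}$ on finite multisets of types. A particle of type $a$ meeting one of type $b$ is a reaction: both are removed and replaced by particles whose types form a multiset $S\sim\pi_{ab}$, sampled independently of everything else. The reaction is effective if $S\ne\{a,b\}$. The system is dissipative if types can be given positive energies such that every effective reaction of positive probability strictly decreases the total energy. **Dynamics.** On a graph $G$, a configuration is a finite multiset of particles, each with a type and a vertex (several particles may share a vertex). In each time step one particle is chosen with probability proportional to the speed of its type. It moves to a uniformly random neighbour of its vertex and meets the other particles there in uniformly random order, until an effective reaction occurs (the new particles are placed at that vertex) or all of these meetings are ineffective. The equilibrium time $T$ is the first time at which no two particles present have types that can react effectively with positive probability. **Persistence.** Let $(G_j)_{j\in J}$ be a family of graphs, $G_j$ having $n_j$ vertices, with initial configurations $X_j$. A type $a$ is persistent if there is $\varepsilon>0$, independent of $j$, such that for every $j$ the number of particles of type $a$ stays at least $\varepsilon n_j$ throughout every sequence of positive-probability reactions starting from the population of $X_j$, where any two particles may react regardless of their positions. All other types are ephemeral.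 The system with these initial configurations is agential if no effective reaction of positive probability has two (possibly equal) ephemeral types as input. **Expanders.** $(G_j)$ is a regular expander family if each $G_j$ is a connected $d_j$-regular simple graph on $n_j\ge2$ vertices and there is $c>0$ such that $1-\mu_2(G_j)\ge c$ for all $j$, where $\mu_2(G_j)$ is the second largest eigenvalue of the lazy random walk matrix $\frac12 I+\frac1{2d_j}A(G_j)$. **Theorem.** Let $(G_j)_{j\in J}$ be a regular expander family (for instance a sequence). Consider a dissipative particle system started on each $G_j$ from a configuration $X_j$ with at most $n_j$ particles, and suppose that it is agential. Let $T_j$ be the equilibrium time on $G_j$ from $X_j$. Then there is a constant $C>0$ such that $\mathbb E[T_j]\le C n_j\log n_j$ for every $j$, and such that $T_j\le Cn_j\log n_j$ with high probability: for every $\eta>0$ there is $N$ such that $\mathbb P(T_j> C n_j\log n_j)\le\eta$ for all $j$ with $n_j\ge N$. -/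

import Mathlib

open scoped NNReal ENNReal

noncomputable section

/-! ### Regular expander families -/

/-- The transition matrix `(1/2) I + (1/(2d)) A` of the lazy random walk on a `d`-regular graph. -/
def lazyWalkMatrix {V : Type*} [Fintype V] [DecidableEq V] (G : SimpleGraph V)
    [DecidableRel G.Adj] (d : ℕ) : Matrix V V ℝ :=
  (1 / 2 : ℝ) • (1 : Matrix V V ℝ) + (1 / (2 * (d : ℝ))) • G.adjMatrix ℝ

theorem lazyWalkMatrix_isHermitian {V : Type*} [Fintype V] [DecidableEq V] (G : SimpleGraph V)
    [DecidableRel G.Adj] (d : ℕ) : (lazyWalkMatrix G d).IsHermitian := by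
  ext i j
  simp [lazyWalkMatrix, Matrix.one_apply, G.adj_comm, eq_comm]

/-- The second largest eigenvalue (with multiplicity) of the lazy random walk matrix; Mathlib's
`eigenvalues₀` lists the eigenvalues in decreasing order, starting from index `0`. -/
def secondEigenvalue {V : Type*} [Fintype V] [DecidableEq V] (G : SimpleGraph V)
    [DecidableRel G.Adj] (d : ℕ) (h : 1 < Fintype.card V) : ℝ :=
  (lazyWalkMatrix_isHermitian G d).eigenvalues₀ ⟨1, h⟩

/-- A family of connected regular graphs (each on at least two vertices, the degrees may vary)
whose spectral gaps are bounded away from `0`. -/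
def IsRegularExpanderFamily {J : Type*} {V : J → Type*} [∀ j, Fintype (V j)]
    [∀ j, DecidableEq (V j)] (G : ∀ j, SimpleGraph (V j)) [∀ j, DecidableRel (G j).Adj] : Prop :=
  ∃ c : ℝ, 0 < c ∧ ∀ j, (G j).Connected ∧
    ∃ (d : ℕ) (h : 1 < Fintype.card (V j)),
      (G j).IsRegularOfDegree d ∧ c ≤ 1 - secondEigenvalue (G j) d h

/-! ### Particle systems -/

/-- A particle system with finite set of types `ι`: for each input pair of types a probability
distribution on outputs (finite multisets of types), and a positive speed for each type. -/
structure ParticleSystem (ι : Type*) [Fintype ι] where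
  react : ι → ι → PMF (Multiset ι)
  react_symm : ∀ a b, react a b = react b a
  speed : ι → ℝ≥0
  speed_pos : ∀ a, 0 < speed a
  sum_speed : ∑ a, speed a = 1

namespace ParticleSystem

variable {ι : Type*} [Fintype ι] (R : ParticleSystem ι)

/-- `S` is the output of an effective reaction with input `{a, b}`: it has positive probability
and differs from the input. -/
def EffectiveOutput (a b : ι) (S : Multiset ι) : Prop :=
  S ∈ (R.react a b).support ∧ S ≠ {a, b}

/-- Some effective reaction between the types `a` and `b` is possible. -/
def HasEffectiveReaction (a b : ι) : Prop := ∃ S, R.EffectiveOutput a b S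

/-- Types can be given positive energies so that every effective reaction strictly decreases the
total energy. -/
def Dissipative : Prop :=
  ∃ e : ι → ℝ, (∀ a, 0 < e a) ∧
    ∀ a b S, R.EffectiveOutput a b S → (S.map e).sum < e a + e b

/-- One mean-field reaction: any two particles of the population `m` (recorded as the multiset of
the types of its particles) react, wherever they are. -/
def MeanFieldStep (m m' : Multiset ι) : Prop :=
  ∃ (a b : ι) (rest S : Multiset ι),
    S ∈ (R.react a b).support ∧ m = {a, b} + rest ∧ m' = S + rest

/-- `m'` can be obtained from `m` by a finite sequence of mean-field reactions. -/
def MeanFieldReachable (m m' : Multiset ι) : Prop :=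
  Relation.ReflTransGen R.MeanFieldStep m m'

/-- For a family of initial populations `m j`, with scale parameters `n j`: the type `a` is
persistent if, for some `ε > 0` not depending on `j`, its density (number of particles divided
by `n j`) stays at least `ε` throughout any sequence of mean-field reactions from `m j`. -/
def Persistent [DecidableEq ι] {J : Type*} (n : J → ℕ) (m : J → Multiset ι) (a : ι) : Prop :=
  ∃ ε : ℝ, 0 < ε ∧ ∀ j m', R.MeanFieldReachable (m j) m' → ε * (n j : ℝ) ≤ (m'.count a : ℝ)

/-- There is no effective reaction between two ephemeral (that is, not persistent) types, which
may be equal. -/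
def Agential [DecidableEq ι] {J : Type*} (n : J → ℕ) (m : J → Multiset ι) : Prop :=
  ∀ a b, ¬ R.Persistent n m a → ¬ R.Persistent n m b → ¬ R.HasEffectiveReaction a b

end ParticleSystem

/-! ### The process on a graph -/

/-- A configuration: a finite multiset of particles, each with a type and a position. -/
abbrev Config (ι V : Type*) := Multiset (ι × V)

instance Config.instMeasurableSpace (ι V : Type*) : MeasurableSpace (Config ι V) := ⊤

instance Config.instDiscreteMeasurableSpace (ι V : Type*) :
    DiscreteMeasurableSpace (Config ι V) := ⟨fun _ => trivial⟩

/-- The population of a configuration, forgetting positions. -/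
def Config.types {ι V : Type*} (X : Config ι V) : Multiset ι := X.map Prod.fst

/-- The types of the particles located at `v`. -/
def Config.typesAt {ι V : Type*} [DecidableEq V] (X : Config ι V) (v : V) : Multiset ι :=
  (X.filter fun p => p.2 = v).map Prod.fst

/-- A simple random walk step from `u` (an isolated vertex stays in place). -/
def walkStep {V : Type*} [Fintype V] [DecidableEq V] (G : SimpleGraph V) [DecidableRel G.Adj]
    (u : V) : PMF V :=
  if h : (G.neighborFinset u).Nonempty then PMF.uniformOfFinset (G.neighborFinset u) h
  else PMF.pure u

namespace ParticleSystem

variable {ι : Type*} [Fintype ι] [DecidableEq ι] (R : ParticleSystem ι)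
variable {V : Type*} [DecidableEq V]

/-- The weight of the particles of type `p.1` at position `p.2`: each particle has its speed. -/
def weight (X : Config ι V) (p : ι × V) : ℝ≥0∞ := (X.count p : ℝ≥0∞) * (R.speed p.1 : ℝ≥0∞)

theorem tsum_weight_ne_zero {X : Config ι V} (hX : X ≠ 0) : ∑' p, R.weight X p ≠ 0 := by
  obtain ⟨p, hp⟩ := Multiset.exists_mem_of_ne_zero hX
  intro h
  have h1 := ENNReal.tsum_eq_zero.1 h p
  have h2 : R.speed p.1 ≠ 0 := (R.speed_pos p.1).ne'
  have h3 : X.count p ≠ 0 := (Multiset.count_pos.2 hp).ne'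
  simp [weight] at h1
  tauto

variable [Fintype V]

theorem tsum_weight_ne_top (X : Config ι V) : ∑' p, R.weight X p ≠ ∞ := by
  rw [tsum_fintype]
  refine ENNReal.sum_ne_top.2 fun p _ => ?_
  exact ENNReal.mul_ne_top (ENNReal.natCast_ne_top _) ENNReal.coe_ne_top

/-- Choose a particle of a non-empty configuration with probability proportional to its speed. -/
def pick (X : Config ι V) (hX : X ≠ 0) : PMF (ι × V) :=
  PMF.normalize (R.weight X) (R.tsum_weight_ne_zero hX) (R.tsum_weight_ne_top X)

/-- A particle of type `a` meets particles of the types in the list, in this order, until an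
effective reaction occurs: the result is `some (b, S)` if it has an effective reaction with output
`S` with a particle of type `b`, and `none` if no reaction is effective. -/
def meetInOrder (a : ι) : List ι → PMF (Option (ι × Multiset ι))
  | [] => PMF.pure none
  | b :: l => (R.react a b).bind fun S =>
      if S = {a, b} then meetInOrder a l else PMF.pure (some (b, S))

/-- The list of types of the particles in a population, in uniformly random order. -/
def randomOrder (s : Multiset ι) : PMF (List ι) :=
  PMF.ofMultiset s.lists (by
    induction s using Quotient.inductionOn with
    | h l =>
      intro h
      have h1 : l ∈ ((↑l : Multiset ι).lists) := by simp
      have h2 : l ∈ (0 : Multiset (List ι)) := h ▸ h1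
      simp at h2)

/-- A particle of type `a` arrives at `v`, where `X` is the configuration of the other particles. -/
def arrive (X : Config ι V) (a : ι) (v : V) : PMF (Config ι V) :=
  (randomOrder (X.typesAt v)).bind fun l =>
    (R.meetInOrder a l).map fun o =>
      match o with
      | none => (a, v) ::ₘ X
      | some (b, S) => S.map (fun c => (c, v)) + X.erase (b, v)

/-- One step of the process: a particle is chosen with probability proportional to its speed,
takes a simple random walk step, and meets the particles at its new position. (The empty
configuration does not change.) -/
def step (G : SimpleGraph V) [DecidableRel G.Adj] (X : Config ι V) : PMF (Config ι V) :=
  if hX : X = 0 then PMF.pure 0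
  else (R.pick X hX).bind fun p =>
    (walkStep G p.2).bind fun v => R.arrive (X.erase p) p.1 v

/-- No further effective reaction is possible: no two particles present have types with an
effective reaction. -/
def IsEquilibrium (X : Config ι V) : Prop :=
  ∀ a b, ({a, b} : Multiset ι) ≤ X.types → ¬ R.HasEffectiveReaction a b

/-- The first time at which a trajectory is in equilibrium (`⊤` if there is none). -/
def equilibriumTime (ω : ℕ → Config ι V) : ℕ∞ :=
  ⨅ (t : ℕ) (_ : R.IsEquilibrium (ω t)), (t : ℕ∞)

end ParticleSystem

/-- The Markov kernel on a discrete space given by transition probabilities `K`. -/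
def transitionKernel {S : Type*} [MeasurableSpace S] [DiscreteMeasurableSpace S]
    (K : S → PMF S) : ProbabilityTheory.Kernel S S :=
  ⟨fun x => (K x).toMeasure, Measurable.of_discrete⟩

instance transitionKernel.instIsMarkovKernel {S : Type*} [MeasurableSpace S]
    [DiscreteMeasurableSpace S] (K : S → PMF S) :
    ProbabilityTheory.IsMarkovKernel (transitionKernel K) :=
  ⟨fun x => PMF.toMeasure.isProbabilityMeasure (K x)⟩

/-- The law, on the space of trajectories, of the Markov chain with transition probabilities `K`
started at `x`. -/
def markovChainLaw {S : Type*} [MeasurableSpace S] [DiscreteMeasurableSpace S]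
    (K : S → PMF S) (x : S) : MeasureTheory.Measure (ℕ → S) :=
  ProbabilityTheory.Kernel.traj (X := fun _ => S)
    (fun n => (transitionKernel K).comap
      (fun h : (Finset.Iic n → S) => h ⟨n, Finset.mem_Iic.2 le_rfl⟩) (measurable_pi_apply _))
    0 (fun _ => x)

/-- The law of the particle system `R` on the graph `G` started from the configuration `X`. -/
def ParticleSystem.law {ι : Type*} [Fintype ι] [DecidableEq ι] (R : ParticleSystem ι)
    {V : Type*} [Fintype V] [DecidableEq V] (G : SimpleGraph V) [DecidableRel G.Adj]
    (X : Config ι V) : MeasureTheory.Measure (ℕ → Config ι V) :=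
  markovChainLaw (R.step G) X

end

/-! Everything follows from a bound P(not in equilibrium at time t) ≤ (1 + η/n)^(-t) D n^A
(`exists_law_le`). After order n log n steps the geometric factor beats the polynomial, and summing
over t bounds the expectation. The bound itself comes from a potential that contracts by the factor
(1 + η/n)⁻¹ in expectation on reachable configurations and is at least 1 off equilibrium
(`markovChainLaw_le_of_drift`).

The potentials are sums of F(i, X - i) over the particles i of X. The presence of a particle does
not favour the outcomes that spare it (`count_sub_mul_meetLaw_le`). Hence, apart from newly created
particles, a potential evolves at most as if each particle were a single tagged walker, killed when
it moves and reacts, in an environment that ignores it (`expect_step_potential_le`). This removes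
the interaction between the tagged particle and its environment.

For a walker of type b that reacts with a type a having at least εn particles, take for F the
expected sum of the powers (1 + η/n)^t up to killing or up to the time when the environment stops
being dense in a. This F satisfies a Lyapunov inequality by construction; the point is that it is
polynomial in n. Its ℓ² norm in the position of the walker is bounded by M · crowding^(θ/n), where
the crowding is the product of the factorials x_v! of the numbers of a-particles at the vertices
times L^energy (`sum_survival_sq_le`). The induction needs a gain of order 1/n per step, obtained
from a dichotomy (`exists_contraction`). If the a-particles occupy a positive fraction of the
vertices, the spectral gap makes the killed walk contract (`HasWalkGap.sum_killed_le`). Otherwise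
the gap, applied to the function √x_v, shows that the power of the crowding decreases in expectation
(`spreadRate_le`, `crowdingRate_le`). Reactions do no harm, since they lose energy and L is large
enough to pay for the factorials. The logarithm of the crowding is O(n log n), so its power θ/n is
polynomial in n.

It remains to assemble the walkers. If no two persistent types react, agentiality forces every
effective reaction to join one persistent and one ephemeral type. Ephemeral particles get weights
that grow along the well-founded relation `Begets`, so that the decrease due to the ephemeral
particle about to be consumed pays for the particles created from it (`expect_step_agentWeight_le`).
If two persistent types do react, dissipation bounds n (`card_lt_of_reactive`). Then a potential
which restarts at each reaction, weighted by a power T^energy, suffices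
(`expect_step_frozenPotential_le`). -/

set_option linter.unusedSectionVars false

noncomputable section

/-! ### Expectations with respect to a probability mass function -/

/-- The expectation of a nonnegative function. -/
def PMF.expect {α : Type*} (p : PMF α) (f : α → ℝ≥0∞) : ℝ≥0∞ := ∑' a, p a * f a

namespace PMF

variable {α β : Type*}

theorem expect_mono {p : PMF α} {f g : α → ℝ≥0∞} (h : ∀ a ∈ p.support, f a ≤ g a) :
    p.expect f ≤ p.expect g := by
  refine ENNReal.tsum_le_tsum fun a => ?_
  by_cases ha : p a = 0
  · simp [ha]
  · gcongr
    exact h a ((mem_support_iff _ _).2 ha)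

theorem expect_congr {p : PMF α} {f g : α → ℝ≥0∞} (h : ∀ a ∈ p.support, f a = g a) :
    p.expect f = p.expect g :=
  le_antisymm (expect_mono fun a ha => (h a ha).le) (expect_mono fun a ha => (h a ha).ge)

@[simp] theorem expect_const (p : PMF α) (c : ℝ≥0∞) : p.expect (fun _ => c) = c := by
  simp [expect, ENNReal.tsum_mul_right, p.tsum_coe]

theorem expect_le_of_le {p : PMF α} {f : α → ℝ≥0∞} {c : ℝ≥0∞} (h : ∀ a ∈ p.support, f a ≤ c) :
    p.expect f ≤ c :=
  (expect_mono h).trans (expect_const p c).le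

@[simp] theorem expect_pure (a : α) (f : α → ℝ≥0∞) : (PMF.pure a).expect f = f a := by
  classical
  rw [expect, tsum_eq_single a]
  · simp
  · intro b hb
    simp [PMF.pure_apply, hb]

@[simp] theorem expect_bind (p : PMF α) (k : α → PMF β) (f : β → ℝ≥0∞) :
    (p.bind k).expect f = p.expect fun a => (k a).expect f := by
  simp only [expect, PMF.bind_apply, ← ENNReal.tsum_mul_right, ← ENNReal.tsum_mul_left]
  rw [ENNReal.tsum_comm]
  simp only [mul_assoc]

@[simp] theorem expect_map (p : PMF α) (g : α → β) (f : β → ℝ≥0∞) :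
    (p.map g).expect f = p.expect fun a => f (g a) := by
  rw [← PMF.bind_pure_comp]
  simp [Function.comp_def]

theorem expect_add (p : PMF α) (f g : α → ℝ≥0∞) :
    p.expect (fun a => f a + g a) = p.expect f + p.expect g := by
  simp only [expect, mul_add, ENNReal.tsum_add]

theorem expect_mul_left (p : PMF α) (c : ℝ≥0∞) (f : α → ℝ≥0∞) :
    p.expect (fun a => c * f a) = c * p.expect f := by
  simp only [expect, ← ENNReal.tsum_mul_left]
  exact tsum_congr fun a => by ring

theorem expect_finset_sum {κ : Type*} (p : PMF α) (s : Finset κ) (f : κ → α → ℝ≥0∞) :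
    p.expect (fun a => ∑ i ∈ s, f i a) = ∑ i ∈ s, p.expect (f i) := by
  classical
  induction s using Finset.induction_on with
  | empty => simp
  | insert i s hi ih => simp [Finset.sum_insert hi, expect_add, ih]

theorem expect_multiset_sum {κ : Type*} (p : PMF α) (s : Multiset κ) (f : κ → α → ℝ≥0∞) :
    p.expect (fun a => (s.map fun i => f i a).sum) = (s.map fun i => p.expect (f i)).sum := by
  induction s using Multiset.induction_on with
  | empty => simp
  | cons i s ih => simp [expect_add, ih]

theorem expect_fintype [Fintype α] (p : PMF α) (f : α → ℝ≥0∞) :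
    p.expect f = ∑ a, p a * f a := tsum_fintype _

end PMF

/-! ### Markov chains -/

section MarkovChain

open MeasureTheory ProbabilityTheory

variable {S : Type*} [MeasurableSpace S] [DiscreteMeasurableSpace S]

theorem PMF.lintegral_toMeasure [Countable S] (p : PMF S) (f : S → ℝ≥0∞) :
    ∫⁻ y, f y ∂p.toMeasure = p.expect f := by
  rw [lintegral_countable']
  refine tsum_congr fun a => ?_
  rw [PMF.toMeasure_apply_singleton _ _ (measurableSet_singleton a), mul_comm]

instance markovChainLaw.instIsProbabilityMeasure (K : S → PMF S) (x : S) :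
    IsProbabilityMeasure (markovChainLaw K x) := by
  unfold markovChainLaw; infer_instance

theorem lintegral_markovChainLaw_zero (K : S → PMF S) (x : S) (f : S → ℝ≥0∞) :
    ∫⁻ ω, f (ω 0) ∂(markovChainLaw K x) = f x := by
  have hf : Measurable f := Measurable.of_discrete
  have h := Kernel.traj_map_frestrictLe_apply (X := fun _ => S)
    (κ := fun n => (transitionKernel K).comap
      (fun h : (Finset.Iic n → S) => h ⟨n, Finset.mem_Iic.2 le_rfl⟩) (measurable_pi_apply _))
    0 0 (fun _ => x)
  rw [Kernel.partialTraj_self, Kernel.id_apply] at h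
  have hg : Measurable fun y : (Finset.Iic 0 → S) => f (y ⟨0, Finset.mem_Iic.2 le_rfl⟩) :=
    hf.comp (measurable_pi_apply _)
  have h2 : ∫⁻ ω, f (ω 0) ∂(markovChainLaw K x) =
      ∫⁻ y : (Finset.Iic 0 → S), f (y ⟨0, Finset.mem_Iic.2 le_rfl⟩)
        ∂((markovChainLaw K x).map (Preorder.frestrictLe 0)) := by
    rw [lintegral_map hg (Preorder.measurable_frestrictLe 0)]
    rfl
  rw [h2]
  unfold markovChainLaw
  rw [h, lintegral_dirac' _ hg]

theorem lintegral_markovChainLaw_succ (K : S → PMF S) (x : S) (f : S → ℝ≥0∞) (t : ℕ) :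
    ∫⁻ ω, f (ω (t + 1)) ∂(markovChainLaw K x) =
      ∫⁻ ω, (∫⁻ y, f y ∂(K (ω t)).toMeasure) ∂(markovChainLaw K x) := by
  have hf : Measurable f := Measurable.of_discrete
  have h := Kernel.partialTraj_compProd_eq_map_traj (X := fun _ => S)
    (κ := fun n => (transitionKernel K).comap
      (fun h : (Finset.Iic n → S) => h ⟨n, Finset.mem_Iic.2 le_rfl⟩) (measurable_pi_apply _))
    (Nat.zero_le t) (x₀ := fun _ => x)
  have hs : Measurable fun z : (Finset.Iic t → S) × S => f z.2 := hf.comp measurable_snd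
  have h1 : ∫⁻ ω, f (ω (t + 1)) ∂(markovChainLaw K x) =
      ∫⁻ z : (Finset.Iic t → S) × S, f z.2
        ∂((markovChainLaw K x).map (fun ω => (Preorder.frestrictLe t ω, ω (t + 1)))) := by
    rw [lintegral_map hs (by fun_prop)]
  have h3 : Measurable fun y : S => ∫⁻ z, f z ∂(K y).toMeasure := Measurable.of_discrete
  have h2 : ∫⁻ ω, (∫⁻ y, f y ∂(K (ω t)).toMeasure) ∂(markovChainLaw K x) =
      ∫⁻ y : (Finset.Iic t → S),
        (∫⁻ z, f z ∂(K (y ⟨t, Finset.mem_Iic.2 le_rfl⟩)).toMeasure)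
        ∂((markovChainLaw K x).map (Preorder.frestrictLe t)) := by
    have hg : Measurable fun y : (Finset.Iic t → S) =>
        ∫⁻ z, f z ∂(K (y ⟨t, Finset.mem_Iic.2 le_rfl⟩)).toMeasure :=
      h3.comp (measurable_pi_apply _)
    rw [lintegral_map hg (by fun_prop)]
    rfl
  rw [h1, h2]
  unfold markovChainLaw
  rw [← h, Kernel.traj_map_frestrictLe_apply,
    Measure.lintegral_compProd hs]
  rfl

theorem lintegral_markovChainLaw_le_pow [Countable S] (K : S → PMF S) (x : S) (Φ : S → ℝ≥0∞)
    (r : ℝ≥0∞) (h : ∀ y, (K y).expect Φ ≤ r * Φ y) (t : ℕ) :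
    ∫⁻ ω, Φ (ω t) ∂(markovChainLaw K x) ≤ r ^ t * Φ x := by
  induction t with
  | zero => simp [lintegral_markovChainLaw_zero]
  | succ t ih =>
    rw [lintegral_markovChainLaw_succ]
    have hΦ : Measurable fun ω : ℕ → S => Φ (ω t) :=
      (Measurable.of_discrete (f := Φ)).comp (measurable_pi_apply t)
    calc ∫⁻ ω, (∫⁻ y, Φ y ∂(K (ω t)).toMeasure) ∂(markovChainLaw K x)
        ≤ ∫⁻ ω, r * Φ (ω t) ∂(markovChainLaw K x) :=
          lintegral_mono fun ω => by rw [PMF.lintegral_toMeasure]; exact h _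
      _ = r * ∫⁻ ω, Φ (ω t) ∂(markovChainLaw K x) := lintegral_const_mul _ hΦ
      _ ≤ r * (r ^ t * Φ x) := by gcongr
      _ = r ^ (t + 1) * Φ x := by ring

/-- If a potential `Φ` contracts in expectation by the factor `r` along an invariant set of states,
and is at least `1` on the states of this set in `B`, then the chain is in `B` at time `t` with
probability at most `r ^ t * Φ x`. -/
theorem markovChainLaw_le_of_drift [Countable S] (K : S → PMF S) (x : S) (Φ : S → ℝ≥0∞)
    (r : ℝ≥0∞) (hr : r ≠ 0) (I : Set S) (hx : x ∈ I)
    (hI : ∀ y ∈ I, (K y).support ⊆ I) (h : ∀ y ∈ I, (K y).expect Φ ≤ r * Φ y)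
    (B : Set S) (hB : ∀ y ∈ I, y ∈ B → 1 ≤ Φ y) (t : ℕ) :
    markovChainLaw K x {ω | ω t ∈ B} ≤ r ^ t * Φ x := by
  classical
  -- The value ∞ outside `I` makes the drift inequality hold at every state, so that no conditioning
  -- on staying in `I` is needed. There `r ≠ 0` ensures `r * ∞ = ∞`.
  set Ψ : S → ℝ≥0∞ := fun y => if y ∈ I then Φ y else ∞ with hΨ
  have hd : ∀ y, (K y).expect Ψ ≤ r * Ψ y := by
    intro y
    by_cases hy : y ∈ I
    · have : (K y).expect Ψ = (K y).expect Φ :=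
        PMF.expect_congr fun a ha => by simp [hΨ, hI y hy ha]
      rw [this]
      simpa [hΨ, hy] using h y hy
    · simp [hΨ, hy, ENNReal.mul_top hr]
  have h1 : ∀ y, B.indicator 1 y ≤ Ψ y := by
    intro y
    by_cases hy : y ∈ B
    · by_cases hyI : y ∈ I
      · simpa [hΨ, hy, hyI] using hB y hyI hy
      · simp [hΨ, hyI]
    · simp [hy]
  have hm : MeasurableSet {ω : ℕ → S | ω t ∈ B} :=
    (measurable_pi_apply t) (MeasurableSet.of_discrete (s := B))
  calc markovChainLaw K x {ω | ω t ∈ B}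
      = ∫⁻ ω, B.indicator 1 (ω t) ∂(markovChainLaw K x) := by
        rw [← lintegral_indicator_one hm]; rfl
    _ ≤ ∫⁻ ω, Ψ (ω t) ∂(markovChainLaw K x) := lintegral_mono fun ω => h1 _
    _ ≤ r ^ t * Ψ x := lintegral_markovChainLaw_le_pow K x Ψ r hd t
    _ = r ^ t * Φ x := by simp [hΨ, hx]

end MarkovChain

/-! ### The equilibrium time and the states at fixed times -/

namespace ParticleSystem

variable {ι : Type*} [Fintype ι] (R : ParticleSystem ι) {V : Type*}

/-- All times before the first equilibrium are counted in the sum; later ones may be counted too, so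
absorption at equilibrium is not needed. The expectation of the equilibrium time is thereby
controlled by one-time marginals. -/
theorem equilibriumTime_le_tsum (ω : ℕ → Config ι V) :
    (R.equilibriumTime ω : ℝ≥0∞) ≤ ∑' t, {X | ¬ R.IsEquilibrium X}.indicator 1 (ω t) := by
  classical
  by_cases h : ∃ t, R.IsEquilibrium (ω t)
  · have h1 : R.equilibriumTime ω ≤ (Nat.find h : ℕ∞) :=
      iInf₂_le (f := fun (t : ℕ) (_ : R.IsEquilibrium (ω t)) => (t : ℕ∞)) _ (Nat.find_spec h)
    calc (R.equilibriumTime ω : ℝ≥0∞) ≤ ((Nat.find h : ℕ∞) : ℝ≥0∞) := by exact_mod_cast h1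
      _ = ∑ t ∈ Finset.range (Nat.find h), 1 := by simp
      _ = ∑ t ∈ Finset.range (Nat.find h), {X | ¬ R.IsEquilibrium X}.indicator 1 (ω t) := by
        refine Finset.sum_congr rfl fun t ht => ?_
        simp [Nat.find_min h (Finset.mem_range.1 ht)]
      _ ≤ _ := ENNReal.sum_le_tsum _
  · push Not at h
    have : ∑' t, ({X | ¬ R.IsEquilibrium X}.indicator 1 (ω t) : ℝ≥0∞) = ∞ := by
      simp [h]
    simp [this]

theorem not_isEquilibrium_of_lt_equilibriumTime (ω : ℕ → Config ι V) (x : ℝ) (hx : 0 ≤ x)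
    (h : ENNReal.ofReal x < (R.equilibriumTime ω : ℝ≥0∞)) : ¬ R.IsEquilibrium (ω ⌊x⌋₊) := by
  intro he
  have h1 : R.equilibriumTime ω ≤ (⌊x⌋₊ : ℕ∞) :=
    iInf₂_le (f := fun (t : ℕ) (_ : R.IsEquilibrium (ω t)) => (t : ℕ∞)) _ he
  have h2 : (R.equilibriumTime ω : ℝ≥0∞) ≤ ((⌊x⌋₊ : ℕ∞) : ℝ≥0∞) := by exact_mod_cast h1
  have h3 : ((⌊x⌋₊ : ℕ∞) : ℝ≥0∞) ≤ ENNReal.ofReal x := by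
    rw [ENat.toENNReal_coe, ← ENNReal.ofReal_natCast]
    exact ENNReal.ofReal_le_ofReal (Nat.floor_le hx)
  exact absurd h (not_lt.2 (h2.trans h3))

end ParticleSystem

/-! ### Random orders and meetings -/

namespace Multiset

variable {α : Type*}

theorem sum_map_eq_sum_count [Fintype α] [DecidableEq α] (s : Multiset α) (f : α → ℝ≥0∞) :
    (s.map f).sum = ∑ a, (s.count a : ℝ≥0∞) * f a := by
  induction s using Multiset.induction_on with
  | empty => simp
  | cons b s ih =>
    simp only [map_cons, sum_cons, ih, count_cons, Nat.cast_add, add_mul, Finset.sum_add_distrib]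
    rw [add_comm]
    congr 1
    rw [Finset.sum_eq_single b]
    · simp
    · intro c _ hc; simp [hc]
    · simp

theorem lists_zero : (0 : Multiset α).lists = {[]} := by
  rw [← coe_nil, lists_coe]
  simp

theorem lists_cons_eq_bind (a : α) (s : Multiset α) :
    (a ::ₘ s).lists = s.lists.bind fun l => (List.permutations'Aux a l : Multiset (List α)) := by
  induction s using Quotient.inductionOn with
  | h l =>
    have h1 (l : List α) : (↑l : Multiset α).lists = (↑(l.permutations') : Multiset (List α)) := by
      rw [lists_coe]
      exact coe_eq_coe.2 (List.permutations_perm_permutations' l)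
    rw [quot_mk_to_coe, cons_coe, h1, h1]
    simp [List.permutations', coe_bind]

/-- An ordering is a first element followed by an ordering of the rest. In the induction, the new
element `a` is inserted into the orderings of `t`: either in front, or behind a first element `b` of
`t`. -/
theorem lists_eq_bind [DecidableEq α] (s : Multiset α) (hs : s ≠ 0) :
    s.lists = s.bind fun b => ((s.erase b).lists.map fun l => b :: l) := by
  induction s using Multiset.induction_on with
  | empty => exact absurd rfl hs
  | cons a t ih =>
    rw [lists_cons_eq_bind, cons_bind, erase_cons_head]
    have h1 : (t.bind fun b => (((a ::ₘ t).erase b).lists.map fun l => b :: l)) =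
        t.bind fun b => (((t.erase b).lists.bind fun l =>
          (List.permutations'Aux a l : Multiset (List α))).map fun l => b :: l) := by
      refine bind_congr fun b hb => ?_
      rw [erase_cons_tail_of_mem hb, lists_cons_eq_bind]
    rw [h1]
    by_cases ht : t = 0
    · subst ht
      simp [lists_zero]
    · have h2 := ih ht
      have h3 : (t.bind fun b => ((t.erase b).lists.map fun l => b :: l)).bind
          (fun l => (List.permutations'Aux a l : Multiset (List α))) =
          (t.bind fun b => ((t.erase b).lists.map fun l => b :: l)).map (fun l => a :: l) +
          t.bind fun b => (((t.erase b).lists.bind fun l =>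
            (List.permutations'Aux a l : Multiset (List α))).map fun l => b :: l) := by
        rw [bind_assoc, map_bind, ← bind_add]
        refine bind_congr fun b _ => ?_
        rw [bind_map, map_map, map_bind]
        simp only [List.permutations'Aux, ← cons_coe, ← map_coe, bind_cons]
        rfl
      rwa [← h2] at h3

theorem card_lists (s : Multiset α) : card s.lists = (card s).factorial := by
  induction s using Quotient.inductionOn with
  | h l =>
    rw [quot_mk_to_coe, lists_coe, coe_card, coe_card, List.length_permutations]

end Multiset

theorem PMF.expect_ofMultiset {α : Type*} (s : Multiset α) (hs : s ≠ 0) (f : α → ℝ≥0∞) :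
    (PMF.ofMultiset s hs).expect f = (Multiset.card s : ℝ≥0∞)⁻¹ * (s.map f).sum := by
  classical
  rw [PMF.expect, Finset.sum_multiset_map_count, Finset.mul_sum, tsum_eq_sum (s := s.toFinset)]
  · refine Finset.sum_congr rfl fun a _ => ?_
    rw [PMF.ofMultiset_apply, ENNReal.div_eq_inv_mul, nsmul_eq_mul, mul_assoc]
  · intro a ha
    rw [PMF.ofMultiset_apply_of_notMem _ (by simpa using ha), zero_mul]

namespace ParticleSystem

variable {ι : Type*}

/-- In a uniformly random order the first element is uniform and the others are again in uniformly
random order. The cardinality is kept on the left to avoid divisions. -/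
theorem card_mul_expect_randomOrder [DecidableEq ι] (s : Multiset ι) (hs : s ≠ 0)
    (g : List ι → ℝ≥0∞) :
    (Multiset.card s : ℝ≥0∞) * (randomOrder s).expect g =
      (s.map fun b => (randomOrder (s.erase b)).expect fun l => g (b :: l)).sum := by
  unfold randomOrder
  simp only [PMF.expect_ofMultiset, Multiset.card_lists]
  conv_lhs => rw [Multiset.lists_eq_bind s hs, Multiset.map_bind, Multiset.sum_bind]
  obtain ⟨m, hm⟩ : ∃ m, Multiset.card s = m + 1 :=
    Nat.exists_eq_succ_of_ne_zero (by simpa using hs)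
  rw [← Multiset.sum_map_mul_left, ← Multiset.sum_map_mul_left]
  refine congrArg Multiset.sum (Multiset.map_congr rfl fun b hb => ?_)
  rw [Multiset.map_map, Multiset.card_erase_of_mem hb, hm, Nat.pred_succ, Nat.factorial_succ]
  rw [← mul_assoc]
  congr 1
  have h1 : ((m + 1 : ℕ) : ℝ≥0∞) ≠ 0 := by exact_mod_cast Nat.succ_ne_zero m
  have h2 : ((m + 1 : ℕ) : ℝ≥0∞) ≠ ∞ := ENNReal.natCast_ne_top _
  rw [Nat.cast_mul, ENNReal.mul_inv (Or.inl h1) (Or.inl h2), ← mul_assoc,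
    ENNReal.mul_inv_cancel h1 h2, one_mul]

variable [Fintype ι] [DecidableEq ι] (R : ParticleSystem ι)

/-- The law of the outcome when a particle of type `a` meets the particles of a population in
uniformly random order. -/
def meetLaw (a : ι) (s : Multiset ι) : PMF (Option (ι × Multiset ι)) :=
  (randomOrder s).bind (R.meetInOrder a)

/-- The probability that a meeting of types `a` and `b` gives the outcome `o`. -/
def outcomeProb (a b : ι) : Option (ι × Multiset ι) → ℝ≥0∞
  | none => 0
  | some (c, S) => if c = b ∧ S ≠ {a, b} then R.react a b S else 0

/-- The probability that a meeting of types `a` and `b` is ineffective. -/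
def idleProb (a b : ι) : ℝ≥0∞ := R.react a b {a, b}

theorem idleProb_le_one (a b : ι) : R.idleProb a b ≤ 1 := PMF.coe_le_one _ _

theorem meetInOrder_cons_apply (a b : ι) (l : List ι) (o : Option (ι × Multiset ι)) :
    R.meetInOrder a (b :: l) o = R.outcomeProb a b o + R.idleProb a b * R.meetInOrder a l o := by
  have hsplit : ∀ S : Multiset ι, R.react a b S *
      (if S = {a, b} then R.meetInOrder a l else PMF.pure (some (b, S))) o =
      (if S = {a, b} then R.idleProb a b * R.meetInOrder a l o else 0) +
      (if o = some (b, S) then R.outcomeProb a b o else 0) := by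
    intro S
    by_cases hS : S = {a, b}
    · subst hS
      by_cases ho : o = some (b, {a, b})
      · simp [-Multiset.insert_eq_cons, ho, outcomeProb, idleProb]
      · simp [-Multiset.insert_eq_cons, ho, idleProb]
    · by_cases ho : o = some (b, S)
      · simp [-Multiset.insert_eq_cons, hS, ho, outcomeProb]
      · simp [-Multiset.insert_eq_cons, hS, ho]
  rw [meetInOrder, PMF.bind_apply]
  simp only [hsplit]
  rw [ENNReal.tsum_add, tsum_ite_eq, add_comm]
  congr 1
  rcases o with _ | ⟨c, S⟩
  · simp [outcomeProb]
  · rw [tsum_eq_single S]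
    · by_cases hc : c = b
      · simp [hc]
      · simp [outcomeProb, hc]
    · intro S' hS'
      simp [hS'.symm]

/-- Conditioning on the first particle met: its reaction either decides the outcome, or is idle and
leaves the same problem for the remaining population. This recursion drives the induction on
populations. -/
theorem card_mul_meetLaw (a : ι) (s : Multiset ι) (hs : s ≠ 0) (o : Option (ι × Multiset ι)) :
    (Multiset.card s : ℝ≥0∞) * R.meetLaw a s o =
      ∑ b, (s.count b : ℝ≥0∞) *
        (R.outcomeProb a b o + R.idleProb a b * R.meetLaw a (s.erase b) o) := by
  have h (s : Multiset ι) : R.meetLaw a s o = (randomOrder s).expect fun l => R.meetInOrder a l o :=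
    PMF.bind_apply _ _ _
  rw [h, card_mul_expect_randomOrder s hs, Multiset.sum_map_eq_sum_count]
  refine Finset.sum_congr rfl fun b _ => ?_
  rw [h]
  simp only [meetInOrder_cons_apply, PMF.expect_add, PMF.expect_const, PMF.expect_mul_left]

theorem sum_count_mul_le_card_mul_meetLaw (a : ι) (s : Multiset ι)
    (o : Option (ι × Multiset ι)) :
    ∑ b, (s.count b : ℝ≥0∞) * (R.outcomeProb a b o + R.idleProb a b * R.meetLaw a (s.erase b) o) =
      (Multiset.card s : ℝ≥0∞) * R.meetLaw a s o := by
  by_cases hs : s = 0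
  · simp [hs]
  · exact (R.card_mul_meetLaw a s hs o).symm

/-- `1` if the outcome is a reaction with a particle of type `c`, and `0` otherwise. -/
def hitsType (c : ι) : Option (ι × Multiset ι) → ℕ
  | none => 0
  | some (b, _) => if b = c then 1 else 0

theorem hitsType_le_one (c : ι) (o : Option (ι × Multiset ι)) : hitsType c o ≤ 1 := by
  rcases o with _ | ⟨b, S⟩
  · simp [hitsType]
  · simp only [hitsType]; split_ifs <;> simp

theorem outcomeProb_eq_zero_of_hitsType (a c : ι) (o : Option (ι × Multiset ι))
    (h : hitsType c o = 0) : R.outcomeProb a c o = 0 := by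
  rcases o with _ | ⟨b, S⟩
  · rfl
  · simp only [hitsType] at h
    have : b ≠ c := by intro hb; simp [hb] at h
    simp [outcomeProb, this]

/-- The presence of a particle does not make more likely the outcomes that spare it: summed over
the particles of type `c`, the probability that `o` occurs and spares the particle is at most the
probability of `o` in its absence. -/
theorem count_sub_mul_meetLaw_le (a c : ι) (o : Option (ι × Multiset ι)) (s : Multiset ι)
    (hc : c ∈ s) :
    ((s.count c - hitsType c o : ℕ) : ℝ≥0∞) * R.meetLaw a s o ≤
      (s.count c : ℝ≥0∞) * R.meetLaw a (s.erase c) o := by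
  induction s using Multiset.strongInductionOn with
  | ih s ih =>
    have hs : s ≠ 0 := by rintro rfl; simp at hc
    set M := s.count c with hM
    set δ := hitsType c o with hδ
    have hM1 : 1 ≤ M := Multiset.one_le_count_iff_mem.2 hc
    have hδ1 : δ ≤ 1 := hitsType_le_one c o
    have hcard : ((Multiset.card s : ℕ) : ℝ≥0∞) = Multiset.card (s.erase c) + 1 := by
      rw [← Multiset.card_erase_add_one hc]; push_cast; rfl
    -- The recursions for `s` and `s.erase c` are compared term by term in the type `d` of the first
    -- particle met. The additional summand for `d = c` makes up for the two cardinalities differing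
    -- by one.
    have key : ∀ d, (s.count d : ℝ≥0∞) * (((M - δ : ℕ) : ℝ≥0∞) *
        (R.outcomeProb a d o + R.idleProb a d * R.meetLaw a (s.erase d) o)) ≤
        (M : ℝ≥0∞) * (((s.erase c).count d : ℝ≥0∞) *
          (R.outcomeProb a d o + R.idleProb a d * R.meetLaw a ((s.erase c).erase d) o)) +
        (if d = c then (M : ℝ≥0∞) * R.meetLaw a (s.erase c) o else 0) := by
      intro d
      by_cases hd : d = c
      · subst hd
        rw [if_pos rfl, Multiset.count_erase_self, ← hM]
        -- Either the outcome consumes a particle of this type and δ = 1, or a first meeting with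
        -- this type cannot produce it and both sides vanish.
        have h1 : ((M - δ : ℕ) : ℝ≥0∞) * R.outcomeProb a d o =
            ((M - 1 : ℕ) : ℝ≥0∞) * R.outcomeProb a d o := by
          by_cases h0 : δ = 0
          · rw [R.outcomeProb_eq_zero_of_hitsType a d o h0]; simp
          · rw [show δ = 1 by omega]
        have h2 : ((M - δ : ℕ) : ℝ≥0∞) * R.meetLaw a (s.erase d) o ≤
            ((M - 1 : ℕ) : ℝ≥0∞) * R.meetLaw a ((s.erase d).erase d) o +
              R.meetLaw a (s.erase d) o := by
          by_cases h2 : d ∈ s.erase d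
          · have h3 := ih (s.erase d) (Multiset.erase_lt.2 hc) h2
            rw [Multiset.count_erase_self, ← hM] at h3
            have h4 : ((M - δ : ℕ) : ℝ≥0∞) ≤ ((M - 1 - δ : ℕ) : ℝ≥0∞) + 1 := by
              exact_mod_cast (by omega : M - δ ≤ M - 1 - δ + 1)
            calc ((M - δ : ℕ) : ℝ≥0∞) * R.meetLaw a (s.erase d) o
                ≤ (((M - 1 - δ : ℕ) : ℝ≥0∞) + 1) * R.meetLaw a (s.erase d) o := by gcongr
              _ = ((M - 1 - δ : ℕ) : ℝ≥0∞) * R.meetLaw a (s.erase d) o +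
                  R.meetLaw a (s.erase d) o := by ring
              _ ≤ _ := by gcongr
          · have h3 : M - 1 = 0 := by
              rw [hM, ← Multiset.count_erase_self]; exact Multiset.count_eq_zero.2 h2
            have h4 : ((M - δ : ℕ) : ℝ≥0∞) ≤ 1 := by
              exact_mod_cast (by omega : M - δ ≤ 1)
            rw [h3]
            simp only [Nat.cast_zero, zero_mul, zero_add]
            calc _ ≤ 1 * R.meetLaw a (s.erase d) o := by gcongr
              _ = _ := one_mul _
        have h5 := R.idleProb_le_one a d
        calc (M : ℝ≥0∞) * (((M - δ : ℕ) : ℝ≥0∞) *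
              (R.outcomeProb a d o + R.idleProb a d * R.meetLaw a (s.erase d) o))
            = M * (((M - δ : ℕ) : ℝ≥0∞) * R.outcomeProb a d o) +
              M * (R.idleProb a d * (((M - δ : ℕ) : ℝ≥0∞) * R.meetLaw a (s.erase d) o)) := by ring
          _ ≤ M * (((M - 1 : ℕ) : ℝ≥0∞) * R.outcomeProb a d o) +
              M * (R.idleProb a d * (((M - 1 : ℕ) : ℝ≥0∞) *
                R.meetLaw a ((s.erase d).erase d) o + R.meetLaw a (s.erase d) o)) := by
              rw [h1]; gcongr
          _ = M * (((M - 1 : ℕ) : ℝ≥0∞) * (R.outcomeProb a d o +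
                R.idleProb a d * R.meetLaw a ((s.erase d).erase d) o)) +
              M * (R.idleProb a d * R.meetLaw a (s.erase d) o) := by ring
          _ ≤ M * (((M - 1 : ℕ) : ℝ≥0∞) * (R.outcomeProb a d o +
                R.idleProb a d * R.meetLaw a ((s.erase d).erase d) o)) +
              M * (1 * R.meetLaw a (s.erase d) o) := by gcongr
          _ = _ := by rw [one_mul]
      · rw [if_neg hd, add_zero, Multiset.count_erase_of_ne hd]
        by_cases hds : d ∈ s
        · have h1 : ((M - δ : ℕ) : ℝ≥0∞) * R.meetLaw a (s.erase d) o ≤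
              M * R.meetLaw a ((s.erase c).erase d) o := by
            have h := ih (s.erase d) (Multiset.erase_lt.2 hds)
              ((Multiset.mem_erase_of_ne (Ne.symm hd)).2 hc)
            rwa [Multiset.count_erase_of_ne (Ne.symm hd), Multiset.erase_comm] at h
          have h2 : ((M - δ : ℕ) : ℝ≥0∞) ≤ M := by exact_mod_cast Nat.sub_le _ _
          calc (s.count d : ℝ≥0∞) * (((M - δ : ℕ) : ℝ≥0∞) *
                (R.outcomeProb a d o + R.idleProb a d * R.meetLaw a (s.erase d) o))
              = s.count d * (((M - δ : ℕ) : ℝ≥0∞) * R.outcomeProb a d o) + s.count d *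
                (R.idleProb a d * (((M - δ : ℕ) : ℝ≥0∞) * R.meetLaw a (s.erase d) o)) := by ring
            _ ≤ s.count d * (M * R.outcomeProb a d o) + s.count d *
                (R.idleProb a d * (M * R.meetLaw a ((s.erase c).erase d) o)) := by gcongr
            _ = _ := by ring
        · simp [Multiset.count_eq_zero.2 hds]
    have h1 : (Multiset.card s : ℝ≥0∞) * (((M - δ : ℕ) : ℝ≥0∞) * R.meetLaw a s o) ≤
        (Multiset.card s : ℝ≥0∞) * ((M : ℝ≥0∞) * R.meetLaw a (s.erase c) o) := by
      calc (Multiset.card s : ℝ≥0∞) * (((M - δ : ℕ) : ℝ≥0∞) * R.meetLaw a s o)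
          = ((M - δ : ℕ) : ℝ≥0∞) * ((Multiset.card s : ℝ≥0∞) * R.meetLaw a s o) := by ring
        _ = ∑ d, (s.count d : ℝ≥0∞) * (((M - δ : ℕ) : ℝ≥0∞) *
              (R.outcomeProb a d o + R.idleProb a d * R.meetLaw a (s.erase d) o)) := by
          rw [R.card_mul_meetLaw a s hs, Finset.mul_sum]
          exact Finset.sum_congr rfl fun d _ => by ring
        _ ≤ ∑ d, ((M : ℝ≥0∞) * (((s.erase c).count d : ℝ≥0∞) *
              (R.outcomeProb a d o + R.idleProb a d * R.meetLaw a ((s.erase c).erase d) o)) +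
              (if d = c then (M : ℝ≥0∞) * R.meetLaw a (s.erase c) o else 0)) :=
          Finset.sum_le_sum fun d _ => key d
        _ = M * ((Multiset.card (s.erase c) : ℝ≥0∞) * R.meetLaw a (s.erase c) o) +
              M * R.meetLaw a (s.erase c) o := by
          rw [Finset.sum_add_distrib, ← Finset.mul_sum, R.sum_count_mul_le_card_mul_meetLaw]
          simp
        _ = _ := by rw [hcard]; ring
    have hc0 : (Multiset.card s : ℝ≥0∞) ≠ 0 := by
      simpa using hs
    exact (ENNReal.mul_le_mul_iff_right hc0 (ENNReal.natCast_ne_top _)).1 h1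

theorem meetInOrder_apply_some_ne_zero (a b : ι) (S : Multiset ι) (l : List ι)
    (h : R.meetInOrder a l (some (b, S)) ≠ 0) : b ∈ l ∧ R.EffectiveOutput a b S := by
  induction l with
  | nil => simp [meetInOrder] at h
  | cons c l ih =>
    rw [meetInOrder_cons_apply] at h
    by_cases h1 : R.outcomeProb a c (some (b, S)) = 0
    · rw [h1, zero_add] at h
      have := ih (right_ne_zero_of_mul h)
      exact ⟨List.mem_cons_of_mem _ this.1, this.2⟩
    · simp only [outcomeProb] at h1
      split_ifs at h1 with h2
      · obtain ⟨rfl, h3⟩ := h2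
        exact ⟨List.mem_cons_self, (PMF.mem_support_iff _ _).2 h1, h3⟩
      · exact absurd rfl h1

theorem meetLaw_apply_some_ne_zero (a b : ι) (S s : Multiset ι)
    (h : R.meetLaw a s (some (b, S)) ≠ 0) : b ∈ s ∧ R.EffectiveOutput a b S := by
  have h1 : some (b, S) ∈ (R.meetLaw a s).support := (PMF.mem_support_iff _ _).2 h
  rw [meetLaw, PMF.mem_support_bind_iff] at h1
  obtain ⟨l, hl, hl2⟩ := h1
  have h2 := R.meetInOrder_apply_some_ne_zero a b S l ((PMF.mem_support_iff _ _).1 hl2)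
  refine ⟨?_, h2.2⟩
  have h3 : l ∈ s.lists := by
    have := hl
    rw [randomOrder, PMF.mem_support_ofMultiset_iff] at this
    simpa using this
  have h4 : (↑l : Multiset ι) = s := by
    have := (Multiset.mem_lists_iff s l).1 h3
    simpa using this.symm
  rw [← h4]
  exact h2.1

/-- The probability that no reaction is effective is at most the idle probability with any of the
types present. -/
theorem meetLaw_none_le (a c : ι) (s : Multiset ι) (hc : c ∈ s) :
    R.meetLaw a s none ≤ R.idleProb a c := by
  have hl : ∀ l : List ι, c ∈ l → R.meetInOrder a l none ≤ R.idleProb a c := by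
    intro l hcl
    induction l with
    | nil => simp at hcl
    | cons b l ih =>
      rw [meetInOrder_cons_apply]
      simp only [outcomeProb, zero_add]
      rcases List.mem_cons.1 hcl with rfl | h
      · calc _ ≤ R.idleProb a c * 1 := by gcongr; exact PMF.coe_le_one _ _
          _ = _ := mul_one _
      · calc _ ≤ 1 * R.idleProb a c := by
              gcongr
              · exact R.idleProb_le_one _ _
              · exact ih h
          _ = _ := one_mul _
  have h : R.meetLaw a s none = (randomOrder s).expect fun l => R.meetInOrder a l none :=
    PMF.bind_apply _ _ _
  rw [h]
  refine PMF.expect_le_of_le fun l hl2 => hl l ?_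
  have h3 : l ∈ s.lists := by
    rw [randomOrder, PMF.mem_support_ofMultiset_iff] at hl2
    simpa using hl2
  have h4 : (↑l : Multiset ι) = s := by
    have := (Multiset.mem_lists_iff s l).1 h3
    simpa using this.symm
  rwa [← h4] at hc

end ParticleSystem

/-! ### Decomposition of one step of the process -/

/-- Both sides run over the ordered pairs of distinct particles. It serves to exchange the moving
particle with the tagged one. -/
theorem Multiset.sum_map_sum_map_erase {α : Type*} [Fintype α] [DecidableEq α] (s : Multiset α)
    (f : α → α → ℝ≥0∞) :
    (s.map fun p => ((s.erase p).map fun i => f p i).sum).sum =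
      (s.map fun i => ((s.erase i).map fun p => f p i).sum).sum := by
  simp only [Multiset.sum_map_eq_sum_count, Finset.mul_sum]
  rw [Finset.sum_comm]
  refine Finset.sum_congr rfl fun i _ => Finset.sum_congr rfl fun p _ => ?_
  by_cases h : i = p
  · rw [h]
  · rw [Multiset.count_erase_of_ne h, Multiset.count_erase_of_ne (Ne.symm h)]
    ring

theorem ENNReal.tsum_multiset_sum {α κ : Type*} (s : Multiset κ) (f : κ → α → ℝ≥0∞) :
    ∑' a, (s.map fun i => f i a).sum = (s.map fun i => ∑' a, f i a).sum := by
  induction s using Multiset.induction_on with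
  | empty => simp
  | cons i s ih => simp [ENNReal.tsum_add, ih]

theorem Multiset.sum_map_le_sum_map_of_mem {α : Type*} (s : Multiset α) (f g : α → ℝ≥0∞)
    (h : ∀ i ∈ s, f i ≤ g i) : (s.map f).sum ≤ (s.map g).sum :=
  Multiset.sum_map_le_sum_map f g h

/-! ### Types present at a vertex -/

namespace Config

variable {ι V : Type*} [DecidableEq ι] [DecidableEq V]

theorem count_typesAt (X : Config ι V) (c : ι) (v : V) :
    (X.typesAt v).count c = X.count (c, v) := by
  induction X using Multiset.induction_on with
  | empty => simp [typesAt]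
  | cons p X ih =>
    obtain ⟨b, w⟩ := p
    by_cases hw : w = v
    · subst hw
      have : typesAt ((b, w) ::ₘ X) w = b ::ₘ typesAt X w := by simp [typesAt]
      rw [this, Multiset.count_cons, Multiset.count_cons, ih]
      simp
    · have : typesAt ((b, w) ::ₘ X) v = typesAt X v := by simp [typesAt, hw]
      rw [this, ih, Multiset.count_cons_of_ne]
      intro h; exact hw (Prod.ext_iff.1 h).2.symm

theorem mem_typesAt {X : Config ι V} {c : ι} {v : V} : c ∈ X.typesAt v ↔ (c, v) ∈ X := by
  rw [← Multiset.count_pos, count_typesAt, Multiset.count_pos]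

theorem typesAt_erase_self (X : Config ι V) (c : ι) (v : V) :
    typesAt (X.erase (c, v)) v = (X.typesAt v).erase c := by
  ext d
  rw [count_typesAt]
  by_cases h : d = c
  · subst h
    rw [Multiset.count_erase_self, Multiset.count_erase_self, count_typesAt]
  · rw [Multiset.count_erase_of_ne h, Multiset.count_erase_of_ne (by simp [h]), count_typesAt]

theorem typesAt_erase_of_ne (X : Config ι V) (c : ι) {w v : V} (h : w ≠ v) :
    typesAt (X.erase (c, w)) v = X.typesAt v := by
  ext d
  rw [count_typesAt, Multiset.count_erase_of_ne (by simp [h.symm]), count_typesAt]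

/-- The particles of types `S`, all placed at the vertex `v`. -/
def placed (S : Multiset ι) (v : V) : Config ι V := S.map fun c => (c, v)

end Config

namespace ParticleSystem

variable {ι : Type*} [Fintype ι] [DecidableEq ι] (R : ParticleSystem ι)
variable {V : Type*} [DecidableEq V]

/-- The total speed of the particles of a configuration. -/
def speedSum (X : Config ι V) : ℝ≥0∞ := (X.map fun p => (R.speed p.1 : ℝ≥0∞)).sum

theorem speedSum_erase_add {X : Config ι V} {i : ι × V} (hi : i ∈ X) :
    (R.speed i.1 : ℝ≥0∞) + R.speedSum (X.erase i) = R.speedSum X := by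
  conv_rhs => rw [← Multiset.cons_erase hi]
  simp [speedSum]

theorem speedSum_ne_top (X : Config ι V) : R.speedSum X ≠ ∞ := by
  induction X using Multiset.induction_on with
  | empty => simp [speedSum]
  | cons p X ih =>
    simp only [speedSum, Multiset.map_cons, Multiset.sum_cons]
    exact ENNReal.add_ne_top.2 ⟨ENNReal.coe_ne_top, ih⟩

theorem speedSum_ne_zero {X : Config ι V} (hX : X ≠ 0) : R.speedSum X ≠ 0 := by
  obtain ⟨p, hp⟩ := Multiset.exists_mem_of_ne_zero hX
  rw [← R.speedSum_erase_add hp]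
  simp [(R.speed_pos p.1).ne']

/-- The configuration after a particle of type `a` has arrived at `v` and its meetings with the
other particles have had a given outcome. -/
def arrivalResult (X : Config ι V) (a : ι) (v : V) : Option (ι × Multiset ι) → Config ι V
  | none => (a, v) ::ₘ X
  | some (b, S) => Config.placed S v + X.erase (b, v)

theorem expect_arrive (X : Config ι V) (a : ι) (v : V) (f : Config ι V → ℝ≥0∞) :
    (R.arrive X a v).expect f =
      (R.meetLaw a (X.typesAt v)).expect fun o => f (arrivalResult X a v o) := by
  simp only [arrive, meetLaw, PMF.expect_bind, PMF.expect_map]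
  congr 1

/-- The arrival of the particle of type `a` at `v` either has no effect, or it is an effective
reaction with a particle at `v`. -/
theorem mem_support_arrive {X Y : Config ι V} {a : ι} {v : V}
    (h : Y ∈ (R.arrive X a v).support) :
    Y = (a, v) ::ₘ X ∨ ∃ b S, (b, v) ∈ X ∧ R.EffectiveOutput a b S ∧
      Y = Config.placed S v + X.erase (b, v) := by
  have h1 : ∃ o ∈ (R.meetLaw a (X.typesAt v)).support, arrivalResult X a v o = Y := by
    rw [arrive, PMF.mem_support_bind_iff] at h
    obtain ⟨l, hl, hl2⟩ := h
    rw [PMF.mem_support_map_iff] at hl2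
    obtain ⟨o, ho, rfl⟩ := hl2
    refine ⟨o, (PMF.mem_support_bind_iff _ _ _).2 ⟨l, hl, ho⟩, ?_⟩
    rcases o with _ | ⟨b, S⟩ <;> rfl
  obtain ⟨o, ho, rfl⟩ := h1
  rcases o with _ | ⟨b, S⟩
  · exact Or.inl rfl
  · have := R.meetLaw_apply_some_ne_zero a b S _ ((PMF.mem_support_iff _ _).1 ho)
    exact Or.inr ⟨b, S, Config.mem_typesAt.1 this.1, this.2, rfl⟩

variable [Fintype V] (G : SimpleGraph V) [DecidableRel G.Adj]

theorem expect_step {X : Config ι V} (hX : X ≠ 0) (f : Config ι V → ℝ≥0∞) :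
    (R.step G X).expect f = (R.speedSum X)⁻¹ * (X.map fun p => (R.speed p.1 : ℝ≥0∞) *
      (walkStep G p.2).expect fun v => (R.arrive (X.erase p) p.1 v).expect f).sum := by
  have hsum : ∑' p, R.weight X p = R.speedSum X := by
    rw [tsum_fintype, speedSum, Multiset.sum_map_eq_sum_count]
    rfl
  rw [step, dif_neg hX]
  simp only [PMF.expect_bind]
  rw [PMF.expect_fintype, Multiset.sum_map_eq_sum_count, Finset.mul_sum]
  refine Finset.sum_congr rfl fun p _ => ?_
  rw [pick, PMF.normalize_apply, hsum, weight]
  ring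

/-- A particle that is present in `X`, moves to `v` and arrives there. -/
theorem mem_support_step {X Y : Config ι V} (hX : X ≠ 0) (h : Y ∈ (R.step G X).support) :
    ∃ p ∈ X, ∃ v, Y ∈ (R.arrive (X.erase p) p.1 v).support := by
  rw [step, dif_neg hX, PMF.mem_support_bind_iff] at h
  obtain ⟨p, hp, h⟩ := h
  rw [PMF.mem_support_bind_iff] at h
  obtain ⟨v, hv, h⟩ := h
  refine ⟨p, ?_, v, h⟩
  rw [pick, PMF.mem_support_normalize_iff] at hp
  by_contra hpX
  exact hp (by simp [weight, Multiset.count_eq_zero.2 hpX])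

/-- One step for a tagged particle `i` and the configuration `ξ` of the other particles: the tagged
particle is killed if it moves and reacts, and the other particles ignore it. -/
def tagKernel (F : ι × V → Config ι V → ℝ≥0∞) (i : ι × V) (ξ : Config ι V) : ℝ≥0∞ :=
  ((R.speed i.1 : ℝ≥0∞) + R.speedSum ξ)⁻¹ *
    ((R.speed i.1 : ℝ≥0∞) * ((walkStep G i.2).expect fun v =>
        R.meetLaw i.1 (ξ.typesAt v) none * F (i.1, v) ξ) +
      (ξ.map fun p => (R.speed p.1 : ℝ≥0∞) * (walkStep G p.2).expect fun v =>
        (R.arrive (ξ.erase p) p.1 v).expect (F i)).sum)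

/-- The sum over the particles of a configuration of a function of the particle and the
configuration of the other particles. -/
def potential (F : ι × V → Config ι V → ℝ≥0∞) (X : Config ι V) : ℝ≥0∞ :=
  (X.map fun i => F i (X.erase i)).sum

/-- The contribution to the potential of the particles created on an arrival. -/
def createdPotential (F : ι × V → Config ι V → ℝ≥0∞) (X : Config ι V) (v : V) :
    Option (ι × Multiset ι) → ℝ≥0∞
  | none => 0
  | some (b, S) => ((Config.placed S v).map fun i =>
      F i ((Config.placed S v + X.erase (b, v)).erase i)).sum

/-- The particles of `X` that are not consumed by the outcome of an arrival at `v`. -/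
def spared (X : Config ι V) (v : V) : Option (ι × Multiset ι) → Config ι V
  | none => X
  | some (b, _) => X.erase (b, v)

/-- Particles away from `v` do not influence the meetings, so removing one changes nothing. For
particles at `v` this is `count_sub_mul_meetLaw_le`, summed over types. -/
theorem sum_spared_mul_meetLaw_le (X : Config ι V) (a : ι) (v : V) (o : Option (ι × Multiset ι))
    (g : ι × V → ℝ≥0∞) :
    R.meetLaw a (X.typesAt v) o * ((spared X v o).map g).sum ≤
      (X.map fun i => R.meetLaw a ((Config.typesAt (X.erase i) v)) o * g i).sum := by
  rw [Multiset.sum_map_eq_sum_count, Multiset.sum_map_eq_sum_count, Finset.mul_sum]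
  refine Finset.sum_le_sum fun i _ => ?_
  obtain ⟨c, w⟩ := i
  have hle : (spared X v o).count (c, w) ≤ X.count (c, w) := by
    rcases o with _ | ⟨b, S⟩
    · exact le_rfl
    · exact Multiset.count_le_of_le _ (Multiset.erase_le _ _)
  have key : ((spared X v o).count (c, w) : ℝ≥0∞) * R.meetLaw a (X.typesAt v) o ≤
      (X.count (c, w) : ℝ≥0∞) * R.meetLaw a (Config.typesAt (X.erase (c, w)) v) o := by
    by_cases hw : w = v
    · subst hw
      by_cases hc : (c, w) ∈ X
      · have h := R.count_sub_mul_meetLaw_le a c o (X.typesAt w) (Config.mem_typesAt.2 hc)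
        rw [Config.count_typesAt] at h
        rw [Config.typesAt_erase_self]
        refine le_trans ?_ h
        gcongr
        rcases o with _ | ⟨b, S⟩
        · simp [spared, hitsType]
        · by_cases hb : b = c
          · subst hb; simp [spared, hitsType]
          · simpa [spared, hitsType, hb] using hle
      · have : (spared X w o).count (c, w) = 0 := by
          have := Multiset.count_eq_zero.2 hc; omega
        simp [this]
    · rw [Config.typesAt_erase_of_ne X c hw]
      gcongr
  calc _ = (((spared X v o).count (c, w) : ℝ≥0∞) * R.meetLaw a (X.typesAt v) o) * g (c, w) := by
        ring
    _ ≤ ((X.count (c, w) : ℝ≥0∞) *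
          R.meetLaw a (Config.typesAt (X.erase (c, w)) v) o) * g (c, w) := mul_le_mul' key le_rfl
    _ = _ := by ring

/-- The particles present afterwards are of three kinds, one for each term: the arriving particle if
nothing reacted, the old particles that were spared, and the created ones. Only the second kind
needs an inequality, namely `sum_spared_mul_meetLaw_le` for each outcome. -/
theorem expect_arrive_potential_le (F : ι × V → Config ι V → ℝ≥0∞) (X : Config ι V) (a : ι)
    (v : V) :
    (R.arrive X a v).expect (potential F) ≤
      R.meetLaw a (X.typesAt v) none * F (a, v) X +
      (X.map fun i => (R.arrive (X.erase i) a v).expect (F i)).sum +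
      (R.meetLaw a (X.typesAt v)).expect (createdPotential F X v) := by
  have key : ∀ o, R.meetLaw a (X.typesAt v) o * potential F (arrivalResult X a v o) ≤
      (if o = none then R.meetLaw a (X.typesAt v) none * F (a, v) X else 0) +
      (X.map fun i => R.meetLaw a (Config.typesAt (X.erase i) v) o *
        F i (arrivalResult (X.erase i) a v o)).sum +
      R.meetLaw a (X.typesAt v) o * createdPotential F X v o := by
    intro o
    refine le_trans ?_ (add_le_add_left (add_le_add_right
      (R.sum_spared_mul_meetLaw_le X a v o fun i => F i (arrivalResult (X.erase i) a v o)) _) _)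
    rcases o with _ | ⟨b, S⟩
    · simp only [potential, arrivalResult, spared, createdPotential, Multiset.map_cons,
        Multiset.sum_cons, Multiset.erase_cons_head, if_true, mul_zero, add_zero]
      rw [mul_add]
      gcongr
      refine le_of_eq (congrArg Multiset.sum (Multiset.map_congr rfl fun i hi => ?_))
      rw [Multiset.erase_cons_tail_of_mem hi]
    · simp only [potential, arrivalResult, spared, createdPotential, Multiset.map_add,
        Multiset.sum_add, reduceCtorEq, if_false, zero_add]
      rw [mul_add, add_comm]
      gcongr
      refine le_of_eq (congrArg Multiset.sum (Multiset.map_congr rfl fun i hi => ?_))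
      rw [Multiset.erase_add_right_pos _ hi, Multiset.erase_comm]
  rw [expect_arrive]
  refine (ENNReal.tsum_le_tsum key).trans (le_of_eq ?_)
  rw [ENNReal.tsum_add, ENNReal.tsum_add, tsum_ite_eq, ENNReal.tsum_multiset_sum]
  simp only [expect_arrive]
  rfl

/-- One step of the process changes the potential at most as the tagged kernel does, up to the
contribution of the created particles. -/
theorem expect_step_potential_le (F : ι × V → Config ι V → ℝ≥0∞) {X : Config ι V} (hX : X ≠ 0) :
    (R.step G X).expect (potential F) ≤
      (X.map fun i => R.tagKernel G F i (X.erase i)).sum +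
      (R.speedSum X)⁻¹ * (X.map fun p => (R.speed p.1 : ℝ≥0∞) * (walkStep G p.2).expect fun v =>
        (R.meetLaw p.1 (Config.typesAt (X.erase p) v)).expect
          (createdPotential F (X.erase p) v)).sum := by
  rw [R.expect_step G hX]
  have h1 : ∀ p ∈ X, (R.speed p.1 : ℝ≥0∞) * ((walkStep G p.2).expect fun v =>
        (R.arrive (X.erase p) p.1 v).expect (potential F)) ≤
      ((R.speed p.1 : ℝ≥0∞) * ((walkStep G p.2).expect fun v =>
        R.meetLaw p.1 (Config.typesAt (X.erase p) v) none * F (p.1, v) (X.erase p)) +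
      ((X.erase p).map fun i => (R.speed p.1 : ℝ≥0∞) * (walkStep G p.2).expect fun v =>
        (R.arrive ((X.erase p).erase i) p.1 v).expect (F i)).sum) +
      (R.speed p.1 : ℝ≥0∞) * (walkStep G p.2).expect fun v =>
        (R.meetLaw p.1 (Config.typesAt (X.erase p) v)).expect
          (createdPotential F (X.erase p) v) := by
    intro p _
    rw [Multiset.sum_map_mul_left, ← mul_add, ← mul_add, ← PMF.expect_multiset_sum,
      ← PMF.expect_add, ← PMF.expect_add]
    refine mul_le_mul' le_rfl ?_
    exact PMF.expect_mono fun v _ => R.expect_arrive_potential_le F (X.erase p) p.1 v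
  refine (mul_le_mul' le_rfl (Multiset.sum_map_le_sum_map_of_mem _ _ _ h1)).trans (le_of_eq ?_)
  -- After the exchange of mover and tagged particle, the terms belonging to one tagged particle add
  -- up to its tagged kernel, whose normalisation is the total speed of `X`.
  rw [Multiset.sum_map_add, Multiset.sum_map_add, Multiset.sum_map_sum_map_erase, mul_add,
    ← Multiset.sum_map_add, ← Multiset.sum_map_mul_left]
  congr 2
  refine Multiset.map_congr rfl fun i hi => ?_
  rw [tagKernel, R.speedSum_erase_add hi]
  simp only [Multiset.erase_comm]

/-- A bound for the contribution of the created particles. -/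
theorem created_le_of_le (F : ι × V → Config ι V → ℝ≥0∞) {X : Config ι V} (hX : X ≠ 0) (c : ℝ≥0∞)
    (h : ∀ p ∈ X, ∀ b v S, (b, v) ∈ X.erase p → R.EffectiveOutput p.1 b S →
      createdPotential F (X.erase p) v (some (b, S)) ≤ c) :
    (R.speedSum X)⁻¹ * (X.map fun p => (R.speed p.1 : ℝ≥0∞) * (walkStep G p.2).expect fun v =>
        (R.meetLaw p.1 (Config.typesAt (X.erase p) v)).expect
          (createdPotential F (X.erase p) v)).sum ≤ c := by
  have h1 : (X.map fun p => (R.speed p.1 : ℝ≥0∞) * (walkStep G p.2).expect fun v =>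
        (R.meetLaw p.1 (Config.typesAt (X.erase p) v)).expect
          (createdPotential F (X.erase p) v)).sum ≤ R.speedSum X * c := by
    rw [speedSum, ← Multiset.sum_map_mul_right]
    refine Multiset.sum_map_le_sum_map_of_mem _ _ _ fun p hp => ?_
    gcongr
    refine PMF.expect_le_of_le fun v _ => PMF.expect_le_of_le fun o ho => ?_
    rcases o with _ | ⟨b, S⟩
    · simp [createdPotential]
    · have := R.meetLaw_apply_some_ne_zero p.1 b S _ ((PMF.mem_support_iff _ _).1 ho)
      exact h p hp b v S (Config.mem_typesAt.1 this.1) this.2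
  calc _ ≤ (R.speedSum X)⁻¹ * (R.speedSum X * c) := by gcongr
    _ = c := by
      rw [← mul_assoc, ENNReal.inv_mul_cancel (R.speedSum_ne_zero hX) (R.speedSum_ne_top X),
        one_mul]

end ParticleSystem

/-! ### Spectral gap of the random walk -/

section SpectralGap

variable {V : Type*} [Fintype V] [DecidableEq V] (G : SimpleGraph V) [DecidableRel G.Adj]

/-- The transition probabilities of the simple random walk, as real numbers. -/
def walkProb (u v : V) : ℝ := (walkStep G u v).toReal

theorem walkProb_nonneg (u v : V) : 0 ≤ walkProb G u v := ENNReal.toReal_nonneg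

theorem ofReal_walkProb (u v : V) : ENNReal.ofReal (walkProb G u v) = walkStep G u v :=
  ENNReal.ofReal_toReal (PMF.apply_ne_top _ _)

theorem sum_walkProb (u : V) : ∑ v, walkProb G u v = 1 := by
  have h := (walkStep G u).tsum_coe
  rw [tsum_fintype] at h
  unfold walkProb
  rw [← ENNReal.toReal_sum fun v _ => PMF.apply_ne_top _ _, h, ENNReal.toReal_one]

/-- The simple random walk is reversible for the uniform distribution, and satisfies a Poincaré
inequality with constant `γ`. -/
structure HasWalkGap (γ : ℝ) : Prop where
  symm : ∀ u v, walkProb G u v = walkProb G v u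
  gap : ∀ h : V → ℝ, ∑ u, ∑ v, walkProb G u v * (h u * h v) ≤
    ∑ u, h u ^ 2 - γ * (∑ u, h u ^ 2 - (∑ u, h u) ^ 2 / Fintype.card V)

theorem walkProb_of_regular {d : ℕ} (hd : G.IsRegularOfDegree d) (hd0 : d ≠ 0) (u v : V) :
    walkProb G u v = 1 / (d : ℝ) * G.adjMatrix ℝ u v := by
  have hcard : (G.neighborFinset u).card = d := hd u
  have hne : (G.neighborFinset u).Nonempty := by
    rw [← Finset.card_pos]; omega
  rw [walkProb, walkStep, dif_pos hne]
  by_cases h : G.Adj u v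
  · rw [PMF.uniformOfFinset_apply_of_mem _ (by simpa using h), hcard]
    simp [h]
  · rw [PMF.uniformOfFinset_apply_of_notMem _ (by simpa using h)]
    simp [h]

-- The constant function is fixed by the walk, while all eigenvalues but the top one are at most `1
-- - c < 1`. Hence the constants span the top eigenline, and the quadratic form is read off in an
-- orthonormal eigenbasis: the term subtracted from the squared norm is the component along the
-- constants.
open Matrix in
theorem lazyWalkMatrix_quadraticForm_le {d : ℕ} (hd : G.IsRegularOfDegree d) (hd0 : d ≠ 0)
    (hn : 1 < Fintype.card V) {c : ℝ} (hc : 0 < c) (hgap : c ≤ 1 - secondEigenvalue G d hn)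
    (h : V → ℝ) :
    h ⬝ᵥ (lazyWalkMatrix G d *ᵥ h) ≤
      ∑ u, h u ^ 2 - c * (∑ u, h u ^ 2 - (∑ u, h u) ^ 2 / Fintype.card V) := by
  set hA := lazyWalkMatrix_isHermitian G d
  set L := lazyWalkMatrix G d
  set b := hA.eigenvectorBasis with hb
  set l := hA.eigenvalues with hl
  set E := (Fintype.equivOfCardEq (Fintype.card_fin (Fintype.card V)) : Fin (Fintype.card V) ≃ V)
  set i0 : V := E ⟨0, by omega⟩ with hi0
  have hl1 : ∀ i, i ≠ i0 → l i ≤ 1 - c := by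
    intro i hi
    have h1 : l i = hA.eigenvalues₀ (E.symm i) := rfl
    have h2 : (⟨1, hn⟩ : Fin (Fintype.card V)) ≤ E.symm i := by
      rw [Fin.le_def]
      by_contra hlt
      have h3 : E.symm i = ⟨0, by omega⟩ := by
        apply Fin.ext; simp only at hlt ⊢; omega
      exact hi (by rw [hi0, ← h3, Equiv.apply_symm_apply])
    have h3 := hA.eigenvalues₀_antitone h2
    have h4 : secondEigenvalue G d hn = hA.eigenvalues₀ ⟨1, hn⟩ := rfl
    rw [h1]; linarith
  have hsymm : ∀ x y : V → ℝ, x ⬝ᵥ (L *ᵥ y) = (L *ᵥ x) ⬝ᵥ y := by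
    intro x y
    rw [Matrix.dotProduct_mulVec, ← Matrix.mulVec_transpose]
    congr 2
  have hinner : ∀ x y : V → ℝ, inner ℝ (WithLp.toLp 2 x) (WithLp.toLp 2 y) = x ⬝ᵥ y := by
    intro x y
    rw [EuclideanSpace.inner_eq_star_dotProduct]
    simp [dotProduct_comm]
  have hbi : ∀ i, b i = WithLp.toLp 2 (⇑(b i)) := fun i => rfl
  have heig : ∀ i (x : V → ℝ), (⇑(b i)) ⬝ᵥ (L *ᵥ x) = l i * ((⇑(b i)) ⬝ᵥ x) := by
    intro i x
    rw [hsymm, hA.mulVec_eigenvectorBasis i, smul_dotProduct, smul_eq_mul]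
  have hpars : ∀ x y : V → ℝ, ∑ i, ((⇑(b i)) ⬝ᵥ x) * ((⇑(b i)) ⬝ᵥ y) = x ⬝ᵥ y := by
    intro x y
    rw [← hinner, ← b.sum_inner_mul_inner]
    refine Finset.sum_congr rfl fun i _ => ?_
    rw [hbi i, hinner, hinner, dotProduct_comm x]
  have hL1 : L *ᵥ (fun _ => (1 : ℝ)) = fun _ => 1 := by
    funext u
    have hd' : (d : ℝ) ≠ 0 := by exact_mod_cast hd0
    have h1 : ∑ v, G.adjMatrix ℝ u v = d := by
      have h2 : (G.adjMatrix ℝ *ᵥ fun _ => (1 : ℝ)) u = (G.degree u : ℝ) := by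
        simp
      rw [hd u] at h2
      simpa [Matrix.mulVec, dotProduct] using h2
    have h2 : (L *ᵥ fun _ => (1 : ℝ)) u = 1 / 2 + 1 / (2 * (d : ℝ)) * ∑ v, G.adjMatrix ℝ u v := by
      simp only [L, lazyWalkMatrix, Matrix.mulVec, dotProduct, Matrix.add_apply, Matrix.smul_apply,
        mul_one, smul_eq_mul, Finset.sum_add_distrib, ← Finset.mul_sum, Matrix.one_apply,
        Finset.sum_ite_eq, Finset.mem_univ, if_true]
    rw [h2, h1]
    field_simp
    norm_num
  -- Eigenvectors of a symmetric matrix for different eigenvalues are orthogonal: the constants have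
  -- eigenvalue 1, and `l i < 1` here.
  have hone : ∀ i, i ≠ i0 → (⇑(b i)) ⬝ᵥ (fun _ => (1 : ℝ)) = 0 := by
    intro i hi
    have h1 := heig i (fun _ => (1 : ℝ))
    rw [hL1] at h1
    have h2 := hl1 i hi
    have h3 : (1 - l i) * ((⇑(b i)) ⬝ᵥ (fun _ => (1 : ℝ))) = 0 := by linarith
    rcases mul_eq_zero.1 h3 with h4 | h4
    · linarith
    · exact h4
  have hsum1 : ∀ y : V → ℝ, ((⇑(b i0)) ⬝ᵥ (fun _ => (1 : ℝ))) * ((⇑(b i0)) ⬝ᵥ y) = ∑ u, y u := by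
    intro y
    have h1 := hpars (fun _ => 1) y
    rw [Finset.sum_eq_single i0] at h1
    · rw [h1]; simp [dotProduct]
    · intro i _ hi; rw [hone i hi, zero_mul]
    · simp
  have hn0 : (0 : ℝ) < Fintype.card V := by exact_mod_cast (by omega : 0 < Fintype.card V)
  set a0 := (⇑(b i0)) ⬝ᵥ (fun _ => (1 : ℝ)) with ha0
  have ha0sq : a0 * a0 = Fintype.card V := by
    have := hsum1 (fun _ => 1)
    simpa using this
  have hl0 : l i0 = 1 := by
    have h1 := heig i0 (fun _ => (1 : ℝ))
    rw [hL1, ← ha0] at h1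
    have h2 : a0 ≠ 0 := by rintro h; rw [h] at ha0sq; simp at ha0sq; linarith
    have h3 : (1 - l i0) * a0 = 0 := by linarith
    rcases mul_eq_zero.1 h3 with h4 | h4
    · linarith
    · exact absurd h4 h2
  set α : V → ℝ := fun i => (⇑(b i)) ⬝ᵥ h with hα
  have hα0 : (∑ u, h u) ^ 2 / Fintype.card V = α i0 ^ 2 := by
    rw [← hsum1 h, ← ha0sq, mul_pow]
    have h2 : a0 ≠ 0 := by rintro h; rw [h] at ha0sq; simp at ha0sq; linarith
    field_simp
    rfl
  have hsq : ∑ u, h u ^ 2 = ∑ i, α i ^ 2 := by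
    have := hpars h h
    simp only [dotProduct] at this
    simp only [hα, pow_two, dotProduct]
    exact this.symm
  have hform : h ⬝ᵥ (L *ᵥ h) = ∑ i, l i * α i ^ 2 := by
    rw [← hpars]
    refine Finset.sum_congr rfl fun i _ => ?_
    rw [heig]; ring
  rw [hform, hα0, hsq, ← Finset.add_sum_erase _ _ (Finset.mem_univ i0),
    ← Finset.add_sum_erase _ (fun i => α i ^ 2) (Finset.mem_univ i0), hl0]
  have h5 : ∑ i ∈ Finset.univ.erase i0, l i * α i ^ 2 ≤
      (1 - c) * ∑ i ∈ Finset.univ.erase i0, α i ^ 2 := by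
    rw [Finset.mul_sum]
    refine Finset.sum_le_sum fun i hi => ?_
    exact mul_le_mul_of_nonneg_right (hl1 i (Finset.ne_of_mem_erase hi)) (sq_nonneg _)
  linarith

-- The lazy matrix is the average of the identity and the simple walk, so removing the laziness
-- doubles the gap. Connectedness only serves to exclude degree 0.
open Matrix in
theorem hasWalkGap_of_secondEigenvalue (hconn : G.Connected) {d : ℕ}
    (hd : G.IsRegularOfDegree d) (hn : 1 < Fintype.card V) {c : ℝ} (hc : 0 < c)
    (hgap : c ≤ 1 - secondEigenvalue G d hn) : HasWalkGap G (2 * c) := by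
  have hd0 : d ≠ 0 := by
    have : Nontrivial V := Fintype.one_lt_card_iff_nontrivial.1 hn
    obtain ⟨v⟩ := hconn.nonempty
    have := hconn.preconnected.degree_pos_of_nontrivial v
    rw [hd v] at this
    omega
  refine ⟨fun u v => ?_, fun h => ?_⟩
  · rw [walkProb_of_regular G hd hd0, walkProb_of_regular G hd hd0]
    simp [G.adj_comm]
  · have h1 := lazyWalkMatrix_quadraticForm_le G hd hd0 hn hc hgap h
    have h2 : h ⬝ᵥ (lazyWalkMatrix G d *ᵥ h) = 1 / 2 * ∑ u, h u ^ 2 +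
        1 / 2 * ∑ u, ∑ v, walkProb G u v * (h u * h v) := by
      rw [lazyWalkMatrix, Matrix.add_mulVec, Matrix.smul_mulVec, Matrix.one_mulVec,
        dotProduct_add, dotProduct_smul, Matrix.smul_mulVec, dotProduct_smul]
      congr 1
      · simp [dotProduct, pow_two]
      · simp only [dotProduct, Matrix.mulVec, smul_eq_mul, Finset.mul_sum]
        refine Finset.sum_congr rfl fun u _ => Finset.sum_congr rfl fun v _ => ?_
        rw [walkProb_of_regular G hd hd0]
        have hd' : (d : ℝ) ≠ 0 := by exact_mod_cast hd0
        field_simp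
    linarith

variable {G}

/-- By 2xy ≤ x² + y², since both the rows and, by symmetry, the columns of the transition matrix sum
to 1. -/
theorem HasWalkGap.sum_mul_le {γ : ℝ} (hG : HasWalkGap G γ) (f g : V → ℝ) :
    ∑ u, ∑ v, walkProb G u v * (f u * g v) ≤ 1 / 2 * (∑ u, f u ^ 2 + ∑ u, g u ^ 2) := by
  have h1 : ∑ u, ∑ v, walkProb G u v * (f u * g v) ≤
      ∑ u, ∑ v, (1 / 2 * (walkProb G u v * f u ^ 2) + 1 / 2 * (walkProb G u v * g v ^ 2)) := by
    refine Finset.sum_le_sum fun u _ => Finset.sum_le_sum fun v _ => ?_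
    nlinarith [mul_nonneg (walkProb_nonneg G u v) (sq_nonneg (f u - g v))]
  refine h1.trans (le_of_eq ?_)
  simp only [Finset.sum_add_distrib, ← Finset.mul_sum]
  rw [Finset.sum_comm (f := fun u v => walkProb G u v * g v ^ 2)]
  simp only [← Finset.sum_mul, sum_walkProb]
  have h2 : ∀ v, ∑ u, walkProb G u v = 1 := by
    intro v; rw [← sum_walkProb G v]; exact Finset.sum_congr rfl fun u _ => hG.symm u v
  simp only [h2, one_mul]
  ring

/-- The walk killed with probability at least `p` on a set `S` of positive density contracts. -/
theorem HasWalkGap.sum_killed_le {γ : ℝ} (hG : HasWalkGap G γ) (hγ : 0 < γ) {p σ : ℝ}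
    (hp : 0 < p) (hσ : 0 < σ) (S : Finset V) (hS : σ * Fintype.card V ≤ S.card)
    (hV : 0 < Fintype.card V)
    (h κ : V → ℝ) (hh : ∀ u, 0 ≤ h u) (hκ0 : ∀ u, 0 ≤ κ u) (hκ1 : ∀ u, κ u ≤ 1)
    (hκS : ∀ u ∈ S, κ u ≤ 1 - p) :
    ∑ u, ∑ v, walkProb G u v * (h u * (κ v * h v)) ≤
      (1 - min (p / 2) γ / (2 * (2 / σ + 1))) * ∑ u, h u ^ 2 := by
  set n : ℝ := (Fintype.card V : ℝ) with hn
  have hn0 : 0 < n := by rw [hn]; exact_mod_cast hV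
  set Q := ∑ u, h u ^ 2 with hQ
  set QS := ∑ u ∈ S, h u ^ 2 with hQS
  set m := (∑ u, h u) / n with hm
  set D := Q - (∑ u, h u) ^ 2 / n with hD
  have hDeq : D = ∑ u, (h u - m) ^ 2 := by
    have : ∑ u, (h u - m) ^ 2 = Q - 2 * m * (∑ u, h u) + n * m ^ 2 := by
      simp only [sub_sq, Finset.sum_add_distrib, Finset.sum_sub_distrib]
      rw [Finset.sum_const, Finset.card_univ, nsmul_eq_mul, ← Finset.sum_mul, ← Finset.mul_sum]
      ring
    rw [this, hD, hm]
    field_simp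
    ring
  have hD0 : 0 ≤ D := by rw [hDeq]; positivity
  have hQS0 : 0 ≤ QS := Finset.sum_nonneg fun u _ => sq_nonneg _
  have hQ0 : 0 ≤ Q := Finset.sum_nonneg fun u _ => sq_nonneg _
  -- First bound: the gain from killing alone. Only one of the two factors carries κ, which is why
  -- `p` is halved.
  have b1 : ∑ u, ∑ v, walkProb G u v * (h u * (κ v * h v)) ≤ Q - p / 2 * QS := by
    have h1 := hG.sum_mul_le h (fun v => κ v * h v)
    have h2 : ∑ v, (κ v * h v) ^ 2 ≤ Q - p * QS := by
      have h3 : ∀ v, (κ v * h v) ^ 2 ≤ h v ^ 2 - (if v ∈ S then p * h v ^ 2 else 0) := by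
        intro v
        have hsq : (κ v) ^ 2 ≤ κ v := by nlinarith [hκ0 v, hκ1 v]
        split_ifs with hv
        · have := hκS v hv
          rw [mul_pow]; nlinarith [sq_nonneg (h v)]
        · have := hκ1 v
          rw [mul_pow]; nlinarith [sq_nonneg (h v)]
      calc ∑ v, (κ v * h v) ^ 2 ≤ ∑ v, (h v ^ 2 - (if v ∈ S then p * h v ^ 2 else 0)) :=
            Finset.sum_le_sum fun v _ => h3 v
        _ = Q - p * QS := by
          rw [Finset.sum_sub_distrib, Finset.sum_ite_mem, Finset.univ_inter, ← Finset.mul_sum]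
    linarith
  -- Second bound: the gain from the spectral gap alone, with κ replaced by 1.
  have b2 : ∑ u, ∑ v, walkProb G u v * (h u * (κ v * h v)) ≤ Q - γ * D := by
    refine le_trans (Finset.sum_le_sum fun u _ => Finset.sum_le_sum fun v _ => ?_) (hG.gap h)
    refine mul_le_mul_of_nonneg_left ?_ (walkProb_nonneg G u v)
    refine mul_le_mul_of_nonneg_left ?_ (hh u)
    exact mul_le_of_le_one_left (hh v) (hκ1 v)
  -- The two gains cannot both be small: if `h` is small on `S` and close to its mean `m`, then `m`
  -- is small because `S` has density at least σ. On `S` one uses m² ≤ 2h² + 2(h - m)².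
  have b3 : Q ≤ (2 / σ + 1) * (QS + D) := by
    have h1 : σ * n * m ^ 2 ≤ 2 * (QS + D) := by
      have h2 : (S.card : ℝ) * m ^ 2 ≤ 2 * (QS + D) := by
        calc (S.card : ℝ) * m ^ 2 = ∑ u ∈ S, m ^ 2 := by simp
          _ ≤ ∑ u ∈ S, (2 * h u ^ 2 + 2 * (h u - m) ^ 2) :=
            Finset.sum_le_sum fun u _ => by nlinarith [sq_nonneg (2 * h u - m)]
          _ = 2 * QS + 2 * ∑ u ∈ S, (h u - m) ^ 2 := by
            rw [Finset.sum_add_distrib, ← Finset.mul_sum, ← Finset.mul_sum]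
          _ ≤ 2 * QS + 2 * D := by
            rw [hDeq]
            gcongr
            exact Finset.subset_univ _
          _ = _ := by ring
      nlinarith [sq_nonneg m]
    have h2 : Q = n * m ^ 2 + D := by rw [hD, hm]; field_simp; ring
    have h3 : n * m ^ 2 ≤ 2 / σ * (QS + D) := by
      rw [div_mul_eq_mul_div, le_div_iff₀ hσ]; linarith
    linarith
  set w := min (p / 2) γ with hw
  have hw0 : 0 < w := lt_min (by linarith) hγ
  have b4 : ∑ u, ∑ v, walkProb G u v * (h u * (κ v * h v)) ≤ Q - w / 2 * (QS + D) := by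
    have := mul_le_mul_of_nonneg_right (min_le_left (p / 2) γ) hQS0
    have := mul_le_mul_of_nonneg_right (min_le_right (p / 2) γ) hD0
    linarith
  have hz : 0 < 2 / σ + 1 := by positivity
  have b5 : w / (2 * (2 / σ + 1)) * Q ≤ w / 2 * (QS + D) := by
    calc w / (2 * (2 / σ + 1)) * Q ≤ w / (2 * (2 / σ + 1)) * ((2 / σ + 1) * (QS + D)) := by gcongr
      _ = _ := by field_simp
  linarith

end SpectralGap

/-! ### Energies -/

theorem Multiset.finite_card_le {α : Type*} [Finite α] (n : ℕ) :
    {s : Multiset α | Multiset.card s ≤ n}.Finite := by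
  refine ((List.finite_length_le α n).image (fun l : List α => (l : Multiset α))).subset ?_
  intro s hs
  induction s using Quotient.inductionOn with
  | h l => exact ⟨l, by simpa using hs, rfl⟩

namespace ParticleSystem

variable {ι : Type*} [Fintype ι] (R : ParticleSystem ι)

/-- Energies at least `1` of the types, such that every effective reaction decreases the total
energy by at least `1`. -/
structure IsEnergy (e : ι → ℝ) : Prop where
  one_le : ∀ a, 1 ≤ e a
  drop : ∀ a b S, R.EffectiveOutput a b S → (S.map e).sum + 1 ≤ e a + e b

theorem card_le_sum_energy {e : ι → ℝ} {c : ℝ} (he : ∀ a, c ≤ e a) (S : Multiset ι) :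
    c * (Multiset.card S : ℝ) ≤ (S.map e).sum := by
  induction S using Multiset.induction_on with
  | empty => simp
  | cons a S ih =>
    simp only [Multiset.card_cons, Nat.cast_add, Nat.cast_one, Multiset.map_cons,
      Multiset.sum_cons]
    linarith [he a]

theorem exists_pos_le {α : Type*} [Finite α] (f : α → ℝ) (hf : ∀ a, 0 < f a) :
    ∃ c, 0 < c ∧ ∀ a, c ≤ f a := by
  rcases isEmpty_or_nonempty α with h | h
  · exact ⟨1, one_pos, fun a => (h.false a).elim⟩
  · obtain ⟨a, ha⟩ := Finite.exists_min f
    exact ⟨f a, hf a, ha⟩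

/-- Positive energies bound the size of every effective output, so there are finitely many effective
reactions. The smallest energy and the smallest loss are therefore positive, and rescaling makes
both at least 1. -/
theorem Dissipative.exists_isEnergy (h : R.Dissipative) : ∃ e : ι → ℝ, R.IsEnergy e := by
  obtain ⟨e, he, hdrop⟩ := h
  obtain ⟨c, hc, hce⟩ := exists_pos_le e he
  obtain ⟨M, hM⟩ : ∃ M : ℝ, ∀ a, e a ≤ M := by
    obtain ⟨M, hM⟩ := (Set.finite_range e).bddAbove
    exact ⟨M, fun a => hM ⟨a, rfl⟩⟩
  set T := {t : ι × ι × Multiset ι | R.EffectiveOutput t.1 t.2.1 t.2.2} with hT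
  have hfin : T.Finite := by
    refine (Set.Finite.prod (Set.finite_univ (α := ι)) (Set.Finite.prod (Set.finite_univ (α := ι))
      (Multiset.finite_card_le (α := ι) ⌈2 * M / c⌉₊))).subset ?_
    rintro ⟨a, b, S⟩ hS
    refine ⟨Set.mem_univ _, Set.mem_univ _, ?_⟩
    have h1 := hdrop a b S hS
    have h2 := card_le_sum_energy hce S
    have h3 : (Multiset.card S : ℝ) ≤ 2 * M / c := by
      rw [le_div_iff₀ hc]; linarith [hM a, hM b]
    exact_mod_cast h3.trans (Nat.le_ceil _)
  have : Finite T := hfin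
  obtain ⟨δ, hδ, hδT⟩ := exists_pos_le
    (fun t : T => e t.1.1 + e t.1.2.1 - (t.1.2.2.map e).sum)
    (fun t => by have := hdrop _ _ _ t.2; linarith)
  set m := min c δ with hm
  have hm0 : 0 < m := lt_min hc hδ
  refine ⟨fun a => e a / m, fun a => ?_, fun a b S hS => ?_⟩
  · rw [le_div_iff₀ hm0, one_mul]
    exact (min_le_left _ _).trans (hce a)
  · have h1 := hδT ⟨⟨a, b, S⟩, hS⟩
    simp only at h1
    have h2 : (S.map fun a => e a / m).sum = (S.map e).sum / m := by
      simp only [div_eq_mul_inv, Multiset.sum_map_mul_right]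
    rw [h2, ← add_div, div_add_one hm0.ne', div_le_div_iff_of_pos_right hm0]
    linarith [min_le_right c δ]

end ParticleSystem

namespace Config

variable {ι V : Type*}

/-- The total energy of a configuration. -/
def energy (e : ι → ℝ) (X : Config ι V) : ℝ := (X.map fun p => e p.1).sum

@[simp] theorem energy_cons (e : ι → ℝ) (p : ι × V) (X : Config ι V) :
    energy e (p ::ₘ X) = e p.1 + X.energy e := by simp [energy]

@[simp] theorem energy_add (e : ι → ℝ) (X Y : Config ι V) :
    energy e (X + Y) = X.energy e + Y.energy e := by simp [energy]

@[simp] theorem energy_placed (e : ι → ℝ) (S : Multiset ι) (v : V) :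
    energy e (placed S v) = (S.map e).sum := by simp [energy, placed]

theorem energy_erase_add [DecidableEq ι] [DecidableEq V] (e : ι → ℝ) {X : Config ι V} {p : ι × V}
    (hp : p ∈ X) : e p.1 + energy e (X.erase p) = energy e X := by
  rw [← energy_cons, Multiset.cons_erase hp]

theorem energy_eq_types (e : ι → ℝ) (X : Config ι V) : energy e X = (X.types.map e).sum := by
  simp [energy, types]

theorem card_le_energy {e : ι → ℝ} (he : ∀ a, 1 ≤ e a) (X : Config ι V) :
    (Multiset.card X : ℝ) ≤ energy e X := by
  induction X using Multiset.induction_on with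
  | empty => simp [energy]
  | cons p X ih =>
    rw [energy_cons, Multiset.card_cons]; push_cast; linarith [he p.1]

end Config

/-! ### A weight measuring the crowding of a type -/

namespace Config

variable {ι V : Type*} [DecidableEq ι] [Fintype V] [DecidableEq V]

/-- The product of the factorials of the numbers of particles of type `a` at the vertices,
multiplied by the factor `L ^ e c` for each particle of type `c`. -/
def crowding (a : ι) (e : ι → ℝ) (L : ℝ) (X : Config ι V) : ℝ :=
  (∏ v, ((X.count (a, v)).factorial : ℝ)) * L ^ energy e X

variable {a : ι} {e : ι → ℝ} {L : ℝ}

theorem crowding_pos (hL : 0 < L) (X : Config ι V) : 0 < crowding a e L X := by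
  unfold crowding
  have := Real.rpow_pos_of_pos hL (energy e X)
  positivity

theorem crowding_cons (hL : 0 < L) (c : ι) (w : V) (X : Config ι V) :
    crowding a e L ((c, w) ::ₘ X) =
      crowding a e L X * L ^ e c * (if c = a then (X.count (a, w) : ℝ) + 1 else 1) := by
  unfold crowding
  rw [energy_cons, Real.rpow_add hL]
  by_cases hc : c = a
  · subst hc
    rw [if_pos rfl]
    have : ∏ v, ((((c, w) ::ₘ X).count (c, v)).factorial : ℝ) =
        (∏ v, ((X.count (c, v)).factorial : ℝ)) * ((X.count (c, w) : ℝ) + 1) := by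
      rw [← Finset.mul_prod_erase _ _ (Finset.mem_univ w),
        ← Finset.mul_prod_erase _ (fun v => ((X.count (c, v)).factorial : ℝ)) (Finset.mem_univ w),
        Multiset.count_cons_self, Nat.factorial_succ]
      have h : ∏ v ∈ Finset.univ.erase w, ((((c, w) ::ₘ X).count (c, v)).factorial : ℝ) =
          ∏ v ∈ Finset.univ.erase w, ((X.count (c, v)).factorial : ℝ) := by
        refine Finset.prod_congr rfl fun v hv => ?_
        rw [Multiset.count_cons_of_ne]
        simpa using Finset.ne_of_mem_erase hv
      rw [h]; push_cast; ring
    rw [this]; ring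
  · rw [if_neg hc]
    have : ∀ v, ((c, w) ::ₘ X).count (a, v) = X.count (a, v) := by
      intro v
      rw [Multiset.count_cons_of_ne]
      simp [Ne.symm hc]
    simp only [this]; ring

/-- Adding one particle multiplies the product of factorials by 1 or by the new number of particles
at its vertex, hence by at most `N`. -/
theorem crowding_add_le (hL : 0 < L) (N : ℕ) (Y ζ : Config ι V)
    (h : Multiset.card Y + Multiset.card ζ ≤ N) :
    crowding a e L (Y + ζ) ≤ crowding a e L ζ * L ^ energy e Y * (N : ℝ) ^ Multiset.card Y := by
  induction Y using Multiset.induction_on with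
  | empty => simp [energy]
  | cons p Y ih =>
    obtain ⟨c, w⟩ := p
    rw [Multiset.card_cons] at h
    have h1 := ih (by omega)
    rw [Multiset.cons_add, crowding_cons hL, energy_cons, Real.rpow_add hL, Multiset.card_cons,
      pow_succ]
    have h2 : (if c = a then ((Y + ζ).count (a, w) : ℝ) + 1 else 1) ≤ N := by
      have h3 := Multiset.count_le_card (a, w) (Y + ζ)
      rw [Multiset.card_add] at h3
      split_ifs
      · exact_mod_cast (by omega : (Y + ζ).count (a, w) + 1 ≤ N)
      · exact_mod_cast (by omega : 1 ≤ N)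
    have hp := (Real.rpow_pos_of_pos hL (e c)).le
    have h0 := (crowding_pos (a := a) (e := e) hL ζ).le
    have h00 := (Real.rpow_pos_of_pos hL (energy e Y)).le
    calc crowding a e L (Y + ζ) * L ^ e c * (if c = a then ((Y + ζ).count (a, w) : ℝ) + 1 else 1)
        ≤ (crowding a e L ζ * L ^ energy e Y * (N : ℝ) ^ Multiset.card Y) * L ^ e c * N := by
          gcongr
      _ = _ := by ring

theorem crowding_erase_le (hL : 0 < L) {ζ : Config ι V} {q : ι × V} (hq : q ∈ ζ) :
    crowding a e L (ζ.erase q) * L ^ e q.1 ≤ crowding a e L ζ := by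
  conv_rhs => rw [← Multiset.cons_erase hq]
  rw [crowding_cons hL]
  have hp := (Real.rpow_pos_of_pos hL (e q.1)).le
  have h0 := (crowding_pos (a := a) (e := e) hL (ζ.erase q)).le
  refine le_mul_of_one_le_right (by positivity) ?_
  split_ifs
  · simp
  · exact le_rfl

theorem one_le_crowding (he : ∀ a, 1 ≤ e a) (hL : 1 ≤ L) (X : Config ι V) :
    1 ≤ crowding a e L X := by
  unfold crowding
  have h1 : (1 : ℝ) ≤ ∏ v, ((X.count (a, v)).factorial : ℝ) := by
    have : 1 ≤ ∏ v, (X.count (a, v)).factorial :=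
      Finset.one_le_prod' fun v _ => Nat.one_le_iff_ne_zero.2 (Nat.factorial_ne_zero _)
    exact_mod_cast this
  have h3 : 0 ≤ energy e X := le_trans (Nat.cast_nonneg _) (card_le_energy he X)
  have h2 : 1 ≤ L ^ energy e X := Real.one_le_rpow hL h3
  nlinarith

/-- The factor by which the crowding changes when a particle of type `c` moves from `u` to `v`. -/
def crowdingRatio (a : ι) (X : Config ι V) (c : ι) (u v : V) : ℝ :=
  if c = a then ((X.count (a, v) : ℝ) + 1) / X.count (a, u) else 1

theorem crowdingRatio_nonneg (X : Config ι V) (c : ι) (u v : V) :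
    0 ≤ crowdingRatio a X c u v := by
  unfold crowdingRatio; split_ifs <;> positivity

/-- A move changes the crowding at most by the crowding ratio, also if there is a reaction. -/
theorem crowding_arrive_le [Fintype ι] (R : ParticleSystem ι) (he : R.IsEnergy e) {k N : ℕ}
    (hk : ∀ a b S, R.EffectiveOutput a b S → Multiset.card S ≤ k) (hL : 1 ≤ L)
    (hNL : (N : ℝ) ^ k ≤ L) {X Y : Config ι V} (hX : Multiset.card X + k ≤ N) {c : ι} {u v : V}
    (hu : (c, u) ∈ X) (hY : Y ∈ (R.arrive (X.erase (c, u)) c v).support) :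
    crowding a e L Y ≤ crowding a e L X * crowdingRatio a X c u v := by
  have hL0 : 0 < L := by linarith
  have hN0 : 1 ≤ N := by
    have := Multiset.card_pos_iff_exists_mem.2 ⟨_, hu⟩; omega
  set X1 := X.erase (c, u) with hX1
  have hcard : Multiset.card X1 + 1 = Multiset.card X := Multiset.card_erase_add_one hu
  have h0 := (crowding_pos (a := a) (e := e) hL0 X1)
  -- A reaction is no worse than the bare move: the at most `k` new particles cost a factor N^k ≤ L,
  -- and the loss of one unit of energy gains a factor L.
  have hmove : crowding a e L Y ≤ crowding a e L ((c, v) ::ₘ X1) := by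
    rcases R.mem_support_arrive hY with rfl | ⟨b, S, hb, hS, rfl⟩
    · exact le_rfl
    · have hSk := hk c b S hS
      have h1 : crowding a e L (placed S v + X1.erase (b, v)) ≤
          crowding a e L (X1.erase (b, v)) * L ^ energy e (placed S v) *
            (N : ℝ) ^ Multiset.card (placed S v) := by
        refine crowding_add_le hL0 N _ _ ?_
        have : Multiset.card (X1.erase (b, v)) ≤ Multiset.card X1 :=
          Multiset.card_le_card (Multiset.erase_le _ _)
        simp only [placed, Multiset.card_map]
        omega
      have h2 := crowding_erase_le (a := a) (e := e) hL0 hb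
      have h3 := he.drop c b S hS
      have hcp := crowding_pos (a := a) (e := e) hL0 (X1.erase (b, v))
      have h4 : (N : ℝ) ^ Multiset.card (placed S v) ≤ L := by
        refine le_trans (pow_le_pow_right₀ (by exact_mod_cast hN0) ?_) hNL
        simpa [placed] using hSk
      have h5 : L ^ energy e (placed S v) * L ≤ L ^ e b * L ^ e c := by
        rw [← Real.rpow_add hL0]
        nth_rewrite 2 [← Real.rpow_one L]
        rw [← Real.rpow_add hL0]
        refine Real.rpow_le_rpow_of_exponent_le hL ?_
        rw [energy_placed]; linarith
      have hpos1 := (Real.rpow_pos_of_pos hL0 (energy e (placed S v))).le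
      have hpos2 := (Real.rpow_pos_of_pos hL0 (e c)).le
      calc crowding a e L (placed S v + X1.erase (b, v))
          ≤ crowding a e L (X1.erase (b, v)) * L ^ energy e (placed S v) *
            (N : ℝ) ^ Multiset.card (placed S v) := h1
        _ ≤ crowding a e L (X1.erase (b, v)) * L ^ energy e (placed S v) * L := by gcongr
        _ = crowding a e L (X1.erase (b, v)) * (L ^ energy e (placed S v) * L) := by ring
        _ ≤ crowding a e L (X1.erase (b, v)) * (L ^ e b * L ^ e c) := by gcongr
        _ = (crowding a e L (X1.erase (b, v)) * L ^ e b) * L ^ e c := by ring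
        _ ≤ crowding a e L X1 * L ^ e c := by gcongr
        _ ≤ crowding a e L ((c, v) ::ₘ X1) := by
          rw [crowding_cons hL0]
          refine le_mul_of_one_le_right (by positivity) ?_
          split_ifs
          · simp
          · exact le_rfl
  refine hmove.trans ?_
  have hXe : crowding a e L X = crowding a e L ((c, u) ::ₘ X1) := by
    rw [hX1, Multiset.cons_erase hu]
  have hp := (Real.rpow_pos_of_pos hL0 (e c))
  rw [hXe, crowding_cons hL0, crowding_cons hL0, crowdingRatio]
  by_cases hc : c = a
  · subst hc
    simp only [if_true]
    have h1 : (X.count (c, u) : ℝ) = X1.count (c, u) + 1 := by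
      have : X1.count (c, u) + 1 = X.count (c, u) := by
        rw [hX1, Multiset.count_erase_self]
        have := Multiset.one_le_count_iff_mem.2 hu
        omega
      exact_mod_cast this.symm
    have h2 : (X1.count (c, v) : ℝ) ≤ X.count (c, v) := by
      exact_mod_cast Multiset.count_le_of_le _ (Multiset.erase_le _ _)
    rw [h1]
    have h3 : (0 : ℝ) < X1.count (c, u) + 1 := by positivity
    calc crowding c e L X1 * L ^ e c * ((X1.count (c, v) : ℝ) + 1)
        ≤ crowding c e L X1 * L ^ e c * ((X.count (c, v) : ℝ) + 1) := by gcongr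
      _ = _ := by field_simp
  · simp [hc]

end Config

/-! ### Spreading of a type -/

section Spreading

variable {ι V : Type*} [Fintype ι] [DecidableEq ι] [Fintype V] [DecidableEq V]
variable (R : ParticleSystem ι) {G : SimpleGraph V} [DecidableRel G.Adj]

/-! ### Square roots of the occupation numbers -/

namespace Config

/-- The sum over the vertices of the square root of the number of particles of type `a`. -/
def rootSum (a : ι) (X : Config ι V) : ℝ := ∑ v, √(X.count (a, v))

theorem rootSum_nonneg (a : ι) (X : Config ι V) : 0 ≤ rootSum a X :=
  Finset.sum_nonneg fun _ _ => Real.sqrt_nonneg _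

/-- The number of particles of type `a`. -/
def mass (a : ι) (X : Config ι V) : ℝ := ∑ v, (X.count (a, v) : ℝ)

theorem mass_nonneg (a : ι) (X : Config ι V) : 0 ≤ mass a X :=
  Finset.sum_nonneg fun _ _ => Nat.cast_nonneg _

theorem mass_eq_count_types (a : ι) (X : Config ι V) : mass a X = X.types.count a := by
  unfold mass
  induction X using Multiset.induction_on with
  | empty => simp [types]
  | cons p X ih =>
    obtain ⟨c, w⟩ := p
    have h1 : types ((c, w) ::ₘ X) = c ::ₘ types X := by simp [types]
    rw [h1, Multiset.count_cons, Nat.cast_add, ← ih]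
    simp only [Multiset.count_cons, Nat.cast_add, Finset.sum_add_distrib]
    congr 1
    by_cases hc : a = c
    · subst hc
      rw [if_pos rfl, Finset.sum_eq_single w]
      · simp
      · intro v _ hv; simp [hv]
      · simp
    · simp [hc]

theorem mass_le_energy {e : ι → ℝ} (he : ∀ c, 1 ≤ e c) (a : ι) (X : Config ι V) :
    mass a X ≤ energy e X := by
  refine le_trans ?_ (card_le_energy he X)
  rw [mass_eq_count_types]
  exact_mod_cast (Multiset.count_le_card a _).trans (by simp [types])

/-- Cauchy–Schwarz on the occupied vertices. With the mass bounded above, a large root sum forces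
many occupied vertices. -/
theorem rootSum_sq_le (a : ι) (X : Config ι V) :
    rootSum a X ^ 2 ≤ (Finset.univ.filter fun v => (a, v) ∈ X).card * mass a X := by
  have h1 : rootSum a X = ∑ v ∈ Finset.univ.filter fun v => (a, v) ∈ X, √(X.count (a, v)) := by
    rw [rootSum, Finset.sum_filter]
    refine Finset.sum_congr rfl fun v _ => ?_
    split_ifs with h
    · rfl
    · simp [Multiset.count_eq_zero.2 h]
  rw [h1]
  refine sq_sum_le_card_mul_sum_sq.trans ?_
  gcongr
  calc ∑ v ∈ Finset.univ.filter fun v => (a, v) ∈ X, √(X.count (a, v) : ℝ) ^ 2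
      = ∑ v ∈ Finset.univ.filter fun v => (a, v) ∈ X, (X.count (a, v) : ℝ) :=
        Finset.sum_congr rfl fun v _ => Real.sq_sqrt (Nat.cast_nonneg _)
    _ ≤ mass a X := by
      refine Finset.sum_le_sum_of_subset_of_nonneg (Finset.subset_univ _) fun _ _ _ =>
        Nat.cast_nonneg _

theorem rootSum_le (a : ι) (X : Config ι V) {K : ℝ} (hK : 1 ≤ K)
    (h : mass a X ≤ K * Fintype.card V) : rootSum a X ≤ K * Fintype.card V := by
  have h1 := rootSum_sq_le a X
  have h2 : ((Finset.univ.filter fun v => (a, v) ∈ X).card : ℝ) ≤ Fintype.card V := by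
    exact_mod_cast Finset.card_le_univ _
  have h3 : rootSum a X ^ 2 ≤ (K * Fintype.card V) ^ 2 := by
    calc rootSum a X ^ 2 ≤ Fintype.card V * (K * Fintype.card V) := by
          refine h1.trans ?_
          have := mass_nonneg a X
          gcongr
      _ ≤ (K * Fintype.card V) * (K * Fintype.card V) := by
        gcongr
        exact le_mul_of_one_le_left (Nat.cast_nonneg _) hK
      _ = _ := by ring
  exact le_of_sq_le_sq h3 (by positivity)

/-- The rate at which the particles of type `a` spread. -/
def spreadRate (G : SimpleGraph V) [DecidableRel G.Adj] (a : ι) (X : Config ι V) : ℝ :=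
  ∑ u, ∑ v, walkProb G u v * (√(X.count (a, u)) * √((X.count (a, v) : ℝ) + 1)) - mass a X

/-- The Poincaré inequality is applied to the function √x_v, whose squared norm is the mass. The
error `rootSum` comes from √(x + 1) ≤ √x + 1. -/
theorem spreadRate_le {γ : ℝ} (hG : HasWalkGap G γ) (a : ι) (X : Config ι V) :
    spreadRate G a X ≤
      -γ * (mass a X - rootSum a X ^ 2 / Fintype.card V) + rootSum a X := by
  have hmass : ∑ u, √(X.count (a, u) : ℝ) ^ 2 = mass a X :=
    Finset.sum_congr rfl fun v _ => Real.sq_sqrt (Nat.cast_nonneg _)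
  have h1 := hG.gap fun u => √(X.count (a, u) : ℝ)
  rw [hmass] at h1
  have h2 : ∑ u, ∑ v, walkProb G u v * (√(X.count (a, u)) * √((X.count (a, v) : ℝ) + 1)) ≤
      ∑ u, ∑ v, walkProb G u v * (√(X.count (a, u)) * √(X.count (a, v) : ℝ)) + rootSum a X := by
    have h3 : rootSum a X = ∑ u, ∑ v, walkProb G u v * √(X.count (a, u) : ℝ) := by
      simp only [← Finset.sum_mul, sum_walkProb, one_mul, rootSum]
    rw [h3, ← Finset.sum_add_distrib]
    refine Finset.sum_le_sum fun u _ => ?_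
    rw [← Finset.sum_add_distrib]
    refine Finset.sum_le_sum fun v _ => ?_
    have h4 : √((X.count (a, v) : ℝ) + 1) ≤ √(X.count (a, v) : ℝ) + 1 := by
      refine Real.sqrt_le_iff.2 ⟨by positivity, ?_⟩
      nlinarith [Real.sq_sqrt (Nat.cast_nonneg (α := ℝ) (X.count (a, v))),
        Real.sqrt_nonneg (X.count (a, v) : ℝ)]
    have := walkProb_nonneg G u v
    calc walkProb G u v * (√(X.count (a, u)) * √((X.count (a, v) : ℝ) + 1))
        ≤ walkProb G u v * (√(X.count (a, u)) * (√(X.count (a, v) : ℝ) + 1)) := by gcongr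
      _ = _ := by ring
  have h5 : (∑ u, √(X.count (a, u) : ℝ)) = rootSum a X := rfl
  rw [h5] at h1
  unfold spreadRate
  linarith

theorem sum_sq_div_le (a : ι) (X : Config ι V) (hV : 0 < Fintype.card V) :
    rootSum a X ^ 2 / Fintype.card V ≤ mass a X := by
  have hn : (0 : ℝ) < Fintype.card V := by exact_mod_cast hV
  rw [div_le_iff₀ hn, mul_comm]
  refine (rootSum_sq_le a X).trans ?_
  have := mass_nonneg a X
  gcongr
  exact_mod_cast Finset.card_le_univ _

end Config

/-! ### Expected change of a small power of the crowding -/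

namespace ParticleSystem

open Config

theorem toReal_speedSum (X : Config ι V) :
    (R.speedSum X).toReal = ∑ i, (X.count i : ℝ) * R.speed i.1 := by
  rw [speedSum, Multiset.sum_map_eq_sum_count, ENNReal.toReal_sum]
  · simp
  · intro i _
    exact ENNReal.mul_ne_top (ENNReal.natCast_ne_top _) ENNReal.coe_ne_top

/-- The total rate of moves, each weighted by the power `τ` of the crowding ratio. -/
def crowdingRate (G : SimpleGraph V) [DecidableRel G.Adj] (a : ι) (τ : ℝ) (X : Config ι V) : ℝ :=
  ∑ i, (X.count i : ℝ) *
    (R.speed i.1 * ∑ v, walkProb G i.2 v * crowdingRatio a X i.1 i.2 v ^ τ)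

theorem crowdingRate_nonneg (a : ι) (τ : ℝ) (X : Config ι V) : 0 ≤ R.crowdingRate G a τ X := by
  refine Finset.sum_nonneg fun i _ => mul_nonneg (Nat.cast_nonneg _) (mul_nonneg (by simp) ?_)
  exact Finset.sum_nonneg fun v _ => mul_nonneg (walkProb_nonneg G _ _)
    (Real.rpow_nonneg (crowdingRatio_nonneg _ _ _ _) _)

/-- Bernoulli's inequality for the power 2τ of √x. Square roots are what turns the crowding ratios
into a quadratic form. -/
theorem rpow_le_one_add_mul_sqrt {x τ : ℝ} (hx : 0 ≤ x) (hτ : 0 ≤ τ) (hτ1 : 2 * τ ≤ 1) :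
    x ^ τ ≤ 1 + 2 * τ * (√x - 1) := by
  have h := rpow_one_add_le_one_add_mul_self (s := √x - 1) (p := 2 * τ)
    (by linarith [Real.sqrt_nonneg x]) (by linarith) hτ1
  rw [add_sub_cancel, Real.sqrt_eq_rpow, ← Real.rpow_mul hx] at h
  rw [Real.sqrt_eq_rpow]
  convert h using 2
  ring

/-- Only moves of type `a` have a ratio different from 1. A vertex `u` is left at a rate
proportional to x_u, and x_u √((x_v + 1)/x_u) = √x_u √(x_v + 1), which is the form in `spreadRate`.
-/
theorem crowdingRate_le (a : ι) {τ : ℝ} (hτ : 0 ≤ τ) (hτ1 : 2 * τ ≤ 1) (X : Config ι V) :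
    R.crowdingRate G a τ X ≤
      (R.speedSum X).toReal + 2 * τ * R.speed a * spreadRate G a X := by
  have h1 : ∀ i : ι × V, (X.count i : ℝ) *
      (R.speed i.1 * ∑ v, walkProb G i.2 v * crowdingRatio a X i.1 i.2 v ^ τ) ≤
      (X.count i : ℝ) * R.speed i.1 + (if i.1 = a then 2 * τ * R.speed a *
        (∑ v, walkProb G i.2 v * (√(X.count (a, i.2)) * √((X.count (a, v) : ℝ) + 1)) -
          X.count (a, i.2)) else 0) := by
    rintro ⟨c, u⟩
    by_cases hc : c = a
    · subst hc
      simp only [crowdingRatio, if_true]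
      set m : ℝ := (X.count (c, u) : ℝ) with hm
      have hm0 : 0 ≤ m := Nat.cast_nonneg _
      have h2 : ∑ v, walkProb G u v * ((((X.count (c, v) : ℝ) + 1) / m) ^ τ) ≤
          ∑ v, walkProb G u v * (1 + 2 * τ * (√(((X.count (c, v) : ℝ) + 1) / m) - 1)) := by
        refine Finset.sum_le_sum fun v _ => ?_
        exact mul_le_mul_of_nonneg_left
          (rpow_le_one_add_mul_sqrt (by positivity) hτ hτ1) (walkProb_nonneg G u v)
      have h3 : ∑ v, walkProb G u v * (1 + 2 * τ * (√(((X.count (c, v) : ℝ) + 1) / m) - 1)) =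
          1 + 2 * τ * (∑ v, walkProb G u v * √(((X.count (c, v) : ℝ) + 1) / m) - 1) := by
        have h4 : ∀ v, walkProb G u v * (1 + 2 * τ * (√(((X.count (c, v) : ℝ) + 1) / m) - 1)) =
            walkProb G u v + 2 * τ * (walkProb G u v * √(((X.count (c, v) : ℝ) + 1) / m)) -
            2 * τ * walkProb G u v := fun v => by ring
        simp only [h4, Finset.sum_sub_distrib, Finset.sum_add_distrib, ← Finset.mul_sum,
          sum_walkProb]
        ring
      have h5 : m * ∑ v, walkProb G u v * √(((X.count (c, v) : ℝ) + 1) / m) =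
          ∑ v, walkProb G u v * (√m * √((X.count (c, v) : ℝ) + 1)) := by
        rw [Finset.mul_sum]
        refine Finset.sum_congr rfl fun v _ => ?_
        rw [Real.sqrt_div (by positivity)]
        rcases hm0.eq_or_lt with h0 | h0
        · simp [← h0]
        · have h6 : √m ≠ 0 := (Real.sqrt_pos.2 h0).ne'
          have h7 : m = √m * √m := (Real.mul_self_sqrt hm0).symm
          nth_rewrite 1 [h7]
          field_simp
      have hs : (0 : ℝ) ≤ R.speed c := NNReal.coe_nonneg _
      calc m * (R.speed c * ∑ v, walkProb G u v * ((((X.count (c, v) : ℝ) + 1) / m) ^ τ))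
          ≤ m * (R.speed c *
            (1 + 2 * τ * (∑ v, walkProb G u v * √(((X.count (c, v) : ℝ) + 1) / m) - 1))) := by
            rw [← h3]; gcongr
        _ = m * R.speed c + 2 * τ * R.speed c *
            (m * ∑ v, walkProb G u v * √(((X.count (c, v) : ℝ) + 1) / m) - m) := by ring
        _ = _ := by rw [h5]
    · simp [crowdingRatio, hc, sum_walkProb]
  refine (Finset.sum_le_sum fun i _ => h1 i).trans (le_of_eq ?_)
  rw [Finset.sum_add_distrib, toReal_speedSum]
  congr 1
  rw [Fintype.sum_prod_type, Finset.sum_eq_single a]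
  · simp only [if_true]
    rw [← Finset.mul_sum, Finset.sum_sub_distrib]
    rfl
  · intro c _ hc; simp [hc]
  · simp

end ParticleSystem

end Spreading

/-! ### Monotone limits of expectations -/

theorem PMF.expect_iSup {α : Type*} (p : PMF α) (f : ℕ → α → ℝ≥0∞) (hf : Monotone f) :
    p.expect (fun a => ⨆ N, f N a) = ⨆ N, p.expect (f N) := by
  let _ : MeasurableSpace α := ⊤
  simp only [PMF.expect, ENNReal.mul_iSup]
  have h (g : α → ℝ≥0∞) : ∑' a, g a = ∫⁻ a, g a ∂MeasureTheory.Measure.count :=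
    (MeasureTheory.lintegral_count g).symm
  simp only [h]
  refine MeasureTheory.lintegral_iSup (fun N => Measurable.of_discrete) fun N M hNM a => ?_
  exact mul_le_mul' le_rfl (hf hNM a)

theorem Multiset.sum_map_iSup {α : Type*} (s : Multiset α) (f : ℕ → α → ℝ≥0∞) (hf : Monotone f) :
    (s.map fun a => ⨆ N, f N a).sum = ⨆ N, (s.map (f N)).sum := by
  induction s using Multiset.induction_on with
  | empty => simp
  | cons a s ih =>
    simp only [Multiset.map_cons, Multiset.sum_cons]
    rw [ih, ENNReal.iSup_add_iSup_of_monotone]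
    · exact fun N M h => hf h a
    · exact fun N M h => Multiset.sum_map_le_sum_map _ _ fun i _ => hf h i

/-! ### The killed tagged particle and its survival function -/

namespace ParticleSystem

open Config

variable {ι V : Type*} [Fintype ι] [DecidableEq ι] [Fintype V] [DecidableEq V]
variable (R : ParticleSystem ι) (G : SimpleGraph V) [DecidableRel G.Adj]

theorem tagKernel_mono {F F' : ι × V → Config ι V → ℝ≥0∞} {i : ι × V}
    (h : ∀ v ξ, F (i.1, v) ξ ≤ F' (i.1, v) ξ) (ξ : Config ι V) :
    R.tagKernel G F i ξ ≤ R.tagKernel G F' i ξ := by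
  unfold tagKernel
  refine mul_le_mul' le_rfl (add_le_add (mul_le_mul' le_rfl (PMF.expect_mono fun v _ =>
    mul_le_mul' le_rfl (h v ξ))) (Multiset.sum_map_le_sum_map _ _ fun p _ =>
    mul_le_mul' le_rfl (PMF.expect_mono fun v _ => PMF.expect_mono fun Y _ => h i.2 Y)))

theorem tagKernel_le_const {F : ι × V → Config ι V → ℝ≥0∞} {c : ℝ≥0∞} (h : ∀ i ξ, F i ξ ≤ c)
    (i : ι × V) (ξ : Config ι V) : R.tagKernel G F i ξ ≤ c := by
  have h0 : (R.speed i.1 : ℝ≥0∞) + R.speedSum ξ ≠ 0 := by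
    simp [(R.speed_pos i.1).ne']
  have h1 : (R.speed i.1 : ℝ≥0∞) + R.speedSum ξ ≠ ∞ :=
    ENNReal.add_ne_top.2 ⟨ENNReal.coe_ne_top, R.speedSum_ne_top ξ⟩
  calc R.tagKernel G F i ξ
      ≤ ((R.speed i.1 : ℝ≥0∞) + R.speedSum ξ)⁻¹ * ((R.speed i.1 : ℝ≥0∞) * c +
        (ξ.map fun p => (R.speed p.1 : ℝ≥0∞) * c).sum) := by
        unfold tagKernel
        refine mul_le_mul' le_rfl (add_le_add (mul_le_mul' le_rfl (PMF.expect_le_of_le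
          fun v _ => ?_)) (Multiset.sum_map_le_sum_map _ _ fun p _ => mul_le_mul' le_rfl
          (PMF.expect_le_of_le fun v _ => PMF.expect_le_of_le fun Y _ => h _ _)))
        calc _ ≤ 1 * c := mul_le_mul' (PMF.coe_le_one _ _) (h _ _)
          _ = c := one_mul c
    _ = ((R.speed i.1 : ℝ≥0∞) + R.speedSum ξ)⁻¹ *
        ((R.speed i.1 : ℝ≥0∞) + R.speedSum ξ) * c := by
        rw [Multiset.sum_map_mul_right, ← add_mul, mul_assoc]; rfl
    _ = c := by rw [ENNReal.inv_mul_cancel h0 h1, one_mul]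

theorem tagKernel_iSup (F : ℕ → ι × V → Config ι V → ℝ≥0∞) (hF : Monotone F) (i : ι × V)
    (ξ : Config ι V) :
    R.tagKernel G (fun i ξ => ⨆ N, F N i ξ) i ξ = ⨆ N, R.tagKernel G (F N) i ξ := by
  have hm : ∀ i ξ, Monotone fun N => F N i ξ := fun i ξ N M h => hF h i ξ
  unfold tagKernel
  simp only [ENNReal.mul_iSup]
  rw [PMF.expect_iSup _ (fun N v => R.meetLaw i.1 (ξ.typesAt v) none * F N (i.1, v) ξ)
    fun N M h v => mul_le_mul' le_rfl (hm _ _ h)]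
  have h1 : ∀ p v, (R.arrive (ξ.erase p) p.1 v).expect (fun ξ => ⨆ N, F N i ξ) =
      ⨆ N, (R.arrive (ξ.erase p) p.1 v).expect (F N i) :=
    fun p v => PMF.expect_iSup _ (fun N => F N i) fun N M h Y => hm _ _ h
  have h2 : ∀ p : ι × V, ((walkStep G p.2).expect fun v =>
      ⨆ N, (R.arrive (ξ.erase p) p.1 v).expect (F N i)) =
      ⨆ N, (walkStep G p.2).expect fun v => (R.arrive (ξ.erase p) p.1 v).expect (F N i) :=
    fun p => PMF.expect_iSup _ (fun N v => (R.arrive (ξ.erase p) p.1 v).expect (F N i))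
      fun N M h v => PMF.expect_mono fun Y _ => hm _ _ h
  simp only [h1, h2, ENNReal.mul_iSup]
  rw [Multiset.sum_map_iSup ξ (fun N p => (R.speed p.1 : ℝ≥0∞) * (walkStep G p.2).expect fun v =>
      (R.arrive (ξ.erase p) p.1 v).expect (F N i)) fun N M h p => mul_le_mul' le_rfl
        (PMF.expect_mono fun v _ => PMF.expect_mono fun Y _ => hm _ _ h),
    ENNReal.iSup_add_iSup_of_monotone, ENNReal.mul_iSup]
  · exact fun N M h => mul_le_mul' le_rfl (PMF.expect_mono fun v _ =>
      mul_le_mul' le_rfl (hm _ _ h))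
  · exact fun N M h => Multiset.sum_map_le_sum_map _ _ fun p _ => mul_le_mul' le_rfl
      (PMF.expect_mono fun v _ => PMF.expect_mono fun Y _ => hm _ _ h)

/-- The sums of the powers of the factor `β` up to the `N`th, or up to the time when the tagged
particle is killed or the environment leaves the set `A`, in expectation. -/
def survival (β : ℝ≥0∞) (A : Set (Config ι V)) [DecidablePred (· ∈ A)] :
    ℕ → ι × V → Config ι V → ℝ≥0∞
  | 0 => fun _ _ => 0
  | N + 1 => fun i ξ => if ξ ∈ A then 1 + β * R.tagKernel G (survival β A N) i ξ else 0

variable {β : ℝ≥0∞} {A : Set (Config ι V)} [DecidablePred (· ∈ A)]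

theorem survival_succ (N : ℕ) (i : ι × V) (ξ : Config ι V) : R.survival G β A (N + 1) i ξ =
    if ξ ∈ A then 1 + β * R.tagKernel G (R.survival G β A N) i ξ else 0 := rfl

theorem survival_monotone : Monotone (R.survival G β A) := by
  refine monotone_nat_of_le_succ fun N => ?_
  induction N with
  | zero => intro i ξ; simp [survival]
  | succ N ih =>
    intro i ξ
    rw [survival_succ, survival_succ]
    split_ifs
    · gcongr
      exact R.tagKernel_mono G (fun v ξ => ih _ _) ξ
    · exact le_rfl

/-- This crude bound grows with `N`; it only permits the passage to real numbers in
`sum_survival_sq_le`, where the uniform bound is proved. -/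
theorem survival_ne_top (hβ : β ≠ ∞) (N : ℕ) : ∃ c : ℝ≥0∞, c ≠ ∞ ∧ ∀ i ξ,
    R.survival G β A N i ξ ≤ c := by
  induction N with
  | zero => exact ⟨0, by simp, fun i ξ => le_rfl⟩
  | succ N ih =>
    obtain ⟨c, hc, h⟩ := ih
    refine ⟨1 + β * c, by finiteness, fun i ξ => ?_⟩
    rw [survival_succ]
    split_ifs
    · gcongr
      exact R.tagKernel_le_const G h i ξ
    · exact zero_le

theorem survival_eq_zero {ξ : Config ι V} (hξ : ξ ∉ A) (N : ℕ) (i : ι × V) :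
    R.survival G β A N i ξ = 0 := by
  cases N <;> simp [survival, hξ]

/-- Monotone convergence in the recursion that defines `survival`: the limit satisfies the Lyapunov
inequality on `A`. -/
theorem one_add_mul_tagKernel_iSup_survival_le {ξ : Config ι V} (hξ : ξ ∈ A) (i : ι × V) :
    1 + β * R.tagKernel G (fun i ξ => ⨆ N, R.survival G β A N i ξ) i ξ ≤
      ⨆ N, R.survival G β A N i ξ := by
  rw [R.tagKernel_iSup G _ (R.survival_monotone G), ENNReal.mul_iSup, ENNReal.add_iSup]
  refine iSup_le fun N => le_iSup_of_le (N + 1) ?_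
  rw [survival_succ, if_pos hξ]

variable {G}

set_option maxHeartbeats 1000000 in
/-- The squared norm of the survival function, as a function of the position of the tagged
particle, is controlled by the crowding, if in each environment the combined effect of the killing
of the tagged particle and of the change of the crowding is a contraction. -/
theorem sum_survival_sq_le {β : ℝ} (hβ : 0 ≤ β) (a b : ι) {e : ι → ℝ} {L τ M w : ℝ} (hL : 1 ≤ L)
    (he : ∀ c, 1 ≤ e c) (hτ : 0 ≤ τ) (hM : 0 ≤ M) (hw : 0 < w)
    (hcrowd : ∀ ξ ∈ A, ∀ c u v, (c, u) ∈ ξ → ∀ Y ∈ (R.arrive (ξ.erase (c, u)) c v).support,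
      crowding a e L Y ≤ crowding a e L ξ * crowdingRatio a ξ c u v)
    (hcontr : ∀ ξ ∈ A, ∃ ρ : ℝ, (∀ h : V → ℝ, (∀ u, 0 ≤ h u) →
        ∑ u, ∑ v, walkProb G u v * (h u * ((R.meetLaw b (ξ.typesAt v) none).toReal * h v)) ≤
          ρ * ∑ u, h u ^ 2) ∧
      β * R.crowdingRate G a τ ξ + w ≤
        R.speed b + (R.speedSum ξ).toReal - β * R.speed b * ρ ∧
      √(Fintype.card V) * (R.speed b + (R.speedSum ξ).toReal) ≤ M * w)
    (N : ℕ) (ξ : Config ι V) :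
    √(∑ u, (R.survival G (ENNReal.ofReal β) A N (b, u) ξ).toReal ^ 2) ≤
      M * crowding a e L ξ ^ τ := by
  have hL0 : 0 < L := by linarith
  induction N generalizing ξ with
  | zero =>
    simp only [survival, ENNReal.toReal_zero]
    have := Real.rpow_nonneg (crowding_pos (a := a) (e := e) hL0 ξ).le τ
    simp only [ne_eq, OfNat.ofNat_ne_zero, not_false_eq_true, zero_pow, Finset.sum_const_zero,
      Real.sqrt_zero]
    positivity
  | succ N ih =>
    have hH0 := Real.rpow_nonneg (crowding_pos (a := a) (e := e) hL0 ξ).le τ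
    by_cases hξ : ξ ∈ A
    swap
    · simp only [R.survival_eq_zero G hξ, ENNReal.toReal_zero]
      simp only [ne_eq, OfNat.ofNat_ne_zero, not_false_eq_true, zero_pow, Finset.sum_const_zero,
        Real.sqrt_zero]
      positivity
    set f := R.survival G (ENNReal.ofReal β) A N with hf
    obtain ⟨C, hC, hfC⟩ := R.survival_ne_top G (A := A) (ENNReal.ofReal_ne_top (r := β)) N
    have hftop : ∀ i ξ, f i ξ ≠ ∞ := fun i ξ => ne_top_of_le_ne_top hC (hfC i ξ)
    obtain ⟨C', hC', hfC'⟩ := R.survival_ne_top G (A := A) (ENNReal.ofReal_ne_top (r := β)) (N + 1)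
    set h : V → ℝ := fun u => (R.survival G (ENNReal.ofReal β) A (N + 1) (b, u) ξ).toReal with hh
    have hh0 : ∀ u, 0 ≤ h u := fun u => ENNReal.toReal_nonneg
    -- Monotonicity in `N` allows the same function `h` to stand on both sides of the recursion.
    -- Then a bound on the quadratic form suffices, rather than on the operator norm.
    have hfh : ∀ u, (f (b, u) ξ).toReal ≤ h u := fun u =>
      ENNReal.toReal_mono (ne_top_of_le_ne_top hC' (hfC' _ _))
        (R.survival_monotone G (Nat.le_succ N) _ _)
    set x := √(∑ u, h u ^ 2) with hx
    have hx0 : 0 ≤ x := Real.sqrt_nonneg _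
    have hxsq : x ^ 2 = ∑ u, h u ^ 2 := Real.sq_sqrt (Finset.sum_nonneg fun u _ => sq_nonneg _)
    set H := crowding a e L ξ ^ τ with hH
    have hH1 : 1 ≤ H := Real.one_le_rpow (one_le_crowding he hL ξ) hτ
    set Z : ℝ := R.speed b + (R.speedSum ξ).toReal with hZ
    have hsb : (0 : ℝ) < R.speed b := R.speed_pos b
    have hZ0 : 0 < Z := by have := ENNReal.toReal_nonneg (a := R.speedSum ξ); linarith
    set Y := R.crowdingRate G a τ ξ with hY
    have hY0 : 0 ≤ Y := R.crowdingRate_nonneg a τ ξ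
    set T : V → ℝ≥0∞ := fun u => (ξ.map fun p => (R.speed p.1 : ℝ≥0∞) *
      (walkStep G p.2).expect fun v => (R.arrive (ξ.erase p) p.1 v).expect (f (b, u))).sum with hT
    have hTtop : ∀ u, T u ≠ ∞ := by
      intro u
      refine ne_top_of_le_ne_top (b := R.speedSum ξ * C)
        (ENNReal.mul_ne_top (R.speedSum_ne_top ξ) hC) ?_
      rw [speedSum, ← Multiset.sum_map_mul_right]
      exact Multiset.sum_map_le_sum_map _ _ fun p _ => mul_le_mul' le_rfl
        (PMF.expect_le_of_le fun v _ => PMF.expect_le_of_le fun Y _ => hfC _ _)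
    -- the contribution of the moves of the environment
    have hTsum : ∑ u, h u * (T u).toReal ≤ x * M * H * Y := by
      have h1 : ∑ u, ENNReal.ofReal (h u) * T u = (ξ.map fun p => (R.speed p.1 : ℝ≥0∞) *
          (walkStep G p.2).expect fun v => (R.arrive (ξ.erase p) p.1 v).expect fun X =>
            ∑ u, ENNReal.ofReal (h u) * f (b, u) X).sum := by
        simp only [hT, PMF.expect_finset_sum, PMF.expect_mul_left, Multiset.sum_map_eq_sum_count,
          Finset.mul_sum]
        rw [Finset.sum_comm]
        refine Finset.sum_congr rfl fun p _ => Finset.sum_congr rfl fun u _ => ?_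
        ring
      have h2 : ∀ p ∈ ξ, ∀ v, ∀ X ∈ (R.arrive (ξ.erase p) p.1 v).support,
          ∑ u, ENNReal.ofReal (h u) * f (b, u) X ≤
            ENNReal.ofReal (x * M * H * crowdingRatio a ξ p.1 p.2 v ^ τ) := by
        intro p hp v X hX
        have h3 : ∑ u, ENNReal.ofReal (h u) * f (b, u) X =
            ENNReal.ofReal (∑ u, h u * (f (b, u) X).toReal) := by
          rw [ENNReal.ofReal_sum_of_nonneg
            fun u _ => mul_nonneg (hh0 u) ENNReal.toReal_nonneg]
          refine Finset.sum_congr rfl fun u _ => ?_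
          rw [ENNReal.ofReal_mul (hh0 u), ENNReal.ofReal_toReal (hftop _ _)]
        rw [h3]
        refine ENNReal.ofReal_le_ofReal ?_
        have h4 := hcrowd ξ hξ p.1 p.2 v hp X hX
        have h5 : crowding a e L X ^ τ ≤ H * crowdingRatio a ξ p.1 p.2 v ^ τ := by
          rw [hH, ← Real.mul_rpow (crowding_pos hL0 ξ).le (crowdingRatio_nonneg _ _ _ _)]
          exact Real.rpow_le_rpow (crowding_pos hL0 X).le h4 hτ
        calc ∑ u, h u * (f (b, u) X).toReal
            ≤ x * √(∑ u, (f (b, u) X).toReal ^ 2) := Real.sum_mul_le_sqrt_mul_sqrt _ _ _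
          _ ≤ x * (M * crowding a e L X ^ τ) := by gcongr; exact ih X
          _ ≤ x * (M * (H * crowdingRatio a ξ p.1 p.2 v ^ τ)) := by gcongr
          _ = _ := by ring
      have h3 : ∑ u, ENNReal.ofReal (h u) * T u ≤ ENNReal.ofReal (x * M * H * Y) := by
        rw [h1]
        calc _ ≤ (ξ.map fun p => (R.speed p.1 : ℝ≥0∞) * (walkStep G p.2).expect fun v =>
              ENNReal.ofReal (x * M * H * crowdingRatio a ξ p.1 p.2 v ^ τ)).sum :=
            Multiset.sum_map_le_sum_map _ _ fun p hp => mul_le_mul' le_rfl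
              (PMF.expect_mono fun v _ => PMF.expect_le_of_le fun X hX => h2 p hp v X hX)
          _ = ENNReal.ofReal (x * M * H * Y) := by
            rw [Multiset.sum_map_eq_sum_count, hY, crowdingRate, Finset.mul_sum,
              ENNReal.ofReal_sum_of_nonneg]
            · refine Finset.sum_congr rfl fun p _ => ?_
              have h6 : x * M * H * ((ξ.count p : ℝ) * (R.speed p.1 *
                  ∑ v, walkProb G p.2 v * crowdingRatio a ξ p.1 p.2 v ^ τ)) =
                  (ξ.count p : ℝ) * (R.speed p.1 *
                  ∑ v, walkProb G p.2 v * (x * M * H * crowdingRatio a ξ p.1 p.2 v ^ τ)) := by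
                simp only [Finset.mul_sum]
                exact Finset.sum_congr rfl fun v _ => by ring
              have h7 : ∀ v, 0 ≤ walkProb G p.2 v *
                  (x * M * H * crowdingRatio a ξ p.1 p.2 v ^ τ) := by
                intro v
                have := walkProb_nonneg G p.2 v
                have := Real.rpow_nonneg (crowdingRatio_nonneg (a := a) ξ p.1 p.2 v) τ
                positivity
              rw [h6, ENNReal.ofReal_mul (Nat.cast_nonneg _), ENNReal.ofReal_natCast,
                ENNReal.ofReal_mul (NNReal.coe_nonneg _), ENNReal.ofReal_coe_nnreal,
                ENNReal.ofReal_sum_of_nonneg fun v _ => h7 v, PMF.expect_fintype]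
              congr 2
              refine Finset.sum_congr rfl fun v _ => ?_
              rw [ENNReal.ofReal_mul (walkProb_nonneg G _ _), ofReal_walkProb]
            · intro p _
              have : 0 ≤ ∑ v, walkProb G p.2 v * crowdingRatio a ξ p.1 p.2 v ^ τ :=
                Finset.sum_nonneg fun v _ => mul_nonneg (walkProb_nonneg G _ _)
                  (Real.rpow_nonneg (crowdingRatio_nonneg _ _ _ _) _)
              have := NNReal.coe_nonneg (R.speed p.1)
              positivity
      have h4 : ∑ u, ENNReal.ofReal (h u) * T u = ENNReal.ofReal (∑ u, h u * (T u).toReal) := by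
        rw [ENNReal.ofReal_sum_of_nonneg fun u _ => mul_nonneg (hh0 u) ENNReal.toReal_nonneg]
        refine Finset.sum_congr rfl fun u _ => ?_
        rw [ENNReal.ofReal_mul (hh0 u), ENNReal.ofReal_toReal (hTtop u)]
      rw [h4] at h3
      exact (ENNReal.ofReal_le_ofReal_iff (by positivity)).1 h3
    -- the recursion, in real numbers
    set κ : V → ℝ := fun v => (R.meetLaw b (ξ.typesAt v) none).toReal with hκ
    have hrec : ∀ u, h u ≤ 1 + β / Z * (R.speed b * ∑ v, walkProb G u v * (κ v * h v) +
        (T u).toReal) := by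
      intro u
      have h1 : R.survival G (ENNReal.ofReal β) A (N + 1) (b, u) ξ =
          1 + ENNReal.ofReal β * (((R.speed b : ℝ≥0∞) + R.speedSum ξ)⁻¹ *
            ((R.speed b : ℝ≥0∞) * (∑ v, walkStep G u v *
              (R.meetLaw b (ξ.typesAt v) none * f (b, v) ξ)) + T u)) := by
        rw [survival_succ, if_pos hξ, tagKernel, PMF.expect_fintype]
      have h2 : ∀ v, walkStep G u v * (R.meetLaw b (ξ.typesAt v) none * f (b, v) ξ) ≠ ∞ :=
        fun v => ENNReal.mul_ne_top (PMF.apply_ne_top _ _)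
          (ENNReal.mul_ne_top (PMF.apply_ne_top _ _) (hftop _ _))
      have h3 : h u = 1 + β / Z * (R.speed b * ∑ v, walkProb G u v *
          (κ v * (f (b, v) ξ).toReal) + (T u).toReal) := by
        have hZ' : Z = ((R.speed b : ℝ≥0∞) + R.speedSum ξ).toReal := by
          rw [ENNReal.toReal_add ENNReal.coe_ne_top (R.speedSum_ne_top ξ)]; simp [hZ]
        have h4 : (∑ v, walkStep G u v * (R.meetLaw b (ξ.typesAt v) none * f (b, v) ξ)) ≠ ∞ :=
          ENNReal.sum_ne_top.2 fun v _ => h2 v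
        have h5 : ((R.speed b : ℝ≥0∞) + R.speedSum ξ)⁻¹ ≠ ∞ := by
          simp [(R.speed_pos b).ne']
        have h6 : ((R.speed b : ℝ≥0∞) * (∑ v, walkStep G u v *
            (R.meetLaw b (ξ.typesAt v) none * f (b, v) ξ)) + T u) ≠ ∞ :=
          ENNReal.add_ne_top.2 ⟨ENNReal.mul_ne_top ENNReal.coe_ne_top h4, hTtop u⟩
        simp only [hh]
        rw [h1, ENNReal.toReal_add ENNReal.one_ne_top (ENNReal.mul_ne_top ENNReal.ofReal_ne_top
          (ENNReal.mul_ne_top h5 h6)), ENNReal.toReal_mul, ENNReal.toReal_mul, ENNReal.toReal_inv,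
          ← hZ', ENNReal.toReal_add (ENNReal.mul_ne_top ENNReal.coe_ne_top h4) (hTtop u),
          ENNReal.toReal_mul, ENNReal.toReal_sum fun v _ => h2 v, ENNReal.toReal_ofReal hβ]
        simp only [ENNReal.toReal_mul, ENNReal.toReal_one, ENNReal.coe_toReal]
        rw [div_eq_mul_inv, mul_assoc]
        rfl
      rw [h3]
      have := div_nonneg hβ hZ0.le
      refine add_le_add_right (mul_le_mul_of_nonneg_left (add_le_add_left
        (mul_le_mul_of_nonneg_left (Finset.sum_le_sum fun v _ => ?_) hsb.le) _) this) _
      exact mul_le_mul_of_nonneg_left (mul_le_mul_of_nonneg_left (hfh v) ENNReal.toReal_nonneg)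
        (walkProb_nonneg G u v)
    obtain ⟨ρ, hρ, hYw, hMw⟩ := hcontr ξ hξ
    -- The recursion is multiplied by `h u` and summed over `u`. Moves of the tagged particle give
    -- the form bounded by ρ x², and moves of the environment give `x * M * H * Y` by Cauchy–Schwarz
    -- and the induction hypothesis.
    have hmain : x ^ 2 ≤ √(Fintype.card V) * x +
        β / Z * (R.speed b * (ρ * x ^ 2) + x * M * H * Y) := by
      have h1 : ∑ u, h u ≤ √(Fintype.card V) * x := by
        have := Real.sum_mul_le_sqrt_mul_sqrt Finset.univ (fun _ : V => (1 : ℝ)) h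
        simpa using this
      have h2 := hρ h hh0
      have hb := div_nonneg hβ hZ0.le
      calc x ^ 2 = ∑ u, h u * h u := by rw [hxsq]; exact Finset.sum_congr rfl fun u _ => pow_two _
        _ ≤ ∑ u, h u * (1 + β / Z * (R.speed b * ∑ v, walkProb G u v * (κ v * h v) +
            (T u).toReal)) := Finset.sum_le_sum fun u _ => mul_le_mul_of_nonneg_left (hrec u) (hh0 u)
        _ = ∑ u, h u + β / Z * (R.speed b *
            (∑ u, ∑ v, walkProb G u v * (h u * (κ v * h v))) + ∑ u, h u * (T u).toReal) := by
          rw [Finset.mul_sum, ← Finset.sum_add_distrib, Finset.mul_sum, ← Finset.sum_add_distrib]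
          refine Finset.sum_congr rfl fun u _ => ?_
          have : ∑ v, walkProb G u v * (h u * (κ v * h v)) =
              h u * ∑ v, walkProb G u v * (κ v * h v) := by
            rw [Finset.mul_sum]; exact Finset.sum_congr rfl fun v _ => by ring
          rw [this]; ring
        _ ≤ _ := by rw [hxsq]; gcongr
    -- If x > MH, the assumption β Y + w ≤ Z - β s_b ρ makes the linear terms exceed the right-hand
    -- side: the source term √n Z is at most M w ≤ M H w.
    by_contra hlt
    push Not at hlt
    have hMH : 0 ≤ M * H := by positivity
    have hxpos : 0 < x := lt_of_le_of_lt hMH hlt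
    have h1 : x * Z ≤ √(Fintype.card V) * Z + β * (R.speed b * ρ * x + M * H * Y) := by
      have h2 : x ^ 2 * Z ≤ (√(Fintype.card V) * Z +
          β * (R.speed b * ρ * x + M * H * Y)) * x := by
        calc x ^ 2 * Z ≤ (√(Fintype.card V) * x +
              β / Z * (R.speed b * (ρ * x ^ 2) + x * M * H * Y)) * Z := by gcongr
          _ = _ := by field_simp
      nlinarith
    have h2 : x * (β * Y + w) ≤ x * (Z - β * R.speed b * ρ) := by gcongr
    have h3 : M * w ≤ M * H * w := by
      have : 0 ≤ M * w := by positivity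
      nlinarith
    have h4 : M * H * (β * Y + w) < x * (β * Y + w) := by
      have : 0 ≤ β * Y := by positivity
      gcongr
    nlinarith

end ParticleSystem

/-! ### Killing of a tagged particle -/

namespace ParticleSystem

open Config

universe u

variable {ι : Type*} [Fintype ι] [DecidableEq ι] (R : ParticleSystem ι)

theorem speed_le_one (a : ι) : R.speed a ≤ 1 :=
  R.sum_speed ▸ Finset.single_le_sum (f := R.speed) (fun _ _ => zero_le) (Finset.mem_univ a)

theorem speedSum_le_energy {V : Type*} [Fintype V] [DecidableEq V] {e : ι → ℝ}
    (he : ∀ c, 1 ≤ e c) (X : Config ι V) : (R.speedSum X).toReal ≤ energy e X := by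
  have h : R.speedSum X ≤ (Multiset.card X : ℝ≥0∞) := by
    unfold speedSum
    calc _ ≤ (X.map fun _ => (1 : ℝ≥0∞)).sum := Multiset.sum_map_le_sum_map _ _ fun p _ => by
          exact_mod_cast R.speed_le_one p.1
      _ = _ := by simp
  refine le_trans ?_ (card_le_energy he X)
  have := ENNReal.toReal_mono (ENNReal.natCast_ne_top _) h
  simpa using this

theorem idleProb_lt_one {a b : ι} (h : R.HasEffectiveReaction a b) : R.idleProb a b < 1 := by
  obtain ⟨S, hS, hne⟩ := h
  refine lt_of_le_of_ne (R.idleProb_le_one a b) fun h1 => hne ?_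
  have h2 := (PMF.apply_eq_one_iff (R.react a b) {a, b}).1 h1
  rw [h2] at hS
  exact hS

theorem exists_idleProb_le : ∃ p : ℝ, 0 < p ∧ p ≤ 1 ∧ ∀ a b, R.HasEffectiveReaction a b →
    (R.idleProb a b).toReal ≤ 1 - p := by
  classical
  obtain ⟨p, hp, h⟩ := exists_pos_le (fun i : ι × ι =>
    if R.HasEffectiveReaction i.1 i.2 then 1 - (R.idleProb i.1 i.2).toReal else 1) (by
      rintro ⟨a, b⟩
      dsimp only
      split_ifs with hab
      · have h1 := R.idleProb_lt_one hab
        have h2 := (ENNReal.toReal_lt_toReal h1.ne_top ENNReal.one_ne_top).2 h1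
        simp only [ENNReal.toReal_one] at h2
        linarith
      · exact one_pos)
  refine ⟨min p 1, by positivity, min_le_right _ _, fun a b hab => ?_⟩
  have := h (a, b)
  simp only [hab, if_true] at this
  have := min_le_left p 1
  linarith

theorem IsEnergy.exists_card_le {e : ι → ℝ} (he : R.IsEnergy e) :
    ∃ k : ℕ, ∀ a b S, R.EffectiveOutput a b S → Multiset.card S ≤ k := by
  refine ⟨⌈2 * ∑ c, |e c|⌉₊, fun a b S hS => ?_⟩
  have h1 := he.drop a b S hS
  have h2 := card_le_sum_energy he.one_le S
  have h3 : ∀ c, e c ≤ ∑ c, |e c| := fun c => (le_abs_self _).trans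
    (Finset.single_le_sum (f := fun c => |e c|) (fun _ _ => abs_nonneg _) (Finset.mem_univ c))
  have h4 := h3 a
  have h5 := h3 b
  have : (Multiset.card S : ℝ) ≤ ⌈2 * ∑ c, |e c|⌉₊ := by
    have := Nat.le_ceil (2 * ∑ c, |e c|)
    linarith
  exact_mod_cast this

/-- If there are enough particles of type `a`, then either these are concentrated, and spread out,
or they are spread out, and then a particle of a type `b` that reacts with `a` is killed with a
substantial probability. -/
theorem exists_contraction {γ ε K p s : ℝ} (hγ : 0 < γ) (hε : 0 < ε) (hK : 1 ≤ K) (hp : 0 < p)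
    (hp1 : p ≤ 1) (hs : 0 < s) (hs1 : s ≤ 1) :
    ∃ θ w : ℝ, 0 < θ ∧ θ ≤ 1 / 4 ∧ 0 < w ∧ ∀ (R : ParticleSystem ι) (_ : ∀ c, s ≤ R.speed c)
      (V : Type u) [Fintype V] [DecidableEq V] (G : SimpleGraph V) [DecidableRel G.Adj]
      (_ : 0 < Fintype.card V) (_ : HasWalkGap G γ) (a b : ι)
      (_ : (R.idleProb b a).toReal ≤ 1 - p) (ξ : Config ι V)
      (_ : ε * Fintype.card V ≤ mass a ξ) (_ : mass a ξ ≤ K * Fintype.card V),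
      ∃ ρ : ℝ, (∀ h : V → ℝ, (∀ u, 0 ≤ h u) →
        ∑ u, ∑ v, walkProb G u v * (h u * ((R.meetLaw b (ξ.typesAt v) none).toReal * h v)) ≤
          ρ * ∑ u, h u ^ 2) ∧
        R.crowdingRate G a (θ / Fintype.card V) ξ + R.speed b * ρ ≤
          R.speed b + (R.speedSum ξ).toReal - w := by
  -- This is the threshold on `rootSum / n`. In the concentrated case it bounds the spread rate by
  -- -γ(ε - δ)n + δn ≤ -γεn/2.
  set δ := min 1 (γ * ε / (2 * (γ + 1))) with hδ
  have hδ0 : 0 < δ := by positivity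
  have hδ1 : δ ≤ 1 := min_le_left _ _
  have hδ2 : (γ + 1) * δ ≤ γ * ε / 2 := by
    have : δ ≤ γ * ε / (2 * (γ + 1)) := min_le_right _ _
    calc (γ + 1) * δ ≤ (γ + 1) * (γ * ε / (2 * (γ + 1))) := by gcongr
      _ = γ * ε / 2 := by field_simp
  -- The density of occupied vertices guaranteed by `rootSum_sq_le` in the spread-out case.
  set σ := δ ^ 2 / K with hσ
  have hσ0 : 0 < σ := by positivity
  set c := min (p / 2) γ / (2 * (2 / σ + 1)) with hc
  have hc0 : 0 < c := by positivity
  have hc1 : c ≤ 1 := by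
    rw [hc, div_le_one (by positivity)]
    have h1 : min (p / 2) γ ≤ p / 2 := min_le_left _ _
    have h2 : 0 < 2 / σ := by positivity
    linarith
  -- In the spread-out case the crowding may increase, at a cost of at most 2(θ/n)Kn = sc/2. This is
  -- half of the gain sc from killing.
  set θ := s * c / (4 * K) with hθ
  have hθ0 : 0 < θ := by positivity
  refine ⟨θ, min (s * c / 2) (θ * s * γ * ε), hθ0, ?_, by positivity, ?_⟩
  · rw [hθ, div_le_div_iff₀ (by positivity) (by norm_num)]
    nlinarith [mul_le_one₀ hs1 hc0.le hc1]
  have hθ1 : θ ≤ 1 / 4 := by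
    rw [hθ, div_le_div_iff₀ (by positivity) (by norm_num)]
    nlinarith [mul_le_one₀ hs1 hc0.le hc1]
  intro R hR V _ _ G _ hV hG a b hab ξ hξ1 hξ2
  set n : ℝ := (Fintype.card V : ℝ) with hn
  have hn0 : 0 < n := by rw [hn]; exact_mod_cast hV
  have hn1 : 1 ≤ n := by rw [hn]; exact_mod_cast hV
  have hκ1 : ∀ v, (R.meetLaw b (ξ.typesAt v) none).toReal ≤ 1 := fun v =>
    ENNReal.toReal_le_of_le_ofReal zero_le_one (by simpa using PMF.coe_le_one _ _)
  have hκ0 : ∀ v, 0 ≤ (R.meetLaw b (ξ.typesAt v) none).toReal := fun v => ENNReal.toReal_nonneg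
  have hτ : 2 * (θ / n) ≤ 1 := by
    have : θ / n ≤ θ := div_le_self hθ0.le hn1
    linarith
  have hrate := R.crowdingRate_le (G := G) a (by positivity : 0 ≤ θ / n) hτ ξ
  have hspread := spreadRate_le hG a ξ
  have hsq := sum_sq_div_le a ξ hV
  have hB := rootSum_nonneg a ξ
  have hsa : s ≤ R.speed a := hR a
  have hsa1 : (R.speed a : ℝ) ≤ 1 := by exact_mod_cast R.speed_le_one a
  by_cases hgood : δ * n ≤ rootSum a ξ
  · refine ⟨1 - c, fun h hh => ?_, ?_⟩
    · refine hG.sum_killed_le hγ hp hσ0 (Finset.univ.filter fun v => (a, v) ∈ ξ) ?_ hV h _ hh hκ0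
        hκ1 fun v hv => ?_
      · have h1 := rootSum_sq_le a ξ
        have h2 : (δ * n) ^ 2 ≤ rootSum a ξ ^ 2 := by gcongr
        have h3 : (δ * n) ^ 2 ≤ (Finset.univ.filter fun v => (a, v) ∈ ξ).card * (K * n) :=
          h2.trans (h1.trans (by gcongr))
        rw [hσ, div_mul_eq_mul_div, div_le_iff₀ (by positivity)]
        refine le_of_mul_le_mul_right ?_ hn0
        calc δ ^ 2 * n * n = (δ * n) ^ 2 := by ring
          _ ≤ _ := h3
          _ = _ := by ring
      · have hv' : a ∈ ξ.typesAt v := mem_typesAt.2 (by simpa using hv)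
        refine le_trans (ENNReal.toReal_mono ?_ (R.meetLaw_none_le b a _ hv')) hab
        exact ne_top_of_le_ne_top ENNReal.one_ne_top (R.idleProb_le_one b a)
    · have h1 : spreadRate G a ξ ≤ K * n := by
        have h2 := rootSum_le a ξ hK hξ2
        have h3 : 0 ≤ γ * (mass a ξ - rootSum a ξ ^ 2 / n) := mul_nonneg hγ.le (by linarith)
        linarith
      have h2 : 2 * (θ / n) * R.speed a * spreadRate G a ξ ≤ s * c / 2 := by
        calc 2 * (θ / n) * R.speed a * spreadRate G a ξ
            ≤ 2 * (θ / n) * R.speed a * (K * n) := by gcongr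
          _ ≤ 2 * (θ / n) * 1 * (K * n) := by gcongr
          _ = s * c / 2 := by rw [hθ]; field_simp; norm_num
      have h3 : s * c ≤ R.speed b * c := by gcongr; exact hR b
      have h4 : min (s * c / 2) (θ * s * γ * ε) ≤ s * c / 2 := min_le_left _ _
      nlinarith
  · push Not at hgood
    -- In the concentrated case killing is ignored (ρ = 1), and the whole gain comes from the
    -- decrease of the crowding.
    refine ⟨1, fun h hh => ?_, ?_⟩
    · have h1 := hG.sum_mul_le h fun v => (R.meetLaw b (ξ.typesAt v) none).toReal * h v
      have h2 : ∑ v, ((R.meetLaw b (ξ.typesAt v) none).toReal * h v) ^ 2 ≤ ∑ v, h v ^ 2 := by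
        refine Finset.sum_le_sum fun v _ => ?_
        have : (R.meetLaw b (ξ.typesAt v) none).toReal * h v ≤ h v :=
          mul_le_of_le_one_left (hh v) (hκ1 v)
        exact pow_le_pow_left₀ (mul_nonneg (hκ0 v) (hh v)) this 2
      linarith
    · have h1 : rootSum a ξ ^ 2 / n ≤ δ * n := by
        rw [div_le_iff₀ hn0]
        calc rootSum a ξ ^ 2 ≤ (δ * n) ^ 2 := by gcongr
          _ = δ * (δ * n * n) := by ring
          _ ≤ 1 * (δ * n * n) := by gcongr
          _ = _ := by ring
      have h2 : spreadRate G a ξ ≤ -(γ * ε * n / 2) := by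
        have h3 : γ * (ε * n) ≤ γ * mass a ξ := by gcongr
        have h4 : γ * (rootSum a ξ ^ 2 / n) ≤ γ * (δ * n) := by gcongr
        have h5 : (γ + 1) * δ * n ≤ γ * ε / 2 * n := by gcongr
        nlinarith
      have h3 : 2 * (θ / n) * R.speed a * spreadRate G a ξ ≤ -(θ * s * γ * ε) := by
        calc 2 * (θ / n) * R.speed a * spreadRate G a ξ
            ≤ 2 * (θ / n) * R.speed a * (-(γ * ε * n / 2)) := by gcongr
          _ = -(θ * R.speed a * γ * ε) := by field_simp
          _ ≤ _ := by
            have : θ * s * γ * ε ≤ θ * R.speed a * γ * ε := by gcongr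
            linarith
      have h4 : min (s * c / 2) (θ * s * γ * ε) ≤ θ * s * γ * ε := min_le_right _ _
      nlinarith

/-- Both the factorials and the energy factor are powers of `N` with exponents of order n. The
exponent θ/n cancels this n. -/
theorem crowding_rpow_le {V : Type*} [Fintype V] [DecidableEq V] {e : ι → ℝ} (he : ∀ c, 1 ≤ e c)
    (a : ι) {K θ : ℝ} (hθ : 0 ≤ θ) {k N : ℕ} (hV : 0 < Fintype.card V) (hN : 1 ≤ N)
    (ξ : Config ι V)
    (hξ : energy e ξ ≤ K * Fintype.card V) (hcard : Multiset.card ξ ≤ N) :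
    crowding a e ((N : ℝ) ^ k) ξ ^ (θ / Fintype.card V) ≤ (N : ℝ) ^ ((k + 1) * K * θ) := by
  set n : ℝ := (Fintype.card V : ℝ) with hn
  have hn0 : 0 < n := by rw [hn]; exact_mod_cast hV
  have hN1 : (1 : ℝ) ≤ N := by exact_mod_cast hN
  have hN0 : (0 : ℝ) < N := by linarith
  have hL : 0 < (N : ℝ) ^ k := by positivity
  have hE : (Multiset.card ξ : ℝ) ≤ K * n := (card_le_energy he ξ).trans hξ
  have h1 : crowding a e ((N : ℝ) ^ k) ξ ≤ (N : ℝ) ^ ((k + 1) * (K * n)) := by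
    have h2 := crowding_add_le (a := a) (e := e) hL N ξ 0 (by simpa using hcard)
    have h0 : crowding a e ((N : ℝ) ^ k) (0 : Config ι V) = 1 := by simp [crowding, energy]
    rw [h0, one_mul, add_zero] at h2
    refine h2.trans ?_
    rw [← Real.rpow_natCast (N : ℝ) k, ← Real.rpow_mul hN0.le, ← Real.rpow_natCast,
      ← Real.rpow_add hN0]
    refine Real.rpow_le_rpow_of_exponent_le hN1 ?_
    have : (k : ℝ) * energy e ξ ≤ k * (K * n) := by gcongr
    linarith
  calc _ ≤ ((N : ℝ) ^ ((k + 1) * (K * n))) ^ (θ / n) :=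
        Real.rpow_le_rpow (crowding_pos hL ξ).le h1 (by positivity)
    _ = _ := by
      rw [← Real.rpow_mul hN0.le]
      congr 1
      field_simp

/-- The configurations in which there are at least `ε n` particles of type `a`, and the energy is at
most `K n`, where `n` is the number of vertices. -/
def denseConfig {V : Type*} [Fintype V] [DecidableEq V] (e : ι → ℝ) (ε K : ℝ) (a : ι) :
    Set (Config ι V) :=
  {ξ | ε * Fintype.card V ≤ mass a ξ ∧ energy e ξ ≤ K * Fintype.card V}

/-- As long as there are at least `ε n` particles of type `a`, a particle of type `b` that reacts
with `a` is killed within a time of order `n log n`: a function satisfying a Lyapunov inequality. -/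
theorem IsEnergy.exists_lyapunov {e : ι → ℝ} (he : R.IsEnergy e) {γ ε K : ℝ} (hγ : 0 < γ)
    (hε : 0 < ε) (hK : 1 ≤ K) :
    ∃ η D : ℝ, ∃ A : ℕ, 0 < η ∧ 1 ≤ D ∧ ∀ (V : Type u) [Fintype V] [DecidableEq V]
      (G : SimpleGraph V) [DecidableRel G.Adj], 0 < Fintype.card V → HasWalkGap G γ →
      ∀ a b, R.HasEffectiveReaction b a → ∃ F : ι × V → Config ι V → ℝ≥0∞,
        (∀ u ξ, F (b, u) ξ ≤ ENNReal.ofReal (D * (Fintype.card V : ℝ) ^ A)) ∧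
        ∀ u, ∀ ξ ∈ denseConfig e ε K a, 1 + ENNReal.ofReal (1 + η / Fintype.card V) *
          R.tagKernel G F (b, u) ξ ≤ F (b, u) ξ := by
  classical
  obtain ⟨p, hp, hp1, hidle⟩ := R.exists_idleProb_le
  obtain ⟨s₀, hs₀, hspeed₀⟩ := exists_pos_le (fun c => (R.speed c : ℝ)) fun c => R.speed_pos c
  obtain ⟨s, hs, hs1, hspeed⟩ : ∃ s : ℝ, 0 < s ∧ s ≤ 1 ∧ ∀ c, s ≤ R.speed c :=
    ⟨min s₀ 1, by positivity, min_le_right _ _, fun c => (min_le_left _ _).trans (hspeed₀ c)⟩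
  obtain ⟨θ, w, hθ, hθ1, hw, hcontr⟩ :=
    exists_contraction.{u} (ι := ι) hγ hε hK hp hp1 hs hs1
  obtain ⟨k, hk⟩ := he.exists_card_le
  -- The total speed, including the tagged particle, is at most (K + 1)n. The discount factor 1 +
  -- η/n then costs at most half of the gain `w`.
  set η := w / (2 * (K + 1)) with hη
  set B := ⌈(k + 1) * K * θ⌉₊ with hB
  set D₀ : ℝ := 2 * (K + 1) / w * (K + 1 + k) ^ B with hD₀
  refine ⟨η, max 1 D₀, 2 + B, by positivity, le_max_left _ _, ?_⟩
  intro V _ _ G _ hV hG a b hab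
  set n : ℝ := (Fintype.card V : ℝ) with hn
  have hn0 : 0 < n := by rw [hn]; exact_mod_cast hV
  have hn1 : 1 ≤ n := by rw [hn]; exact_mod_cast hV
  -- Bounds the number of particles in a dense configuration, with room for the at most `k` products
  -- of one more reaction.
  set N : ℕ := ⌊K * n⌋₊ + k + 1 with hN
  have hNK : (N : ℝ) ≤ (K + 1 + k) * n := by
    have h1 := Nat.floor_le (by positivity : 0 ≤ K * n)
    have h2 : (k : ℝ) ≤ k * n := le_mul_of_one_le_right (by positivity) hn1
    push_cast [hN]
    nlinarith
  have hN1 : 1 ≤ N := by omega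
  have hN1' : (1 : ℝ) ≤ N := by exact_mod_cast hN1
  set L : ℝ := (N : ℝ) ^ k with hL
  have hL1 : 1 ≤ L := one_le_pow₀ hN1'
  set A : Set (Config ι V) := denseConfig e ε K a with hA
  set β : ℝ := 1 + η / n with hβ
  have hη0 : 0 < η := by positivity
  have hβ0 : 0 ≤ β := by positivity
  have hcard : ∀ ξ : Config ι V, energy e ξ ≤ K * n → Multiset.card ξ + k ≤ N := by
    intro ξ hξ
    have h1 : Multiset.card ξ ≤ ⌊K * n⌋₊ := Nat.le_floor ((card_le_energy he.one_le ξ).trans hξ)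
    omega
  set M : ℝ := √n * ((K + 1) * n) / (w / 2) with hM
  have hbound := fun N' ξ => R.sum_survival_sq_le (G := G) (A := A) hβ0 a b (e := e) (L := L)
    (τ := θ / n) (M := M) (w := w / 2) hL1 he.one_le (by positivity) (by positivity) (by positivity)
    (fun ξ hξ c u v hu Y hY => crowding_arrive_le R he hk hL1 le_rfl (hcard ξ hξ.2) hu hY)
    (fun ξ hξ => by
      obtain ⟨ρ, h1, h2⟩ := hcontr R hspeed V G hV hG a b (hidle b a hab) ξ hξ.1
        ((mass_le_energy he.one_le a ξ).trans hξ.2)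
      have hZ : R.speed b + (R.speedSum ξ).toReal ≤ (K + 1) * n := by
        have h3 := (R.speedSum_le_energy he.one_le ξ).trans hξ.2
        have h4 : (R.speed b : ℝ) ≤ 1 := by exact_mod_cast R.speed_le_one b
        change _ ≤ K * n at h3
        linarith
      refine ⟨ρ, h1, ?_, ?_⟩
      · set Z := R.speed b + (R.speedSum ξ).toReal with hZ'
        have h3 : β * (R.crowdingRate G a (θ / n) ξ + R.speed b * ρ) ≤ β * (Z - w) := by gcongr
        have h4 : η / n * Z ≤ w / 2 := by
          calc η / n * Z ≤ η / n * ((K + 1) * n) := by gcongr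
            _ = w / 2 := by rw [hη]; field_simp
        have h5 : 0 ≤ η / n * w := by positivity
        have h6 : β * (Z - w) = Z + η / n * Z - w - η / n * w := by rw [hβ]; ring
        have h7 : β * (R.crowdingRate G a (θ / n) ξ + R.speed b * ρ) =
          β * R.crowdingRate G a (θ / n) ξ + β * R.speed b * ρ := by ring
        linarith
      · rw [hM, div_mul_cancel₀ _ (by positivity)]
        gcongr) N' ξ
  refine ⟨fun i ξ => ⨆ N', R.survival G (ENNReal.ofReal β) A N' i ξ, ?_, ?_⟩
  · intro u ξ
    refine iSup_le fun N' => ?_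
    by_cases hξ : ξ ∈ A
    swap
    · simp [R.survival_eq_zero G hξ]
    obtain ⟨C, hC, hfC⟩ := R.survival_ne_top G (A := A) (ENNReal.ofReal_ne_top (r := β)) N'
    rw [← ENNReal.ofReal_toReal (ne_top_of_le_ne_top hC (hfC (b, u) ξ))]
    refine ENNReal.ofReal_le_ofReal ?_
    have h1 : (R.survival G (ENNReal.ofReal β) A N' (b, u) ξ).toReal ≤ M *
        crowding a e L ξ ^ (θ / n) := by
      refine le_trans ?_ (hbound N' ξ)
      refine Real.le_sqrt_of_sq_le ?_
      exact Finset.single_le_sum (f := fun u =>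
        (R.survival G (ENNReal.ofReal β) A N' (b, u) ξ).toReal ^ 2) (fun _ _ => sq_nonneg _)
        (Finset.mem_univ u)
    have h2 := crowding_rpow_le he.one_le a hθ.le (k := k) hV hN1 ξ hξ.2
      (by have := hcard ξ hξ.2; omega)
    have h3 : (N : ℝ) ^ ((k + 1) * K * θ) ≤ ((K + 1 + k) * n) ^ B := by
      calc (N : ℝ) ^ ((k + 1) * K * θ) ≤ (N : ℝ) ^ (B : ℝ) :=
            Real.rpow_le_rpow_of_exponent_le hN1' (Nat.le_ceil _)
        _ = (N : ℝ) ^ B := Real.rpow_natCast _ _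
        _ ≤ _ := by gcongr
    have h4 : √n ≤ n := by
      rw [Real.sqrt_le_left hn0.le]
      nlinarith
    have h5 : M ≤ 2 * (K + 1) / w * n ^ 2 := by
      calc M ≤ n * ((K + 1) * n) / (w / 2) := by rw [hM]; gcongr
        _ = _ := by field_simp
    calc _ ≤ M * crowding a e L ξ ^ (θ / n) := h1
      _ ≤ M * ((K + 1 + k) * n) ^ B := by
        have : 0 ≤ M := by positivity
        exact mul_le_mul_of_nonneg_left (h2.trans h3) this
      _ ≤ 2 * (K + 1) / w * n ^ 2 * ((K + 1 + k) * n) ^ B := by gcongr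
      _ = D₀ * n ^ (2 + B) := by rw [hD₀, mul_pow, pow_add]; ring
      _ ≤ max 1 D₀ * n ^ (2 + B) := by gcongr; exact le_max_right _ _
  · intro u ξ hξ
    exact R.one_add_mul_tagKernel_iSup_survival_le G hξ (b, u)

end ParticleSystem

/-! ### Reachable populations and drift -/

namespace Config

variable {ι V : Type*} [DecidableEq ι] [DecidableEq V]

@[simp] theorem types_cons (p : ι × V) (X : Config ι V) : types (p ::ₘ X) = p.1 ::ₘ X.types := by
  simp [types]

@[simp] theorem types_add (X Y : Config ι V) : types (X + Y) = X.types + Y.types := by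
  simp [types]

@[simp] theorem types_placed (S : Multiset ι) (v : V) : types (placed S v) = S := by
  simp [types, placed]

theorem cons_types_erase {X : Config ι V} {p : ι × V} (hp : p ∈ X) :
    p.1 ::ₘ types (X.erase p) = X.types := by
  rw [← types_cons, Multiset.cons_erase hp]

theorem mem_types {X : Config ι V} {a : ι} : a ∈ X.types ↔ ∃ v, (a, v) ∈ X := by
  simp [types]

end Config

namespace ParticleSystem

open Config

variable {ι : Type*} [Fintype ι] [DecidableEq ι] {R : ParticleSystem ι}

theorem EffectiveOutput.symm {a b : ι} {S : Multiset ι} (h : R.EffectiveOutput a b S) :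
    R.EffectiveOutput b a S := by
  refine ⟨R.react_symm a b ▸ h.1, ?_⟩
  rw [Multiset.pair_comm]
  exact h.2

theorem HasEffectiveReaction.symm {a b : ι} (h : R.HasEffectiveReaction a b) :
    R.HasEffectiveReaction b a := ⟨h.choose, h.choose_spec.symm⟩

theorem EffectiveOutput.meanFieldStep {a b : ι} {S : Multiset ι} (h : R.EffectiveOutput a b S)
    (rest : Multiset ι) : R.MeanFieldStep ({a, b} + rest) (S + rest) :=
  ⟨a, b, rest, S, h.1, rfl, rfl⟩

/-! ### Transitions of the process as mean-field reactions -/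

section Reachability

variable {V : Type*} [DecidableEq V]

theorem types_eq_of_mem_arrive {X Y : Config ι V} {p : ι × V} {v : V} (hp : p ∈ X)
    (h : Y ∈ (R.arrive (X.erase p) p.1 v).support) :
    Y.types = X.types ∨ ∃ a b rest S, R.EffectiveOutput a b S ∧ X.types = {a, b} + rest ∧
      Y.types = S + rest := by
  rcases R.mem_support_arrive h with rfl | ⟨b, S, hb, hS, rfl⟩
  · left
    rw [types_cons, cons_types_erase hp]
  · right
    refine ⟨p.1, b, types ((X.erase p).erase (b, v)), S, hS, ?_, by simp⟩
    rw [← cons_types_erase hp, ← cons_types_erase hb]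
    simp [Multiset.insert_eq_cons]

variable [Fintype V] {G : SimpleGraph V} [DecidableRel G.Adj]

theorem types_eq_of_mem_step {X Y : Config ι V} (h : Y ∈ (R.step G X).support) :
    Y.types = X.types ∨ ∃ a b rest S, R.EffectiveOutput a b S ∧ X.types = {a, b} + rest ∧
      Y.types = S + rest := by
  by_cases hX : X = 0
  · subst hX
    simp only [step, dif_pos, PMF.support_pure, Set.mem_singleton_iff] at h
    rw [h]; exact Or.inl rfl
  · obtain ⟨p, hp, v, hv⟩ := R.mem_support_step G hX h
    exact types_eq_of_mem_arrive hp hv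

theorem MeanFieldReachable.of_mem_step {m : Multiset ι} {X Y : Config ι V}
    (hX : R.MeanFieldReachable m X.types) (h : Y ∈ (R.step G X).support) :
    R.MeanFieldReachable m Y.types := by
  rcases types_eq_of_mem_step h with h | ⟨a, b, rest, S, hS, h1, h2⟩
  · rwa [h]
  · refine Relation.ReflTransGen.tail hX ?_
    rw [h1, h2]
    exact hS.meanFieldStep rest

end Reachability

theorem IsEnergy.sum_add_one_le {e : ι → ℝ} (he : R.IsEnergy e) {a b : ι} {S : Multiset ι}
    (h : R.EffectiveOutput a b S) (rest : Multiset ι) :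
    ((S + rest).map e).sum + 1 ≤ (({a, b} + rest : Multiset ι).map e).sum := by
  have := he.drop a b S h
  simp only [Multiset.map_add, Multiset.sum_add, Multiset.insert_eq_cons, Multiset.map_cons,
    Multiset.map_singleton, Multiset.sum_cons, Multiset.sum_singleton]
  linarith

theorem IsEnergy.sum_le_of_reachable {e : ι → ℝ} (he : R.IsEnergy e) {m m' : Multiset ι}
    (h : R.MeanFieldReachable m m') : (m'.map e).sum ≤ (m.map e).sum := by
  induction h with
  | refl => exact le_rfl
  | tail _ h ih =>
    obtain ⟨a, b, rest, S, hS, rfl, rfl⟩ := h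
    refine le_trans ?_ ih
    by_cases hab : S = {a, b}
    · rw [hab]
    · have := he.sum_add_one_le ⟨hS, hab⟩ rest
      linarith

/-! ### One-step drift and families of Lyapunov functions -/

section Drift

variable (R) {V : Type*} [Fintype V] [DecidableEq V] (G : SimpleGraph V) [DecidableRel G.Adj]

/-- The individual Lyapunov gains `g` add up, while the cost `c` of creation is paid once, since a
step contains at most one effective reaction. Both potentials below choose `F` so that the gains
cover the creation. -/
theorem mul_expect_step_potential_add_le (F : ι × V → Config ι V → ℝ≥0∞) (g : ι × V → ℝ≥0∞)
    {X : Config ι V} (hX : X ≠ 0) (β c : ℝ≥0∞)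
    (h1 : ∀ i ∈ X, g i + β * R.tagKernel G F i (X.erase i) ≤ F i (X.erase i))
    (h2 : ∀ p ∈ X, ∀ b v S, (b, v) ∈ X.erase p → R.EffectiveOutput p.1 b S →
      createdPotential F (X.erase p) v (some (b, S)) ≤ c) :
    β * (R.step G X).expect (potential F) + (X.map g).sum ≤ potential F X + β * c := by
  have h3 : (X.map fun i => g i + β * R.tagKernel G F i (X.erase i)).sum ≤ potential F X :=
    Multiset.sum_map_le_sum_map_of_mem _ _ _ h1
  rw [Multiset.sum_map_add, Multiset.sum_map_mul_left] at h3
  calc _ ≤ β * ((X.map fun i => R.tagKernel G F i (X.erase i)).sum + c) + (X.map g).sum := by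
        gcongr
        exact (R.expect_step_potential_le G F hX).trans
          (add_le_add le_rfl (R.created_le_of_le G F hX c h2))
    _ = ((X.map g).sum + β * (X.map fun i => R.tagKernel G F i (X.erase i)).sum) + β * c := by
        ring
    _ ≤ _ := by gcongr

theorem tagKernel_mul_left (c : ℝ≥0∞) (F : ι × V → Config ι V → ℝ≥0∞) (i : ι × V)
    (ξ : Config ι V) :
    R.tagKernel G (fun i ξ => c * F i ξ) i ξ = c * R.tagKernel G F i ξ := by
  have h : ∀ v, R.meetLaw i.1 (ξ.typesAt v) none * (c * F (i.1, v) ξ) =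
      c * (R.meetLaw i.1 (ξ.typesAt v) none * F (i.1, v) ξ) := fun v => by ring
  have h' : ∀ p : ι × V, ∀ x : ℝ≥0∞, (R.speed p.1 : ℝ≥0∞) * (c * x) = c * (R.speed p.1 * x) :=
    fun p x => by ring
  simp only [tagKernel, h, PMF.expect_mul_left, h', Multiset.sum_map_mul_left]
  ring

theorem tagKernel_finset_sum {κ : Type*} (s : Finset κ) (F : κ → ι × V → Config ι V → ℝ≥0∞)
    (i : ι × V) (ξ : Config ι V) :
    R.tagKernel G (fun i ξ => ∑ k ∈ s, F k i ξ) i ξ = ∑ k ∈ s, R.tagKernel G (F k) i ξ := by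
  simp only [tagKernel, Finset.mul_sum, PMF.expect_finset_sum]
  rw [← Finset.mul_sum]
  rw [Finset.sum_congr rfl fun k _ => mul_add _ _ _]
  simp only [Multiset.sum_map_eq_sum_count, Finset.mul_sum, Finset.sum_add_distrib, mul_add]
  congr 1
  rw [Finset.sum_comm]

/-- A family of functions satisfying Lyapunov inequalities, for pairs of types that react. -/
structure IsLyapunov (e : ι → ℝ) (ε K β P : ℝ)
    (U : ι → ι → ι × V → Config ι V → ℝ≥0∞) : Prop where
  le : ∀ a b u ξ, U a b (b, u) ξ ≤ ENNReal.ofReal P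
  one_add_le : ∀ a b, R.HasEffectiveReaction b a → ∀ u, ∀ ξ ∈ denseConfig e ε K a,
    1 + ENNReal.ofReal β * R.tagKernel G (U a b) (b, u) ξ ≤ U a b (b, u) ξ

open Classical in
/-- The types in `P` that react with `b`. -/
def partners (P : Set ι) (b : ι) : Finset ι :=
  Finset.univ.filter fun a => a ∈ P ∧ R.HasEffectiveReaction b a

theorem mem_partners {P : Set ι} {a b : ι} :
    a ∈ R.partners P b ↔ a ∈ P ∧ R.HasEffectiveReaction b a := by simp [partners]

variable {R G}

theorem IsLyapunov.sum_add_le {e : ι → ℝ} {ε K β P : ℝ} {U : ι → ι → ι × V → Config ι V → ℝ≥0∞}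
    (hU : R.IsLyapunov G e ε K β P U) {s : Finset ι} {b : ι} {u : V} {ξ : Config ι V}
    (hs : ∀ a ∈ s, R.HasEffectiveReaction b a ∧ ξ ∈ denseConfig e ε K a) :
    s.card + ENNReal.ofReal β * R.tagKernel G (fun i ξ => ∑ a ∈ s, U a b i ξ) (b, u) ξ ≤
      ∑ a ∈ s, U a b (b, u) ξ := by
  rw [tagKernel_finset_sum, Finset.mul_sum]
  calc _ = ∑ a ∈ s, (1 + ENNReal.ofReal β * R.tagKernel G (U a b) (b, u) ξ) := by
        rw [Finset.sum_add_distrib]; simp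
    _ ≤ _ := Finset.sum_le_sum fun a ha => hU.one_add_le a b (hs a ha).1 u ξ (hs a ha).2

theorem IsLyapunov.sum_le {e : ι → ℝ} {ε K β P : ℝ} {U : ι → ι → ι × V → Config ι V → ℝ≥0∞}
    (hU : R.IsLyapunov G e ε K β P U) (s : Finset ι) (b : ι) (u : V) (ξ : Config ι V) :
    ∑ a ∈ s, U a b (b, u) ξ ≤ Fintype.card ι * ENNReal.ofReal P := by
  calc _ ≤ ∑ a ∈ s, ENNReal.ofReal P := Finset.sum_le_sum fun a _ => hU.le a b u ξ
    _ = s.card * ENNReal.ofReal P := by simp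
    _ ≤ _ := by
      gcongr
      exact Finset.card_le_univ s

end Drift

universe u

theorem IsEnergy.exists_isLyapunov {e : ι → ℝ} (he : R.IsEnergy e) {γ ε K : ℝ} (hγ : 0 < γ)
    (hε : 0 < ε) (hK : 1 ≤ K) :
    ∃ η D : ℝ, ∃ A : ℕ, 0 < η ∧ 1 ≤ D ∧ ∀ (V : Type u) [Fintype V] [DecidableEq V]
      (G : SimpleGraph V) [DecidableRel G.Adj], 0 < Fintype.card V → HasWalkGap G γ →
      ∃ U, R.IsLyapunov G e ε K (1 + η / Fintype.card V) (D * (Fintype.card V : ℝ) ^ A) U := by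
  classical
  obtain ⟨η, D, A, hη, hD, h⟩ := IsEnergy.exists_lyapunov.{u} R he hγ hε hK
  refine ⟨η, D, A, hη, hD, fun V _ _ G _ hV hG => ?_⟩
  choose F hF using h V G hV hG
  refine ⟨fun a b => if hab : R.HasEffectiveReaction b a then F a b hab else fun _ _ => 0,
    fun a b u ξ => ?_, fun a b hab u ξ hξ => ?_⟩
  · by_cases hab : R.HasEffectiveReaction b a
    · simpa [hab] using (hF a b hab).1 u ξ
    · simp [hab]
  · simpa [hab] using (hF a b hab).2 u ξ hξ

end ParticleSystem

/-! ### Potential of the particles of ephemeral types -/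

/-- The rank counts the strict predecessors in the transitive closure. -/
theorem WellFounded.exists_rank {α : Type*} [Fintype α] {r : α → α → Prop} (h : WellFounded r) :
    ∃ f : α → ℕ, (∀ a, f a ≤ Fintype.card α) ∧ ∀ a b, r a b → f a < f b := by
  classical
  refine ⟨fun b => (Finset.univ.filter fun a => Relation.TransGen r a b).card,
    fun a => Finset.card_le_univ _, fun a b hab => Finset.card_lt_card ?_⟩
  refine Finset.ssubset_iff_of_subset (fun c hc => ?_) |>.2 ⟨a, ?_, ?_⟩
  · simp only [Finset.mem_filter, Finset.mem_univ, true_and] at hc ⊢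
    exact hc.tail hab
  · simpa using Relation.TransGen.single hab
  · simpa using h.transGen.irrefl.irrefl a

namespace ParticleSystem

open Config

universe u

variable {ι : Type*} [Fintype ι] [DecidableEq ι] {R : ParticleSystem ι}

/-- The type `b'` can be created, together with the destruction of a particle of type `b` that
occurs in one of the populations in `M`, in a reaction with a type in `P`. -/
def Begets (R : ParticleSystem ι) (M : Set (Multiset ι)) (P : Set ι) (b' b : ι) : Prop :=
  (∃ m ∈ M, b ∈ m) ∧ b ∉ P ∧ ∃ a ∈ P, ∃ S, R.EffectiveOutput a b S ∧ b' ∈ S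

/-- Types in `P` are present in every population in `M`, so a step from `b` to an offspring `b'` can
be performed as a reaction in an actual population containing `b`. The result is again in `M`,
contains `b'` and has at least one unit less energy. Descending chains are thus bounded by the
initial energy. -/
theorem IsEnergy.wellFounded_begets {e : ι → ℝ} (he : R.IsEnergy e) {M : Set (Multiset ι)}
    {P : Set ι} (hM : ∀ m ∈ M, ∀ m', R.MeanFieldReachable m m' → m' ∈ M)
    (hP : ∀ m ∈ M, ∀ a ∈ P, a ∈ m) : WellFounded (R.Begets M P) := by
  have key : ∀ N : ℕ, ∀ m ∈ M, (m.map e).sum ≤ N → ∀ b ∈ m, Acc (R.Begets M P) b := by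
    intro N
    induction N with
    | zero =>
      intro m _ h b hb
      have h1 := card_le_sum_energy he.one_le m
      have h2 : 0 < Multiset.card m := Multiset.card_pos_iff_exists_mem.2 ⟨b, hb⟩
      have h3 : (0 : ℝ) < Multiset.card m := by exact_mod_cast h2
      push_cast at h
      linarith
    | succ N ih =>
      intro m hm h b hb
      refine Acc.intro _ fun b' hb' => ?_
      obtain ⟨-, hbP, a, haP, S, hS, hb'S⟩ := hb'
      have ham := hP m hm a haP
      have hab : a ∈ m.erase b := (Multiset.mem_erase_of_ne (fun h : a = b => hbP (h ▸ haP))).2 ham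
      have hdec : m = {a, b} + (m.erase b).erase a := by
        conv_lhs => rw [← Multiset.cons_erase hb, ← Multiset.cons_erase hab]
        rw [Multiset.insert_eq_cons, Multiset.cons_add, Multiset.singleton_add, Multiset.cons_swap]
      have hstep := hS.meanFieldStep ((m.erase b).erase a)
      have hen := he.sum_add_one_le hS ((m.erase b).erase a)
      rw [← hdec] at hstep hen
      refine ih _ (hM m hm _ (Relation.ReflTransGen.single hstep)) ?_ b'
        (Multiset.mem_add.2 (Or.inl hb'S))
      push_cast at h
      linarith
  refine ⟨fun b => ?_⟩
  by_cases hb : ∃ m ∈ M, b ∈ m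
  · obtain ⟨m, hm, hb⟩ := hb
    obtain ⟨N, hN⟩ := exists_nat_ge (m.map e).sum
    exact key N m hm hN b hb
  · exact Acc.intro _ fun b' hb' => absurd hb'.1 hb

variable {V : Type u} [Fintype V] [DecidableEq V] {G : SimpleGraph V} [DecidableRel G.Adj]

open Classical in
/-- The weighted sum of the functions `U a b`, over the types `a` in `P` that react with the type
`b` of the tagged particle, if `b` is not in `P`. -/
def agentWeight (R : ParticleSystem ι) (P : Set ι) (W : ι → ℝ≥0∞)
    (U : ι → ι → ι × V → Config ι V → ℝ≥0∞) (i : ι × V) (ξ : Config ι V) : ℝ≥0∞ :=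
  if i.1 ∈ P then 0 else W i.1 * ∑ a ∈ R.partners P i.1, U a i.1 i ξ

open Classical in
/-- The sum of the weights of the particles whose types are not in `P`, multiplied by the numbers
of types in `P` they react with. -/
def agentCount (R : ParticleSystem ι) (P : Set ι) (W : ι → ℝ≥0∞) (i : ι × V) : ℝ≥0∞ :=
  if i.1 ∈ P then 0 else W i.1 * (R.partners P i.1).card

variable {P : Set ι} {W : ι → ℝ≥0∞} {U : ι → ι → ι × V → Config ι V → ℝ≥0∞} {e : ι → ℝ}
  {ε K β B : ℝ}

theorem agentWeight_le (hU : R.IsLyapunov G e ε K β B U) (i : ι × V) (ξ : Config ι V) :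
    R.agentWeight P W U i ξ ≤ W i.1 * (Fintype.card ι * ENNReal.ofReal B) := by
  unfold agentWeight
  split_ifs
  · exact zero_le
  · exact mul_le_mul' le_rfl (hU.sum_le _ _ _ _)

/-- The tagged type is not in `P`, so removing the tagged particle leaves the numbers of its
partners unchanged and the environment is still dense in them. -/
theorem agentCount_add_le (hU : R.IsLyapunov G e ε K β B U) {X : Config ι V}
    (hX : energy e X ≤ K * Fintype.card V) (he : ∀ a, 1 ≤ e a)
    (hP : ∀ a ∈ P, ε * Fintype.card V ≤ mass a X) (i : ι × V) (hi : i ∈ X) :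
    R.agentCount P W i + ENNReal.ofReal β * R.tagKernel G (R.agentWeight P W U) i (X.erase i) ≤
      R.agentWeight P W U i (X.erase i) := by
  obtain ⟨b, v⟩ := i
  by_cases hb : b ∈ P
  · have : R.tagKernel G (R.agentWeight P W U) (b, v) (X.erase (b, v)) ≤ 0 := by
      refine (R.tagKernel_mono G (F' := fun _ _ => 0) (fun w ξ => ?_) _).trans
        (R.tagKernel_le_const G (fun _ _ => le_rfl) _ _)
      simp [agentWeight, hb]
    simp [agentCount, agentWeight, hb, nonpos_iff_eq_zero.1 this]
  · have h1 : R.tagKernel G (R.agentWeight P W U) (b, v) (X.erase (b, v)) ≤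
        W b * R.tagKernel G (fun i ξ => ∑ a ∈ R.partners P b, U a b i ξ) (b, v)
          (X.erase (b, v)) := by
      rw [← R.tagKernel_mul_left]
      refine R.tagKernel_mono G (fun w ξ => ?_) _
      simp [agentWeight, hb]
    have h2 := hU.sum_add_le (s := R.partners P b) (b := b) (u := v) (ξ := X.erase (b, v))
      fun a ha => by
        rw [mem_partners] at ha
        refine ⟨ha.2, ?_, ?_⟩
        · have hab : ∀ w, (a, w) ≠ (b, v) := fun w h => hb (by
            rw [← (Prod.mk.inj h).1]; exact ha.1)
          have : mass a (X.erase (b, v)) = mass a X := by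
            unfold mass
            exact Finset.sum_congr rfl fun w _ => by rw [Multiset.count_erase_of_ne (hab w)]
          rw [this]
          exact hP a ha.1
        · have := energy_erase_add e hi
          have := he b
          simp only at *
          linarith
    calc _ ≤ W b * (R.partners P b).card + ENNReal.ofReal β * (W b *
          R.tagKernel G (fun i ξ => ∑ a ∈ R.partners P b, U a b i ξ) (b, v) (X.erase (b, v))) := by
          gcongr
          simp [agentCount, hb]
      _ = W b * ((R.partners P b).card + ENNReal.ofReal β *
          R.tagKernel G (fun i ξ => ∑ a ∈ R.partners P b, U a b i ξ) (b, v) (X.erase (b, v))) := by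
          ring
      _ ≤ W b * ∑ a ∈ R.partners P b, U a b (b, v) (X.erase (b, v)) := by gcongr
      _ = _ := by simp [agentWeight, hb]

theorem le_sum_agentCount {X : Config ι V} {a b : ι} (hb : b ∉ P) (hbX : b ∈ X.types) (ha : a ∈ P)
    (hab : R.HasEffectiveReaction b a) : W b ≤ (X.map (R.agentCount P W)).sum := by
  obtain ⟨v, hv⟩ := mem_types.1 hbX
  refine le_trans ?_ (Multiset.single_le_sum (fun _ _ => zero_le) _
    (Multiset.mem_map_of_mem (R.agentCount P W) hv))
  have h1 : 1 ≤ (R.partners P b).card := Finset.card_pos.2 ⟨a, R.mem_partners.2 ⟨ha, hab⟩⟩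
  have h2 : (1 : ℝ≥0∞) ≤ (R.partners P b).card := by exact_mod_cast h1
  simp only [agentCount, hb, if_false]
  exact le_mul_of_one_le_right' h2

/-- The expected potential decreases by a factor, if every effective reaction is between a type in
`P` and a type not in `P`, and the weights of the types decrease sufficiently. -/
theorem expect_step_agentWeight_le (hU : R.IsLyapunov G e ε K β B U) (he : R.IsEnergy e)
    {k : ℕ} (hk : ∀ a b S, R.EffectiveOutput a b S → Multiset.card S ≤ k)
    {M : Set (Multiset ι)} {X : Config ι V} (hXM : X.types ∈ M)
    (hX : energy e X ≤ K * Fintype.card V) (hP : ∀ a ∈ P, ε * Fintype.card V ≤ mass a X)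
    (hPP : ∀ a b, R.HasEffectiveReaction a b → (a ∈ P ↔ b ∉ P)) (hβ : 0 < β)
    (hWtop : ∀ b, W b ≠ ∞)
    (hW : ∀ b' b, R.Begets M P b' b →
      ENNReal.ofReal β * (k * (W b' * (Fintype.card ι * ENNReal.ofReal B))) ≤ W b) :
    (R.step G X).expect (potential (R.agentWeight P W U)) ≤
      (ENNReal.ofReal β)⁻¹ * potential (R.agentWeight P W U) X := by
  have hβ0 : ENNReal.ofReal β ≠ 0 := by simpa using hβ
  by_cases hX0 : X = 0
  · subst hX0
    simp [step, PMF.expect_pure, potential]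
  set c := (ENNReal.ofReal β)⁻¹ * (X.map (R.agentCount P W)).sum with hc
  have hβc : ENNReal.ofReal β * c = (X.map (R.agentCount P W)).sum := by
    rw [hc, ← mul_assoc, ENNReal.mul_inv_cancel hβ0 ENNReal.ofReal_ne_top, one_mul]
  have hcount : (X.map (R.agentCount P W)).sum ≠ ∞ := by
    rw [Multiset.sum_map_eq_sum_count]
    refine ENNReal.sum_ne_top.2 fun i _ => ENNReal.mul_ne_top (ENNReal.natCast_ne_top _) ?_
    unfold agentCount
    split_ifs
    · simp
    · exact ENNReal.mul_ne_top (hWtop _) (ENNReal.natCast_ne_top _)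
  -- Since a particle of type `b` is present and has a partner, the gains are at least `W b`. By
  -- `hW` this covers up to `k` offspring of smaller weight, whatever their environments.
  have hcreated : ∀ a b, a ∈ P → b ∉ P → b ∈ X.types → ∀ S, R.EffectiveOutput a b S →
      ∀ (v : V) (ζ : ι × V → Config ι V), ((Config.placed S v).map fun i => R.agentWeight P W U i (ζ i)).sum ≤ c := by
    intro a b ha hb hbX S hS v ζ
    rw [hc, ← ENNReal.mul_le_iff_le_inv hβ0 ENNReal.ofReal_ne_top]
    refine le_trans ?_ (le_sum_agentCount hb hbX ha ⟨S, hS.symm⟩)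
    by_cases hS0 : S = 0
    · subst hS0; simp [Config.placed]
    have h1 : ∀ c ∈ S, ENNReal.ofReal β * (k * R.agentWeight P W U (c, v) (ζ (c, v))) ≤ W b :=
      fun c hcS => le_trans (by gcongr; exact agentWeight_le hU (c, v) _)
        (hW c b ⟨⟨_, hXM, hbX⟩, hb, a, ha, S, hS, hcS⟩)
    have h2 : (Multiset.card S : ℝ≥0∞) * (ENNReal.ofReal β *
        ((Config.placed S v).map fun i => R.agentWeight P W U i (ζ i)).sum) ≤
        (Multiset.card S : ℝ≥0∞) * W b := by
      calc _ ≤ (k : ℝ≥0∞) * (ENNReal.ofReal β *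
            ((Config.placed S v).map fun i => R.agentWeight P W U i (ζ i)).sum) := by
            gcongr
            exact hk _ _ _ hS
        _ = (S.map fun c => ENNReal.ofReal β *
            (k * R.agentWeight P W U (c, v) (ζ (c, v)))).sum := by
            rw [Multiset.sum_map_mul_left, Multiset.sum_map_mul_left, Config.placed,
              Multiset.map_map]
            simp only [Function.comp_def]
            ring
        _ ≤ (S.map fun _ => W b).sum := Multiset.sum_map_le_sum_map_of_mem _ _ _ h1
        _ = _ := by simp
    have h3 : (Multiset.card S : ℝ≥0∞) ≠ 0 := by simpa using hS0
    exact (ENNReal.mul_le_mul_iff_right h3 (ENNReal.natCast_ne_top _)).1 h2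
  have h := R.mul_expect_step_potential_add_le G (R.agentWeight P W U) (R.agentCount P W) hX0
    (ENNReal.ofReal β) c (fun i hi => agentCount_add_le hU hX he.one_le hP i hi)
    fun p hp b v S hb hS => by
      have hp' : p.1 ∈ X.types := mem_types.2 ⟨p.2, hp⟩
      have hb' : b ∈ X.types := mem_types.2 ⟨v, Multiset.mem_of_mem_erase hb⟩
      by_cases hpP : p.1 ∈ P
      · exact hcreated p.1 b hpP ((hPP _ _ ⟨S, hS⟩).1 hpP) hb' S hS v _
      · have : b ∈ P := by
          by_contra h
          exact hpP ((hPP _ _ ⟨S, hS⟩).2 h)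
        exact hcreated b p.1 this hpP hp' S hS.symm v _
  rw [hβc] at h
  rw [← ENNReal.mul_le_iff_le_inv hβ0 ENNReal.ofReal_ne_top]
  exact (ENNReal.add_le_add_iff_right hcount).1 h

end ParticleSystem

/-! ### Geometric tails -/

namespace ParticleSystem

open Config

universe u

variable {ι : Type*} [Fintype ι] [DecidableEq ι] {R : ParticleSystem ι}

theorem energy_le_card {V : Type*} (e : ι → ℝ) (X : Config ι V) :
    energy e X ≤ (∑ c, |e c|) * Multiset.card X := by
  induction X using Multiset.induction_on with
  | empty => simp [energy]
  | cons p X ih =>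
    have : e p.1 ≤ ∑ c, |e c| := (le_abs_self _).trans
      (Finset.single_le_sum (f := fun c => |e c|) (fun _ _ => abs_nonneg _) (Finset.mem_univ p.1))
    rw [energy_cons, Multiset.card_cons]
    push_cast
    linarith

/-- There are finitely many types, so the smallest of their densities works for all persistent ones.
-/
theorem Persistent.exists_uniform {J : Type*} (n : J → ℕ) (m : J → Multiset ι) :
    ∃ ε : ℝ, 0 < ε ∧ ∀ a, R.Persistent n m a → ∀ j m', R.MeanFieldReachable (m j) m' →
      ε * (n j : ℝ) ≤ (m'.count a : ℝ) := by
  classical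
  have h : ∀ a, ∃ ε : ℝ, 0 < ε ∧ (R.Persistent n m a → ∀ j m', R.MeanFieldReachable (m j) m' →
      ε * (n j : ℝ) ≤ (m'.count a : ℝ)) := by
    intro a
    by_cases ha : R.Persistent n m a
    · obtain ⟨ε, hε, h⟩ := ha
      exact ⟨ε, hε, fun _ => h⟩
    · exact ⟨1, one_pos, fun h => absurd h ha⟩
  choose δ hδ h using h
  obtain ⟨ε, hε, hεδ⟩ := exists_pos_le δ hδ
  exact ⟨ε, hε, fun a ha j m' hm' =>
    (mul_le_mul_of_nonneg_right (hεδ a) (Nat.cast_nonneg _)).trans (h a ha j m' hm')⟩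

/-! ### Reactions between one persistent and one ephemeral type -/

section NoPersistentPair

/-- If no two persistent types react, the probability not to be in equilibrium decreases
geometrically, after a polynomial factor. -/
theorem IsEnergy.law_le_of_no_persistent_pair {e : ι → ℝ} (he : R.IsEnergy e)
    {J : Type*} {V : J → Type u} [∀ j, Fintype (V j)] [∀ j, DecidableEq (V j)]
    (G : ∀ j, SimpleGraph (V j)) [∀ j, DecidableRel (G j).Adj] {γ : ℝ} (hγ : 0 < γ)
    (hV : ∀ j, 0 < Fintype.card (V j)) (hG : ∀ j, HasWalkGap (G j) γ)
    (X₀ : ∀ j, Config ι (V j)) (hX₀ : ∀ j, (X₀ j).card ≤ Fintype.card (V j))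
    (hA : R.Agential (fun j => Fintype.card (V j)) (fun j => (X₀ j).types))
    (hPP : ∀ a b, R.Persistent (fun j => Fintype.card (V j)) (fun j => (X₀ j).types) a →
      R.Persistent (fun j => Fintype.card (V j)) (fun j => (X₀ j).types) b →
      ¬ R.HasEffectiveReaction a b) :
    ∃ η D : ℝ, ∃ A : ℕ, 0 < η ∧ 1 ≤ D ∧ ∀ j t,
      R.law (G j) (X₀ j) {ω | ¬ R.IsEquilibrium (ω t)} ≤
        ((ENNReal.ofReal (1 + η / Fintype.card (V j)))⁻¹) ^ t *
          ENNReal.ofReal (D * (Fintype.card (V j) : ℝ) ^ A) := by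
  obtain ⟨ε, hε, hpers⟩ := Persistent.exists_uniform (R := R) (fun j => Fintype.card (V j))
    (fun j => (X₀ j).types)
  set P : Set ι := {a | R.Persistent (fun j => Fintype.card (V j)) (fun j => (X₀ j).types) a}
    with hP
  set K : ℝ := 1 + ∑ c, |e c| with hK
  have hsum0 : 0 ≤ ∑ c, |e c| := Finset.sum_nonneg fun _ _ => abs_nonneg _
  have hK1 : 1 ≤ K := by linarith
  obtain ⟨k, hk⟩ := he.exists_card_le
  obtain ⟨η, D, A, hη, hD, hlyap⟩ := IsEnergy.exists_isLyapunov.{u} he hγ hε hK1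
  set M : Set (Multiset ι) := {m | ∃ j, R.MeanFieldReachable (X₀ j).types m} with hM
  have hwf : WellFounded (R.Begets M P) := he.wellFounded_begets
    (fun m ⟨j, hj⟩ m' h => ⟨j, hj.trans h⟩) (fun m ⟨j, hj⟩ a ha => by
      have h1 := hpers a ha j m hj
      have h2 : (0 : ℝ) < Fintype.card (V j) := by exact_mod_cast hV j
      have h3 : (0 : ℝ) < m.count a := lt_of_lt_of_le (by positivity) h1
      exact Multiset.count_pos.1 (by exact_mod_cast h3))
  obtain ⟨rank, hrank, hlt⟩ := hwf.exists_rank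
  set q := Fintype.card ι with hq
  set D' : ℝ := (1 + η) * ((k + 1) * ((q + 1) * D)) with hD'
  have hD'1 : 1 ≤ D' := by
    have h1 : (1 : ℝ) ≤ 1 + η := by linarith
    have h2 : (1 : ℝ) ≤ k + 1 := by have := Nat.cast_nonneg (α := ℝ) k; linarith
    have h3 : (1 : ℝ) ≤ q + 1 := by have := Nat.cast_nonneg (α := ℝ) q; linarith
    exact one_le_mul_of_one_le_of_one_le h1 (one_le_mul_of_one_le_of_one_le h2
      (one_le_mul_of_one_le_of_one_le h3 hD))
  -- With Q = D' n^A, a particle contributes at most Q^q through its weight and one more factor Q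
  -- through its Lyapunov functions; there are initially at most n particles.
  refine ⟨η, D' ^ (q + 1), A * (q + 1) + 1, hη, one_le_pow₀ hD'1, fun j t => ?_⟩
  set n : ℝ := (Fintype.card (V j) : ℝ) with hn
  have hn1 : 1 ≤ n := by rw [hn]; exact_mod_cast hV j
  obtain ⟨U, hU⟩ := hlyap (V j) (G j) (hV j) (hG j)
  set B : ℝ := D * n ^ A with hB
  have hB0 : 0 ≤ B := by positivity
  set Q : ℝ := D' * n ^ A with hQ
  have hQ1 : 1 ≤ Q := one_le_mul_of_one_le_of_one_le hD'1 (one_le_pow₀ hn1)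
  set β : ℝ := 1 + η / n with hβ
  have hβ0 : 0 < β := by positivity
  have hβ1 : β ≤ 1 + η := by
    have : η / n ≤ η := div_le_self hη.le hn1
    linarith
  have hQ' : β * (k * (q * B)) ≤ Q := by
    calc β * (k * (q * B)) ≤ (1 + η) * ((k + 1) * ((q + 1) * B)) := by
          gcongr <;> linarith
      _ = Q := by rw [hQ, hD', hB]; ring
  have hqB : q * B ≤ Q := by
    calc q * B ≤ (1 + η) * ((k + 1) * ((q + 1) * B)) := by
          have h1 : (1 : ℝ) ≤ (1 + η) * (k + 1) := by
            have := Nat.cast_nonneg (α := ℝ) k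
            nlinarith
          have h2 : q * B ≤ (q + 1) * B := by gcongr; linarith
          calc q * B ≤ 1 * ((q + 1) * B) := by linarith
            _ ≤ (1 + η) * (k + 1) * ((q + 1) * B) := by gcongr
            _ = _ := by ring
      _ = Q := by rw [hQ, hD', hB]; ring
  -- An offspring has smaller rank, so its weight is smaller by a factor Q at least; Q dominates the
  -- discount, the number of offspring and the bound on the Lyapunov functions.
  set W : ι → ℝ≥0∞ := fun b => ENNReal.ofReal (Q ^ rank b) with hW
  have hWle : ∀ b, W b ≤ ENNReal.ofReal (Q ^ q) := fun b =>
    ENNReal.ofReal_le_ofReal (pow_le_pow_right₀ hQ1 (hrank b))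
  have hW1 : ∀ b, 1 ≤ W b := fun b => by
    rw [hW, ← ENNReal.ofReal_one]
    exact ENNReal.ofReal_le_ofReal (one_le_pow₀ hQ1)
  set I : Set (Config ι (V j)) := {X | R.MeanFieldReachable (X₀ j).types X.types} with hI
  have hIen : ∀ X ∈ I, energy e X ≤ K * n := by
    intro X hX
    have h1 := he.sum_le_of_reachable hX
    rw [← energy_eq_types, ← energy_eq_types] at h1
    have h2 := energy_le_card e (X₀ j)
    have h3 : ((X₀ j).card : ℝ) ≤ n := by rw [hn]; exact_mod_cast hX₀ j
    have h4 : (∑ c, |e c|) * ((X₀ j).card : ℝ) ≤ (∑ c, |e c|) * n := by gcongr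
    rw [hK]
    linarith
  have hIP : ∀ X ∈ I, ∀ a ∈ P, ε * n ≤ mass a X := by
    intro X hX a ha
    rw [mass_eq_count_types]
    exact hpers a ha j _ hX
  have hPP' : ∀ a b, R.HasEffectiveReaction a b → (a ∈ P ↔ b ∉ P) := by
    intro a b hab
    refine ⟨fun ha hb => hPP a b ha hb hab, fun hb => ?_⟩
    by_contra ha
    exact hA a b ha hb hab
  have hmain := markovChainLaw_le_of_drift (R.step (G j)) (X₀ j)
    (potential (R.agentWeight P W U)) (ENNReal.ofReal β)⁻¹ (by simp) I
    (Relation.ReflTransGen.refl) (fun X hX Y hY => MeanFieldReachable.of_mem_step hX hY)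
    (fun X hX => expect_step_agentWeight_le hU he hk (M := M) ⟨j, hX⟩ (hIen X hX) (hIP X hX) hPP'
      hβ0 (fun b => ENNReal.ofReal_ne_top) fun b' b hbb' => by
        rw [hW, ← ENNReal.ofReal_natCast k, ← ENNReal.ofReal_natCast (Fintype.card ι),
          ← ENNReal.ofReal_mul (by positivity), ← ENNReal.ofReal_mul (by positivity),
          ← ENNReal.ofReal_mul (by positivity), ← ENNReal.ofReal_mul (by positivity)]
        refine ENNReal.ofReal_le_ofReal ?_
        calc β * (k * (Q ^ rank b' * (q * B))) = Q ^ rank b' * (β * (k * (q * B))) := by ring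
          _ ≤ Q ^ rank b' * Q := by gcongr
          _ = Q ^ (rank b' + 1) := (pow_succ _ _).symm
          _ ≤ Q ^ rank b := pow_le_pow_right₀ hQ1 (hlt b' b hbb'))
    {X | ¬ R.IsEquilibrium X} (fun X hX hne => by
      have h1 : (X.map (R.agentCount P W)).sum ≤ potential (R.agentWeight P W U) X :=
        Multiset.sum_map_le_sum_map_of_mem _ _ _ fun i hi => le_self_add.trans
          (agentCount_add_le (W := W) hU (hIen X hX) he.one_le (hIP X hX) i hi)
      refine le_trans ?_ h1
      simp only [Set.mem_ofPred_eq, IsEquilibrium, not_forall, not_not] at hne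
      obtain ⟨a, b, hab, hr⟩ := hne
      have haX : a ∈ X.types := Multiset.mem_of_le hab (by simp)
      have hbX : b ∈ X.types := Multiset.mem_of_le hab (by simp)
      by_cases ha : a ∈ P
      · exact (hW1 b).trans (le_sum_agentCount ((hPP' _ _ hr).1 ha) hbX ha hr.symm)
      · have hb : b ∈ P := by
          by_contra hb
          exact ha ((hPP' _ _ hr).2 hb)
        exact (hW1 a).trans (le_sum_agentCount ha haX hb hr)) t
  refine hmain.trans (mul_le_mul' le_rfl ?_)
  have hcard : ((X₀ j).card : ℝ≥0∞) ≤ ENNReal.ofReal n := by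
    rw [hn, ENNReal.ofReal_natCast]
    exact_mod_cast hX₀ j
  calc potential (R.agentWeight P W U) (X₀ j)
      ≤ ((X₀ j).map fun _ => ENNReal.ofReal (Q ^ q) * ENNReal.ofReal Q).sum := by
        refine Multiset.sum_map_le_sum_map _ _ fun i _ => (agentWeight_le hU i _).trans
          (mul_le_mul' (hWle _) ?_)
        rw [← ENNReal.ofReal_natCast (Fintype.card ι), ← ENNReal.ofReal_mul (Nat.cast_nonneg _)]
        exact ENNReal.ofReal_le_ofReal hqB
    _ = (X₀ j).card * (ENNReal.ofReal (Q ^ q) * ENNReal.ofReal Q) := by simp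
    _ ≤ ENNReal.ofReal n * (ENNReal.ofReal (Q ^ q) * ENNReal.ofReal Q) := by gcongr
    _ = ENNReal.ofReal (n * (Q ^ q * Q)) := by
      rw [← ENNReal.ofReal_mul (by positivity), ← ENNReal.ofReal_mul (by positivity)]
    _ = _ := by
      congr 1
      rw [← pow_succ, hQ, mul_pow, ← pow_mul]
      ring

end NoPersistentPair

/-! ### Families of bounded size -/

section PersistentPair

/-- With at least two particles of each type always present, `a` and `b` could react forever, each
time losing a unit of energy. Two are required, rather than one, to allow for `a = b`. -/
theorem IsEnergy.card_lt_of_reactive {e : ι → ℝ} (he : R.IsEnergy e) {m₀ : Multiset ι} {a b : ι}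
    (hab : R.HasEffectiveReaction a b) {x : ℝ}
    (ha : ∀ m, R.MeanFieldReachable m₀ m → x ≤ m.count a)
    (hb : ∀ m, R.MeanFieldReachable m₀ m → x ≤ m.count b) : x < 2 := by
  by_contra! hx
  have key : ∀ N : ℕ, ∀ m, R.MeanFieldReachable m₀ m → ¬ (m.map e).sum ≤ N := by
    have h2 : ∀ m, R.MeanFieldReachable m₀ m → 2 ≤ m.count a ∧ 2 ≤ m.count b := by
      intro m hm
      have h1 := hx.trans (ha m hm)
      have h2 := hx.trans (hb m hm)
      exact ⟨by exact_mod_cast h1, by exact_mod_cast h2⟩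
    intro N
    induction N with
    | zero =>
      intro m hm h
      have h1 := card_le_sum_energy he.one_le m
      have h3 : 2 ≤ Multiset.card m := (h2 m hm).1.trans (Multiset.count_le_card _ _)
      have h4 : (2 : ℝ) ≤ Multiset.card m := by exact_mod_cast h3
      push_cast at h
      linarith
    | succ N ih =>
      intro m hm h
      obtain ⟨S, hS⟩ := hab
      have hle : ({a, b} : Multiset ι) ≤ m := by
        rw [Multiset.le_iff_count]
        intro c
        have h3 := h2 m hm
        rw [Multiset.insert_eq_cons, Multiset.count_cons, Multiset.count_singleton]
        split_ifs <;> subst_vars <;> omega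
      obtain ⟨rest, rfl⟩ := Multiset.le_iff_exists_add.1 hle
      have h3 := he.sum_add_one_le hS rest
      refine ih _ (Relation.ReflTransGen.tail hm (hS.meanFieldStep rest)) ?_
      push_cast at h
      linarith
  obtain ⟨N, hN⟩ := exists_nat_ge (m₀.map e).sum
  exact key N m₀ Relation.ReflTransGen.refl hN

variable {V : Type u} [Fintype V] [DecidableEq V] {G : SimpleGraph V} [DecidableRel G.Adj]

/-- The types in the population `m` that react with a given particle of type `b` in it. -/
def presentPartners (R : ParticleSystem ι) (m : Multiset ι) (b : ι) : Finset ι :=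
  (R.partners Set.univ b).filter (· ∈ m.erase b)

/-- The sum of the functions `U a b`, over the types `a` in the population `m` that react with the
tagged particle, while the population is `m`. -/
def frozenWeight (R : ParticleSystem ι) (m : Multiset ι)
    (U : ι → ι → ι × V → Config ι V → ℝ≥0∞) (i : ι × V) (ξ : Config ι V) : ℝ≥0∞ :=
  if i.1 ::ₘ ξ.types = m then ∑ a ∈ R.presentPartners m i.1, U a i.1 i ξ else 0

variable {U : ι → ι → ι × V → Config ι V → ℝ≥0∞} {e : ι → ℝ} {ε K β B : ℝ}

theorem potential_frozenWeight_le (hU : R.IsLyapunov G e ε K β B U) (m : Multiset ι)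
    (X : Config ι V) : potential (R.frozenWeight m U) X ≤
      Multiset.card X * (Fintype.card ι * ENNReal.ofReal B) := by
  calc _ ≤ (X.map fun _ => (Fintype.card ι * ENNReal.ofReal B : ℝ≥0∞)).sum := by
        refine Multiset.sum_map_le_sum_map _ _ fun i _ => ?_
        unfold frozenWeight
        split_ifs
        · exact hU.sum_le _ _ _ _
        · exact zero_le
    _ = _ := by simp

/-- When ε n ≤ 1, a single particle already counts as dense, so every partner present can be used.
An effective reaction lowers the energy and so changes the population, which sets the weights of the
created particles to 0. -/
theorem expect_step_frozenWeight_add_le (hU : R.IsLyapunov G e ε K β B U) (he : R.IsEnergy e)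
    (hε : ε * Fintype.card V ≤ 1) {X : Config ι V} (hX0 : X ≠ 0)
    (hX : energy e X ≤ K * Fintype.card V) :
    ENNReal.ofReal β * (R.step G X).expect (potential (R.frozenWeight X.types U)) +
      (X.map fun i => ((R.presentPartners X.types i.1).card : ℝ≥0∞)).sum ≤
      potential (R.frozenWeight X.types U) X := by
  have h := R.mul_expect_step_potential_add_le G (R.frozenWeight X.types U)
    (fun i => ((R.presentPartners X.types i.1).card : ℝ≥0∞)) hX0 (ENNReal.ofReal β) 0
    (fun i hi => by
      obtain ⟨b, v⟩ := i
      have h1 : R.frozenWeight X.types U (b, v) (X.erase (b, v)) =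
          ∑ a ∈ R.presentPartners X.types b, U a b (b, v) (X.erase (b, v)) := by
        rw [frozenWeight, if_pos (cons_types_erase hi)]
      rw [h1]
      refine le_trans ?_ (hU.sum_add_le fun a ha => ?_)
      · gcongr
        refine R.tagKernel_mono G (fun w ξ => ?_) _
        unfold frozenWeight
        split_ifs
        · exact le_rfl
        · exact zero_le
      · rw [presentPartners, Finset.mem_filter, mem_partners] at ha
        refine ⟨ha.1.2, ?_, ?_⟩
        · have h2 : types (X.erase (b, v)) = X.types.erase b := by
            rw [← cons_types_erase hi, Multiset.erase_cons_head]
          rw [mass_eq_count_types, h2]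
          have h3 := Multiset.count_pos.2 ha.2
          have h4 : (1 : ℝ) ≤ (X.types.erase b).count a := by exact_mod_cast h3
          linarith
        · have := energy_erase_add e hi
          have := he.one_le b
          simp only at *
          linarith)
    (fun p hp b v S hb hS => by
      have hne : Config.types (Config.placed S v + (X.erase p).erase (b, v)) ≠ X.types := by
        intro h
        have h1 := congrArg (fun m => (Multiset.map e m).sum) h
        have h2 := he.drop _ _ _ hS
        simp only [← energy_eq_types] at h1
        have h3 := energy_erase_add e hp
        have h4 := energy_erase_add e hb
        rw [energy_add, energy_placed] at h1
        simp only at *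
        linarith
      unfold createdPotential
      refine le_of_eq (Multiset.sum_eq_zero fun x hx => ?_)
      obtain ⟨i, hi, rfl⟩ := Multiset.mem_map.1 hx
      rw [frozenWeight, if_neg]
      rw [cons_types_erase (Multiset.mem_add.2 (Or.inl hi))]
      exact hne)
  simpa using h

theorem one_le_sum_presentPartners {X : Config ι V} (hX : ¬ R.IsEquilibrium X) :
    1 ≤ (X.map fun i => ((R.presentPartners X.types i.1).card : ℝ≥0∞)).sum := by
  simp only [IsEquilibrium, not_forall, not_not] at hX
  obtain ⟨a, b, hab, hr⟩ := hX
  have ha : a ∈ X.types := Multiset.mem_of_le hab (by simp)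
  obtain ⟨v, hv⟩ := mem_types.1 ha
  have h1 : b ∈ X.types.erase a := by
    refine Multiset.mem_of_le (Multiset.erase_le_erase a hab) ?_
    rw [Multiset.insert_eq_cons, Multiset.erase_cons_head]
    exact Multiset.mem_singleton_self b
  have h2 : 1 ≤ (R.presentPartners X.types a).card := by
    refine Finset.card_pos.2 ⟨b, ?_⟩
    rw [presentPartners, Finset.mem_filter, mem_partners]
    exact ⟨⟨trivial, hr⟩, h1⟩
  have h3 : (1 : ℝ≥0∞) ≤ (R.presentPartners X.types a).card := by exact_mod_cast h2
  rw [← Multiset.cons_erase hv, Multiset.map_cons, Multiset.sum_cons, Multiset.cons_erase hv]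
  exact h3.trans le_self_add

/-- The potential of the frozen population, multiplied by a quantity that decreases with the
energy. -/
def frozenPotential (R : ParticleSystem ι) (e : ι → ℝ) (T : ℝ)
    (U : ι → ι → ι × V → Config ι V → ℝ≥0∞) (X : Config ι V) : ℝ≥0∞ :=
  ENNReal.ofReal (T ^ energy e X) * potential (R.frozenWeight X.types U) X

theorem one_le_frozenPotential (hU : R.IsLyapunov G e ε K β B U) (he : R.IsEnergy e)
    (hε : ε * Fintype.card V ≤ 1) {X : Config ι V} (hX : energy e X ≤ K * Fintype.card V) {T : ℝ}
    (hT : 1 ≤ T) (hne : ¬ R.IsEquilibrium X) : 1 ≤ R.frozenPotential e T U X := by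
  have hX0 : X ≠ 0 := by
    rintro rfl
    exact hne fun a b hab => by simp [types] at hab
  have h1 : 0 ≤ energy e X := (Nat.cast_nonneg _).trans (card_le_energy he.one_le X)
  have h2 : (1 : ℝ≥0∞) ≤ ENNReal.ofReal (T ^ energy e X) := by
    rw [← ENNReal.ofReal_one]
    exact ENNReal.ofReal_le_ofReal (Real.one_le_rpow hT h1)
  have h3 := (one_le_sum_presentPartners hne).trans
    (le_add_self.trans (expect_step_frozenWeight_add_le hU he hε hX0 hX))
  exact one_le_mul h2 h3

/-- While the population is unchanged the frozen potential contracts. A reaction starts a new one,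
of size at most `Q`, with a prefactor smaller by T ≥ βQ; off equilibrium the gain T^E covers this.
-/
theorem expect_step_frozenPotential_le (hU : R.IsLyapunov G e ε K β B U) (he : R.IsEnergy e)
    (hε : ε * Fintype.card V ≤ 1) {X : Config ι V} (hX : energy e X ≤ K * Fintype.card V) {T : ℝ}
    (hT : 1 ≤ T) (hβ : 0 < β)
    (hTβ : β * (K * Fintype.card V * (Fintype.card ι * B)) ≤ T) :
    (R.step G X).expect (R.frozenPotential e T U) ≤
      (ENNReal.ofReal β)⁻¹ * R.frozenPotential e T U X := by
  classical
  have hβ0 : ENNReal.ofReal β ≠ 0 := by simpa using hβ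
  by_cases hX0 : X = 0
  · subst hX0
    simp [step, PMF.expect_pure, frozenPotential, potential]
  have hT0 : 0 < T := by linarith
  set E := energy e X with hE
  set Q : ℝ := K * Fintype.card V * (Fintype.card ι * B) with hQ
  -- The price of restarting after a reaction. It vanishes at equilibrium, where no reaction can
  -- occur and no gain is available.
  set q : ℝ≥0∞ := if R.IsEquilibrium X then 0 else ENNReal.ofReal (T ^ (E - 1) * Q) with hq
  have h1 : ∀ Y ∈ (R.step G X).support, R.frozenPotential e T U Y ≤
      ENNReal.ofReal (T ^ E) * potential (R.frozenWeight X.types U) Y + q := by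
    intro Y hY
    rcases types_eq_of_mem_step hY with h | ⟨a, b, rest, S, hS, h2, h3⟩
    · rw [frozenPotential, h, energy_eq_types, h, ← energy_eq_types]
      exact le_self_add
    · refine le_trans ?_ le_add_self
      have h4 : ¬ R.IsEquilibrium X := fun h => h a b (by rw [h2]; exact Multiset.le_add_right _ _)
        ⟨S, hS⟩
      rw [hq, if_neg h4]
      have h5 := he.sum_add_one_le hS rest
      rw [← h2, ← h3, ← energy_eq_types, ← energy_eq_types] at h5
      have h6 : ENNReal.ofReal (T ^ energy e Y) ≤ ENNReal.ofReal (T ^ (E - 1)) :=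
        ENNReal.ofReal_le_ofReal (Real.rpow_le_rpow_of_exponent_le hT (by linarith))
      have h7 : (Multiset.card Y : ℝ≥0∞) ≤ ENNReal.ofReal (K * Fintype.card V) := by
        rw [← ENNReal.ofReal_natCast]
        refine ENNReal.ofReal_le_ofReal ?_
        have := card_le_energy he.one_le Y
        linarith
      have h8 : 0 ≤ K * Fintype.card V := by
        have := card_le_energy he.one_le X
        have := Nat.cast_nonneg (α := ℝ) (Multiset.card X)
        linarith
      calc R.frozenPotential e T U Y
          ≤ ENNReal.ofReal (T ^ (E - 1)) * (ENNReal.ofReal (K * Fintype.card V) *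
            (Fintype.card ι * ENNReal.ofReal B)) :=
            mul_le_mul' h6 ((potential_frozenWeight_le hU _ Y).trans (mul_le_mul' h7 le_rfl))
        _ = _ := by
          rw [← ENNReal.ofReal_natCast (Fintype.card ι), ← ENNReal.ofReal_mul (Nat.cast_nonneg _),
            ← ENNReal.ofReal_mul h8, ← ENNReal.ofReal_mul (by positivity)]
  have h2 : ENNReal.ofReal β * q ≤ ENNReal.ofReal (T ^ E) *
      (X.map fun i => ((R.presentPartners X.types i.1).card : ℝ≥0∞)).sum := by
    rw [hq]
    split_ifs with h
    · simp
    · calc _ = ENNReal.ofReal (T ^ (E - 1) * (β * Q)) := by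
            rw [← ENNReal.ofReal_mul hβ.le]; congr 1; ring
        _ ≤ ENNReal.ofReal (T ^ (E - 1) * T) := ENNReal.ofReal_le_ofReal (by gcongr)
        _ = ENNReal.ofReal (T ^ E) * 1 := by
          rw [Real.rpow_sub_one hT0.ne', div_mul_cancel₀ _ hT0.ne', mul_one]
        _ ≤ _ := by gcongr; exact one_le_sum_presentPartners h
  have h3 := expect_step_frozenWeight_add_le hU he hε hX0 hX
  rw [← ENNReal.mul_le_iff_le_inv hβ0 ENNReal.ofReal_ne_top]
  calc _ ≤ ENNReal.ofReal β * (R.step G X).expect (fun Y => ENNReal.ofReal (T ^ E) *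
        potential (R.frozenWeight X.types U) Y + q) := by gcongr; exact PMF.expect_mono h1
    _ = ENNReal.ofReal (T ^ E) * (ENNReal.ofReal β * (R.step G X).expect
        (potential (R.frozenWeight X.types U))) + ENNReal.ofReal β * q := by
      rw [PMF.expect_add, PMF.expect_mul_left, PMF.expect_const]
      ring
    _ ≤ ENNReal.ofReal (T ^ E) * (ENNReal.ofReal β * (R.step G X).expect
        (potential (R.frozenWeight X.types U)) +
        (X.map fun i => ((R.presentPartners X.types i.1).card : ℝ≥0∞)).sum) := by
      rw [mul_add]; gcongr
    _ ≤ _ := mul_le_mul' le_rfl h3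

/-- If the numbers of vertices are bounded, the probability not to be in equilibrium decreases
geometrically, also if the system is not agential. -/
theorem IsEnergy.law_le_of_card_le (he : R.IsEnergy e)
    {J : Type*} {V : J → Type u} [∀ j, Fintype (V j)] [∀ j, DecidableEq (V j)]
    (G : ∀ j, SimpleGraph (V j)) [∀ j, DecidableRel (G j).Adj] {γ : ℝ} (hγ : 0 < γ)
    (hV : ∀ j, 0 < Fintype.card (V j)) (hG : ∀ j, HasWalkGap (G j) γ)
    (X₀ : ∀ j, Config ι (V j)) (hX₀ : ∀ j, (X₀ j).card ≤ Fintype.card (V j))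
    {N : ℕ} (hN : ∀ j, Fintype.card (V j) ≤ N) :
    ∃ η D : ℝ, ∃ A : ℕ, 0 < η ∧ 1 ≤ D ∧ ∀ j t,
      R.law (G j) (X₀ j) {ω | ¬ R.IsEquilibrium (ω t)} ≤
        ((ENNReal.ofReal (1 + η / Fintype.card (V j)))⁻¹) ^ t *
          ENNReal.ofReal (D * (Fintype.card (V j) : ℝ) ^ A) := by
  set K : ℝ := 1 + ∑ c, |e c| with hK
  have hsum0 : 0 ≤ ∑ c, |e c| := Finset.sum_nonneg fun _ _ => abs_nonneg _
  have hK1 : 1 ≤ K := by linarith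
  obtain ⟨η, D, A, hη, hD, hlyap⟩ :=
    IsEnergy.exists_isLyapunov.{u} he (ε := 1 / (N + 1)) hγ (by positivity) hK1
  set q := Fintype.card ι with hq
  set Q : ℝ := K * N * (q * (D * (N : ℝ) ^ A)) with hQ
  set T : ℝ := 1 + (1 + η) * Q with hT
  have hQ0 : 0 ≤ Q := by positivity
  have hT1 : 1 ≤ T := by
    have : 0 ≤ (1 + η) * Q := by positivity
    linarith
  -- The constant may depend on `N` exponentially, since `N` bounds all sizes in the family; no
  -- power of n is needed.
  refine ⟨η, 1 + T ^ (K * N) * Q, 0, hη, ?_, fun j t => ?_⟩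
  · have : 0 ≤ T ^ (K * N) * Q := by positivity
    linarith
  set n : ℝ := (Fintype.card (V j) : ℝ) with hn
  have hn1 : 1 ≤ n := by rw [hn]; exact_mod_cast hV j
  have hnN : n ≤ N := by rw [hn]; exact_mod_cast hN j
  obtain ⟨U, hU⟩ := hlyap (V j) (G j) (hV j) (hG j)
  set B : ℝ := D * n ^ A with hB
  have hB0 : 0 ≤ B := by positivity
  set β : ℝ := 1 + η / n with hβ
  have hβ0 : 0 < β := by positivity
  have hβ1 : β ≤ 1 + η := by
    have : η / n ≤ η := div_le_self hη.le hn1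
    linarith
  have hBQ : K * n * (q * B) ≤ Q := by rw [hB, hQ]; gcongr
  have hε : 1 / ((N : ℝ) + 1) * n ≤ 1 := by
    rw [div_mul_eq_mul_div, one_mul, div_le_one (by positivity)]
    linarith
  set I : Set (Config ι (V j)) := {X | R.MeanFieldReachable (X₀ j).types X.types} with hI
  have hen₀ : energy e (X₀ j) ≤ K * n := by
    have h2 := energy_le_card e (X₀ j)
    have h3 : ((X₀ j).card : ℝ) ≤ n := by rw [hn]; exact_mod_cast hX₀ j
    have h4 : (∑ c, |e c|) * ((X₀ j).card : ℝ) ≤ (∑ c, |e c|) * n := by gcongr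
    rw [hK]
    linarith
  have hIen : ∀ X ∈ I, energy e X ≤ K * n := by
    intro X hX
    have h1 := he.sum_le_of_reachable hX
    rw [← energy_eq_types, ← energy_eq_types] at h1
    linarith
  have hTβ : β * (K * n * (q * B)) ≤ T := by
    calc β * (K * n * (q * B)) ≤ (1 + η) * Q := by gcongr
      _ ≤ T := by linarith
  have hmain := markovChainLaw_le_of_drift (R.step (G j)) (X₀ j)
    (R.frozenPotential e T U) (ENNReal.ofReal β)⁻¹ (by simp) I
    (Relation.ReflTransGen.refl) (fun X hX Y hY => MeanFieldReachable.of_mem_step hX hY)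
    (fun X hX => expect_step_frozenPotential_le hU he hε (hIen X hX) hT1 hβ0 hTβ)
    {X | ¬ R.IsEquilibrium X}
    (fun X hX hne => one_le_frozenPotential hU he hε (hIen X hX) hT1 hne) t
  refine hmain.trans (mul_le_mul' le_rfl ?_)
  have hcard : ((X₀ j).card : ℝ≥0∞) ≤ ENNReal.ofReal (K * n) := by
    rw [← ENNReal.ofReal_natCast]
    exact ENNReal.ofReal_le_ofReal ((card_le_energy he.one_le _).trans hen₀)
  calc R.frozenPotential e T U (X₀ j)
      ≤ ENNReal.ofReal (T ^ (K * N)) * (ENNReal.ofReal (K * n) * (q * ENNReal.ofReal B)) := by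
        refine mul_le_mul' (ENNReal.ofReal_le_ofReal (Real.rpow_le_rpow_of_exponent_le hT1 ?_))
          ((potential_frozenWeight_le hU _ _).trans (mul_le_mul' hcard le_rfl))
        calc energy e (X₀ j) ≤ K * n := hen₀
          _ ≤ K * N := by gcongr
    _ = ENNReal.ofReal (T ^ (K * N) * (K * n * (q * B))) := by
      rw [← ENNReal.ofReal_natCast q, ← ENNReal.ofReal_mul (by positivity),
        ← ENNReal.ofReal_mul (by positivity), ← ENNReal.ofReal_mul (by positivity)]
    _ ≤ _ := by
      refine ENNReal.ofReal_le_ofReal ?_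
      rw [pow_zero, mul_one]
      have : T ^ (K * N) * (K * n * (q * B)) ≤ T ^ (K * N) * Q := by gcongr
      linarith

end PersistentPair

end ParticleSystem

/-! ### From geometric tails to the equilibrium time -/

/-- After taking logarithms this is log(1 + η/n) ≥ η/(n + η) ≥ (η/(1 + η))/n, where the last
inequality uses n ≥ 1. -/
theorem pow_le_one_add_div_pow {η n : ℝ} (hη : 0 < η) (hn : 1 ≤ n) {A t : ℕ}
    (ht : A / (η / (1 + η)) * n * Real.log n ≤ t) : n ^ A ≤ (1 + η / n) ^ t := by
  have hn0 : 0 < n := by linarith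
  have hβ : 0 < 1 + η / n := by positivity
  have h1 : η / (1 + η) / n ≤ Real.log (1 + η / n) := by
    refine le_trans ?_ (Real.one_sub_inv_le_log_of_pos hβ)
    have h2 : 1 - (1 + η / n)⁻¹ = η / (n + η) := by field_simp; ring
    rw [h2, div_div]
    refine div_le_div_of_nonneg_left hη.le (by positivity) ?_
    nlinarith
  have h2 : A * Real.log n ≤ t * (η / (1 + η) / n) := by
    calc A * Real.log n = A / (η / (1 + η)) * n * Real.log n * (η / (1 + η) / n) := by
          field_simp
      _ ≤ _ := by gcongr
  rw [← Real.log_le_log_iff (by positivity) (by positivity), Real.log_pow, Real.log_pow]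
  exact h2.trans (by gcongr)

/-! ### Summation of geometric tails -/

section Tail

variable {Ω : Type*} [MeasurableSpace Ω] (μ : MeasureTheory.Measure Ω)
  [MeasureTheory.IsProbabilityMeasure μ] {E : ℕ → Set Ω} {η D n : ℝ} {A : ℕ}

theorem measure_le_div_of_geometric (hη : 0 < η) (hn : 1 ≤ n)
    (hE : ∀ t, μ (E t) ≤ ((ENNReal.ofReal (1 + η / n))⁻¹) ^ t * ENNReal.ofReal (D * n ^ A)) {t : ℕ}
    (ht : (A + 1 : ℕ) / (η / (1 + η)) * n * Real.log n ≤ t) :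
    μ (E t) ≤ ENNReal.ofReal (D / n) := by
  have hn0 : 0 < n := by linarith
  have hβ : 0 < 1 + η / n := by positivity
  refine (hE t).trans ?_
  rw [← ENNReal.ofReal_inv_of_pos hβ, ← ENNReal.ofReal_pow (by positivity),
    ← ENNReal.ofReal_mul (by positivity)]
  by_cases hD : D ≤ 0
  · rw [ENNReal.ofReal_of_nonpos]
    · exact zero_le
    · exact mul_nonpos_of_nonneg_of_nonpos (by positivity)
        (mul_nonpos_of_nonpos_of_nonneg hD (by positivity))
  push Not at hD
  refine ENNReal.ofReal_le_ofReal ?_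
  have h1 := pow_le_one_add_div_pow hη hn ht
  rw [inv_pow, inv_mul_le_iff₀ (by positivity)]
  calc D * n ^ A = n ^ (A + 1) * (D / n) := by field_simp; ring
    _ ≤ _ := by gcongr

/-- Up to the time `t₀` at which the geometric factor has absorbed n^A, probabilities are bounded by
1; the remaining geometric series is of order n. The factor 2 and the summand 1 use log n ≥ 1/2,
which holds for n ≥ 2. -/
theorem tsum_measure_le_of_geometric (hη : 0 < η) (hn : 2 ≤ n) (hD : 0 ≤ D)
    (hE : ∀ t, μ (E t) ≤ ((ENNReal.ofReal (1 + η / n))⁻¹) ^ t * ENNReal.ofReal (D * n ^ A)) :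
    ∑' t, μ (E t) ≤ ENNReal.ofReal
      ((A / (η / (1 + η)) + 1 + 2 * (D / (η / (1 + η)))) * n * Real.log n) := by
  have hn0 : 0 < n := by linarith
  have hn1 : 1 ≤ n := by linarith
  have hlog : 1 / 2 ≤ Real.log n := by
    have := Real.log_le_log two_pos hn
    have := Real.log_two_gt_d9
    linarith
  set r := η / (1 + η) with hr
  have hr0 : 0 < r := by positivity
  set β := 1 + η / n with hβ
  have hβ0 : 0 < β := by positivity
  have hβ1 : 1 < β := by rw [hβ]; have : 0 < η / n := by positivity
                         linarith
  set t₀ := ⌈A / r * n * Real.log n⌉₊ with ht₀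
  have hpow : n ^ A ≤ β ^ t₀ := pow_le_one_add_div_pow hη hn1 (Nat.le_ceil _)
  have htail : ∀ t, μ (E (t + t₀)) ≤ ENNReal.ofReal D * (ENNReal.ofReal β⁻¹) ^ t := by
    intro t
    refine (hE _).trans ?_
    rw [← ENNReal.ofReal_inv_of_pos hβ0, ← ENNReal.ofReal_pow (by positivity),
      ← ENNReal.ofReal_mul (by positivity), ← ENNReal.ofReal_pow (by positivity),
      ← ENNReal.ofReal_mul hD]
    refine ENNReal.ofReal_le_ofReal ?_
    rw [pow_add]
    have h1 : β⁻¹ ^ t₀ * n ^ A ≤ 1 := by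
      rw [inv_pow, inv_mul_le_iff₀ (by positivity), mul_one]; exact hpow
    calc β⁻¹ ^ t * β⁻¹ ^ t₀ * (D * n ^ A) = D * β⁻¹ ^ t * (β⁻¹ ^ t₀ * n ^ A) := by ring
      _ ≤ D * β⁻¹ ^ t * 1 := by gcongr
      _ = _ := mul_one _
  have hgeom : ∑' t : ℕ, ENNReal.ofReal D * (ENNReal.ofReal β⁻¹) ^ t ≤ ENNReal.ofReal (D / r * n) := by
    have h1 : 0 < 1 - β⁻¹ := by
      have := inv_lt_one_of_one_lt₀ hβ1
      linarith
    rw [ENNReal.tsum_mul_left, ENNReal.tsum_geometric, ← ENNReal.ofReal_one,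
      ← ENNReal.ofReal_sub _ (by positivity), ← ENNReal.ofReal_inv_of_pos h1,
      ← ENNReal.ofReal_mul hD]
    refine ENNReal.ofReal_le_ofReal ?_
    have h2 : (1 - β⁻¹)⁻¹ = (n + η) / η := by
      rw [hβ]; field_simp; ring_nf; field_simp
    have h3 : (n + η) / η ≤ n / r := by
      rw [hr, div_div_eq_mul_div]
      gcongr
      nlinarith
    calc D * (1 - β⁻¹)⁻¹ ≤ D * (n / r) := by rw [h2]; gcongr
      _ = _ := by ring
  rw [← ENNReal.summable.sum_add_tsum_nat_add' (k := t₀)]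
  calc _ ≤ ∑ t ∈ Finset.range t₀, (1 : ℝ≥0∞) + ENNReal.ofReal (D / r * n) := by
        gcongr
        · exact MeasureTheory.prob_le_one
        · exact (ENNReal.tsum_le_tsum htail).trans hgeom
    _ = ENNReal.ofReal (t₀ + D / r * n) := by
        rw [ENNReal.ofReal_add (by positivity) (by positivity)]
        simp
    _ ≤ _ := by
      refine ENNReal.ofReal_le_ofReal ?_
      have h1 := (Nat.ceil_lt_add_one (by positivity : 0 ≤ A / r * n * Real.log n)).le
      have h2 : 1 ≤ n * Real.log n := by nlinarith
      have h3 : D / r * n ≤ 2 * (D / r) * n * Real.log n := by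
        have : 0 ≤ D / r * n := by positivity
        nlinarith
      nlinarith

end Tail

namespace ParticleSystem

variable {ι : Type*} [Fintype ι] [DecidableEq ι] {R : ParticleSystem ι}

/-- Two reactive persistent types would each have at least εn particles forever; this forces n <
2/ε, so that the family has bounded size. Otherwise the weighted potential of the ephemeral
particles applies. -/
theorem exists_law_le {J : Type*} {V : J → Type*} [∀ j, Fintype (V j)] [∀ j, DecidableEq (V j)]
    (hR : R.Dissipative) (G : ∀ j, SimpleGraph (V j)) [∀ j, DecidableRel (G j).Adj]
    (hG : IsRegularExpanderFamily G) (X₀ : ∀ j, Config ι (V j))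
    (hX₀ : ∀ j, (X₀ j).card ≤ Fintype.card (V j))
    (hA : R.Agential (fun j => Fintype.card (V j)) (fun j => (X₀ j).types)) :
    ∃ η D : ℝ, ∃ A : ℕ, 0 < η ∧ 1 ≤ D ∧ ∀ j t,
      R.law (G j) (X₀ j) {ω | ¬ R.IsEquilibrium (ω t)} ≤
        ((ENNReal.ofReal (1 + η / Fintype.card (V j)))⁻¹) ^ t *
          ENNReal.ofReal (D * (Fintype.card (V j) : ℝ) ^ A) := by
  obtain ⟨c, hc, hG⟩ := hG
  obtain ⟨e, he⟩ := hR.exists_isEnergy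
  have hV : ∀ j, 0 < Fintype.card (V j) := fun j => by
    obtain ⟨-, d, h, -⟩ := hG j
    omega
  have hgap : ∀ j, HasWalkGap (G j) (2 * c) := fun j => by
    obtain ⟨hconn, d, h, hd, hgap⟩ := hG j
    exact hasWalkGap_of_secondEigenvalue (G j) hconn hd h hc hgap
  by_cases hPP : ∀ a b, R.Persistent (fun j => Fintype.card (V j)) (fun j => (X₀ j).types) a →
      R.Persistent (fun j => Fintype.card (V j)) (fun j => (X₀ j).types) b →
      ¬ R.HasEffectiveReaction a b
  · exact he.law_le_of_no_persistent_pair G (by positivity) hV hgap X₀ hX₀ hA hPP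
  · push Not at hPP
    obtain ⟨a, b, ha, hb, hab⟩ := hPP
    obtain ⟨ε, hε, h⟩ := Persistent.exists_uniform (R := R) (fun j => Fintype.card (V j))
      (fun j => (X₀ j).types)
    refine he.law_le_of_card_le G (by positivity) hV hgap X₀ hX₀ (N := ⌈2 / ε⌉₊) fun j => ?_
    have h1 := he.card_lt_of_reactive hab (fun m hm => h a ha j m hm) (fun m hm => h b hb j m hm)
    have h2 : (Fintype.card (V j) : ℝ) ≤ 2 / ε := by
      rw [le_div_iff₀ hε]
      linarith
    exact_mod_cast h2.trans (Nat.le_ceil _)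

end ParticleSystem

end

theorem theorem4 {ι : Type*} [Fintype ι] [DecidableEq ι] (R : ParticleSystem ι)
    (hR : R.Dissipative)
    {J : Type*} {V : J → Type*} [∀ j, Fintype (V j)] [∀ j, DecidableEq (V j)]
    (G : ∀ j, SimpleGraph (V j)) [∀ j, DecidableRel (G j).Adj]
    (hG : IsRegularExpanderFamily G)
    (X₀ : ∀ j, Config ι (V j))
    (hX₀ : ∀ j, (X₀ j).card ≤ Fintype.card (V j))
    (hA : R.Agential (fun j => Fintype.card (V j)) (fun j => (X₀ j).types)) :
    ∃ C : ℝ, 0 < C ∧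
      (∀ η : ℝ≥0∞, 0 < η → ∃ N : ℕ, ∀ j, N ≤ Fintype.card (V j) →
        R.law (G j) (X₀ j)
          {ω | ENNReal.ofReal (C * Fintype.card (V j) * Real.log (Fintype.card (V j))) <
            (R.equilibriumTime ω : ℝ≥0∞)} ≤ η) ∧
      (∀ j, ∫⁻ ω, (R.equilibriumTime ω : ℝ≥0∞) ∂(R.law (G j) (X₀ j)) ≤
        ENNReal.ofReal (C * Fintype.card (V j) * Real.log (Fintype.card (V j)))) := by
  obtain ⟨η, D, A, hη, hD, htail⟩ := ParticleSystem.exists_law_le hR G hG X₀ hX₀ hA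
  have hn2 : ∀ j, (2 : ℝ) ≤ Fintype.card (V j) := fun j => by
    obtain ⟨c, hc, hG⟩ := hG
    obtain ⟨-, d, h, -⟩ := hG j
    exact_mod_cast h
  have hprob : ∀ j, MeasureTheory.IsProbabilityMeasure (R.law (G j) (X₀ j)) := fun j =>
    markovChainLaw.instIsProbabilityMeasure _ _
  set r := η / (1 + η) with hr
  have hr0 : 0 < r := by positivity
  have hD0 : 0 < D := by linarith
  -- One constant for both claims: A + 1 instead of A leaves a spare factor 1/n in the probability
  -- bound, the summand 1 absorbs the rounding of times, and 2D/r bounds the geometric tail in the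
  -- expectation.
  refine ⟨(A + 1) / r + 1 + 2 * (D / r), by positivity, ?_, ?_⟩
  · intro δ hδ
    obtain ⟨N, hN⟩ : ∃ N : ℕ, ∀ n : ℝ, 0 < n → N ≤ n → ENNReal.ofReal (D / n) ≤ δ := by
      by_cases hδt : δ = ∞
      · exact ⟨0, fun n _ _ => hδt ▸ le_top⟩
      have hδ0 : 0 < δ.toReal := ENNReal.toReal_pos hδ.ne' hδt
      refine ⟨⌈D / δ.toReal⌉₊, fun n hn0 hn => ENNReal.ofReal_le_of_le_toReal ?_⟩
      rw [div_le_comm₀ hn0 hδ0]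
      exact (Nat.le_ceil _).trans hn
    refine ⟨N, fun j hj => ?_⟩
    have hn := hn2 j
    set n : ℝ := (Fintype.card (V j) : ℝ) with hn'
    have hlog : 1 / 2 ≤ Real.log n := by
      have := Real.log_le_log two_pos hn
      have := Real.log_two_gt_d9
      linarith
    set x := ((A + 1) / r + 1 + 2 * (D / r)) * n * Real.log n with hx
    have hx0 : 0 ≤ x := by positivity
    have := hprob j
    calc _ ≤ R.law (G j) (X₀ j) {ω | ¬ R.IsEquilibrium (ω ⌊x⌋₊)} :=
          MeasureTheory.measure_mono fun ω hω =>
            R.not_isEquilibrium_of_lt_equilibriumTime ω x hx0 hω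
      _ ≤ ENNReal.ofReal (D / n) := by
        refine measure_le_div_of_geometric (R.law (G j) (X₀ j))
          (E := fun t => {ω | ¬ R.IsEquilibrium (ω t)}) hη (by linarith) (htail j) ?_
        have h1 := (Nat.lt_floor_add_one x).le
        have h2 : 1 ≤ n * Real.log n := by nlinarith
        have h3 : 0 ≤ 2 * (D / r) * (n * Real.log n) := by positivity
        push_cast
        rw [← hr]
        nlinarith
      _ ≤ δ := hN n (by linarith) (by rw [hn']; exact_mod_cast hj)
  · intro j
    have := hprob j
    have hn := hn2 j
    have hlog : 0 ≤ Real.log (Fintype.card (V j)) := Real.log_nonneg (by linarith)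
    calc ∫⁻ ω, (R.equilibriumTime ω : ℝ≥0∞) ∂(R.law (G j) (X₀ j))
        ≤ ∫⁻ ω, ∑' t, {X | ¬ R.IsEquilibrium X}.indicator 1 (ω t) ∂(R.law (G j) (X₀ j)) :=
          MeasureTheory.lintegral_mono fun ω => R.equilibriumTime_le_tsum ω
      _ = ∑' t, R.law (G j) (X₀ j) {ω | ¬ R.IsEquilibrium (ω t)} := by
        have hm : ∀ t, MeasurableSet {ω : ℕ → Config ι (V j) | ¬ R.IsEquilibrium (ω t)} :=
          fun t => (measurable_pi_apply t : Measurable fun ω : ℕ → Config ι (V j) => ω t)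
            (MeasurableSet.of_discrete (s := {X | ¬ R.IsEquilibrium X}))
        rw [MeasureTheory.lintegral_tsum]
        · refine tsum_congr fun t => ?_
          rw [← MeasureTheory.lintegral_indicator_one (hm t)]
          rfl
        · exact fun t => ((measurable_one.indicator MeasurableSet.of_discrete).comp
            (measurable_pi_apply t)).aemeasurable
      _ ≤ _ := tsum_measure_le_of_geometric (R.law (G j) (X₀ j))
          (E := fun t => {ω | ¬ R.IsEquilibrium (ω t)}) hη hn hD0.le (htail j)
      _ ≤ _ := by
        refine ENNReal.ofReal_le_ofReal ?_
        rw [← hr]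
        gcongr
        linarith
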